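/- Let $\mathbf F_q$ be a finite field with $q$ elements and algebraic closure $\overline{\mathbf F}_q$. Let $\varphi$ be Euler's totient function and $\psi(k)=k\prod_{p\mid k}(1+1/p)$, the product being over the primes $p$ dividing $k$. For positive integers $d\mid n$ let $$w(d,n)=\sum_{[E]}\frac{1}{\#\operatorname{Aut}_{\mathbf F_q}(E)},$$ the sum running over the $\mathbf F_q$-isomorphism classes of elliptic curves $E$ over $\mathbf F_q$ with $E[n](\mathbf F_q)\cong(\mathbf Z/d\mathbf Z)\times(\mathbf Z/n\mathbf Z)$. Let $m,n$ be positive integers with $m\mid\gcd(n,q-1)$, and let $\zeta_m\in\mathbf F_q$ be a primitive $m$-th root of unity. Let $y(m,n)$ be the (unweighted) number of $\overline{\mathbf F}_q$-isomorphism classes of triples $(E,P,Q)$, where $E$ is an elliptic curve over $\mathbf F_q$ and $P,Q\in E(\mathbf F_q)$ are points of order $m$ and $n$, respectively, such that $e_m(P,(n/m)Q)=\zeta_m$, where $e_m$ is the Weil pairing on $E[m]$. Here $(E,P,Q)$ and $(E',P',Q')$ are $\overline{\mathbf F}_q$-isomorphic if there is an isomorphism $E_{\overline{\mathbf F}_q}\to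 E'_{\overline{\mathbf F}_q}$ of elliptic curves over $\overline{\mathbf F}_q$ that takes $P$ to $P'$ and $Q$ to $Q'$. Then $$y(m,n)=m\,\varphi(n)\,\psi(n)\sum_{d\,:\;m\mid d\mid\gcd(n,q-1)}\frac{w(d,n)}{\psi(n/d)}.$$ -/

import Mathlib

/-!
Elliptic curves are given by Weierstrass equations of nonzero discriminant, and isomorphisms
(of elliptic curves, so preserving the origin) by admissible changes of variables.
-/

noncomputable section

namespace EllCount

open WeierstrassCurve Polynomial
open scoped Classical Polynomial.Bivariate

universe u v

/-! ### Elliptic curves up to isomorphism and weighted cardinality -/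

/-- Elliptic curves over the field `K`. -/
abbrev EllCurve (K : Type u) [Field K] : Type u :=
  {E : WeierstrassCurve K // E.IsElliptic}

/-- `K`-isomorphism of elliptic curves over `K`. -/
def isoSetoid (K : Type u) [Field K] : Setoid (EllCurve K) where
  r E E' := ∃ C : VariableChange K, C • E.1 = E'.1
  iseqv :=
    { refl := fun E => ⟨1, one_smul _ _⟩
      symm := by
        rintro E E' ⟨C, h⟩
        exact ⟨C⁻¹, by rw [← h, inv_smul_smul]⟩
      trans := by
        rintro E E' E'' ⟨C, h⟩ ⟨C', h'⟩
        exact ⟨C' * C, by rw [mul_smul, h, h']⟩ }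

/-- The set of `K`-isomorphism classes of elliptic curves over `K`. -/
def IsoClass (K : Type u) [Field K] : Type u := Quotient (isoSetoid K)

/-- The group `Aut_K(E)`. -/
abbrev Aut {K : Type u} [Field K] (E : WeierstrassCurve K) : Subgroup (VariableChange K) :=
  MulAction.stabilizer (VariableChange K) E

/-- `#Aut_K(E)` as a function of the isomorphism class of `E`. -/
def autCard {K : Type u} [Field K] (c : IsoClass K) : ℕ :=
  Quotient.lift (s := isoSetoid K) (fun E => Nat.card (Aut E.1))
    (by
      rintro E E' ⟨C, h⟩
      have hr : MulAction.orbitRel (VariableChange K) (WeierstrassCurve K) E'.1 E.1 := ⟨C, h⟩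
      exact (Nat.card_congr
        (MulAction.stabilizerEquivStabilizerOfOrbitRel hr).toEquiv).symm) c

/-- The weighted cardinality of a set of isomorphism classes of elliptic curves. -/
def weightedCard {K : Type u} [Field K] (S : Set (IsoClass K)) : ℚ :=
  ∑ᶠ c ∈ S, 1 / (autCard c : ℚ)

/-- The `K`-isomorphism classes of elliptic curves `E` over `K` with
`E[n](K) ≅ ℤ/m × ℤ/n`. -/
def classesW (K : Type u) [Field K] (m n : ℕ) : Set (IsoClass K) :=
  {c | ∃ E : EllCurve K, Quotient.mk (isoSetoid K) E = c ∧
    Nonempty (AddSubgroup.torsionBy E.1.toAffine.Point (n : ℤ) ≃+ ZMod m × ZMod n)}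

/-! ### The Weil pairing -/

section Weil

variable {K : Type u} [Field K]

/-- The ideal of a point in the affine coordinate ring (the unit ideal for the point at
infinity). -/
def pointIdeal {W : Affine K} : W.Point → Ideal W.CoordinateRing
  | .zero => ⊤
  | .some x y _ => Affine.CoordinateRing.XYIdeal W x (C y)

/-- The value of a polynomial function at an affine point (`0` by convention at infinity). -/
def evalPt {W : Affine K} (f : K[X][Y]) : W.Point → K
  | .zero => 0
  | .some x y _ => f.evalEval x y

/-- `IsWeilPairing W m S T ζ` says `e_m(S, T) = ζ`, for an elliptic curve `W` over an algebraically
closed field in which `m ≠ 0` and for points `S`, `T` of `W` killed by `m`. As usual, take a function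
`f` with divisor `m(T) - m(O)`; it is regular outside infinity, so the condition on its divisor is
that it generates the `m`-th power of the ideal of `T` in the coordinate ring. Take a rational
function `g = a / b` with `g ^ m = f ∘ [m]`. Then `e_m(S, T) = g(X + S) / g(X)`. All identities of
rational functions are tested at all but finitely many points `X`. -/
def IsWeilPairing (W : Affine K) (m : ℕ) (S T : W.Point) (ζ : K) : Prop :=
  ∃ f a b : K[X][Y],
    Ideal.span {Affine.CoordinateRing.mk W f} = pointIdeal T ^ m ∧
    (∀ᶠ X : W.Point in Filter.cofinite,
      evalPt b X ≠ 0 ∧ (evalPt a X / evalPt b X) ^ m = evalPt f (m • X)) ∧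
    (∀ᶠ X : W.Point in Filter.cofinite,
      evalPt a (X + S) / evalPt b (X + S) = ζ * (evalPt a X / evalPt b X))

end Weil

/-! ### Triples `(E, P, Q)` -/

/-- The map `E(K) → E(L)`, `P ↦ P_L`. -/
def pointBase {K : Type u} [Field K] (L : Type v) [Field L] [Algebra K L]
    (E : WeierstrassCurve K) : E.toAffine.Point → (E.baseChange L).toAffine.Point
  | .zero => .zero
  | .some x y h => .some (algebraMap K L x) (algebraMap K L y)
      ((Affine.map_nonsingular E (algebraMap K L).injective x y).mpr h)

/-- If `C • W = W'`, this says that the isomorphism `W ≅ W'` attached to `C` takes `P` to `P'`: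
in coordinates, it is the inverse of `(x', y') ↦ (u²x' + r, u³y' + u²sx' + t)`. -/
def Maps {L : Type u} [Field L] (C : VariableChange L) {W W' : Affine L} :
    W.Point → W'.Point → Prop
  | .zero, .zero => True
  | .some x y _, .some x' y' _ =>
      x = (C.u : L) ^ 2 * x' + C.r ∧ y = (C.u : L) ^ 3 * y' + (C.u : L) ^ 2 * C.s * x' + C.t
  | .zero, .some _ _ _ => False
  | .some _ _ _, .zero => False

theorem maps_one {L : Type u} [Field L] {W : Affine L} (P : W.Point) : Maps 1 P P := by
  cases P <;> simp [Maps, VariableChange.one_def]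

theorem maps_inv {L : Type u} [Field L] {C : VariableChange L} {W W' : Affine L}
    {P : W.Point} {P' : W'.Point} (h : Maps C P P') : Maps C⁻¹ P' P := by
  rcases P with _ | ⟨x, y, _⟩ <;> rcases P' with _ | ⟨x', y', _⟩ <;>
    simp only [Maps, VariableChange.inv_def] at h ⊢
  obtain ⟨rfl, rfl⟩ := h
  have hu : (C.u : L) ≠ 0 := C.u.ne_zero
  simp only [Units.val_inv_eq_inv_val]
  constructor <;> field_simp <;> ring

theorem maps_mul {L : Type u} [Field L] {C C' : VariableChange L} {W W' W'' : Affine L}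
    {P : W.Point} {P' : W'.Point} {P'' : W''.Point} (h : Maps C P P') (h' : Maps C' P' P'') :
    Maps (C' * C) P P'' := by
  rcases P with _ | ⟨x, y, _⟩ <;> rcases P' with _ | ⟨x', y', _⟩ <;>
    rcases P'' with _ | ⟨x'', y'', _⟩ <;> simp only [Maps, VariableChange.mul_def] at h h' ⊢
  obtain ⟨rfl, rfl⟩ := h
  obtain ⟨rfl, rfl⟩ := h'
  simp only [Units.val_mul]
  constructor <;> ring

/-- Triples `(E, P, Q)` with `E` an elliptic curve over `K` and `P, Q ∈ E(K)` of orders `m` and `n`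
such that `e_m(P, (n/m)Q) = ζ`. -/
structure Triple (K : Type u) [Field K] (ζ : K) (m n : ℕ) where
  E : WeierstrassCurve K
  isElliptic : E.IsElliptic
  P : E.toAffine.Point
  Q : E.toAffine.Point
  orderP : addOrderOf P = m
  orderQ : addOrderOf Q = n
  pairing : IsWeilPairing (E.baseChange (AlgebraicClosure K)).toAffine m
    (pointBase (AlgebraicClosure K) E P) (pointBase (AlgebraicClosure K) E ((n / m) • Q))
    (algebraMap K (AlgebraicClosure K) ζ)

/-- `L`-isomorphism of triples over `K`. -/
def tripleSetoid (L : Type v) (K : Type u) [Field K] [Field L] [Algebra K L] (ζ : K) (m n : ℕ) :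
    Setoid (Triple K ζ m n) where
  r t t' := ∃ C : VariableChange L, C • t.E.baseChange L = t'.E.baseChange L ∧
    Maps C (pointBase L t.E t.P) (pointBase L t'.E t'.P) ∧
    Maps C (pointBase L t.E t.Q) (pointBase L t'.E t'.Q)
  iseqv :=
    { refl := fun t => ⟨1, one_smul _ _, maps_one _, maps_one _⟩
      symm := by
        rintro t t' ⟨C, h, hP, hQ⟩
        exact ⟨C⁻¹, by rw [← h, inv_smul_smul], maps_inv hP, maps_inv hQ⟩
      trans := by
        rintro t t' t'' ⟨C, h, hP, hQ⟩ ⟨C', h', hP', hQ'⟩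
        exact ⟨C' * C, by rw [mul_smul, h, h'], maps_mul hP hP', maps_mul hQ hQ'⟩ }

/-- The set `Y(L/K; ζ, m, n)` of `L`-isomorphism classes of triples `(E, P, Q)` over `K`. -/
def ClassesY (L : Type v) (K : Type u) [Field K] [Field L] [Algebra K L] (ζ : K) (m n : ℕ) :
    Type u :=
  Quotient (tripleSetoid L K ζ m n)

/-! ### The numbers in the formula -/

/-- `ψ(n) = n ∏_{p ∣ n} (1 + 1/p)`. -/
def psi (n : ℕ) : ℚ := n * ∏ p ∈ n.primeFactors, (1 + 1 / (p : ℚ))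

/-- `w(m, n)`: the weighted number of curves with `E[n](K) ≅ ℤ/m × ℤ/n`. -/
def w (K : Type u) [Field K] (m n : ℕ) : ℚ := weightedCard (classesW K m n)

/-- `y(m, n)`: the number of `K̄`-isomorphism classes of triples over `K`. -/
def y (K : Type u) [Field K] (ζ : K) (m n : ℕ) : ℕ :=
  Nat.card (ClassesY (AlgebraicClosure K) K ζ m n)

end EllCount

end

/-! Let G be the group of admissible changes of variables. Weierstrass equations are counted instead
of classes, and the factor #G(F) is cancelled at the end. The triples in one class over the
algebraic closure are the Frobenius-fixed elements of a single G-orbit with finite stabiliser. By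
Lang's theorem for G there are exactly #G(F) of them (`card_triple_class`). Hence y(m,n)·#G(F) is
the number of all triples over F, although y carries no weights. By orbit-stabiliser an F-class of
curves consists of #G(F)/#Aut equations, so w(d,n)·#G(F) is the number of equations with the
prescribed torsion (`w_mul_card`). It remains to count the pairs (P, Q) on one curve (`card_pairs`).

If E has a rational point of order n, then E[n](F) ≅ ℤ/d × ℤ/n for one d ∣ n, because E[k] has at
most k² points (`exists_equiv_zmod_prod`). A triple forces m ∣ d: since e_m is alternating, P and
(n/m)Q are independent as soon as they pair to a primitive root (`card_tors_of_isWeilPairing`). It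
forces d ∣ q − 1: rational points pair to rational roots of unity (`dvd_card_sub_one`). Conversely,
for such a d there are φ(n)ψ(n)/ψ(n/d) points Q of order n (`card_addOrderOf_eq`). Each has exactly
m partners P, which form a coset of the kernel of e_m(·, (n/m)Q) on the m² points of E[m]
(`card_isWeilPairing`). Summing over curves gives the formula.

Most of the file develops the Weil pairing as it is defined here, over an algebraically closed
field. Rational functions are germs of functions on the set of points, and points over the function
field are rational maps to the curve, so the group law on maps is the group law of E over that
field. The height bound h(nG) ≤ n² for the generic point G bounds the degree of [n]. It gives #E[n]
≤ n², and in case of equality the functions invariant under E[n] are exactly the pullbacks along [n]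
(`exists_mulPull_eq`). The invariant derivation excludes equality when n vanishes in the field
(`card_tors_lt`).

A function f with divisor m(T) − m(O) satisfies a reciprocity law with lines (`exists_lineRes_eq`).
This gives an addition formula for f (`exists_fAt_add`) and from it an m-th root g of f ∘ [m]. The
pairing is the character S ↦ τ_S g / g (`exists_weilHom`). It takes every m-th root of unity as a
value if #E[m] = m² and T has order m: otherwise some power of g would descend along [m] and produce
a regular function with one simple pole (`exists_isWeilPairing`). It is alternating because the
product of the translates of f by the multiples of T is constant (`isWeilPairing_self`). -/

noncomputable section
namespace EllCount
open WeierstrassCurve Polynomial Filter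
open scoped Classical Polynomial.Bivariate

/-! ### Rational functions as germs of functions on the set of points -/

section Germs

variable {K : Type*} [Field K] {W : Affine K}

/-- The first coordinate of a point (`0` at infinity). -/
def xCoord : W.Point → K
  | .zero => 0
  | .some x _ _ => x

/-- The second coordinate of a point (`0` at infinity). -/
def yCoord : W.Point → K
  | .zero => 0
  | .some _ y _ => y

@[simp] lemma xCoord_some {x y : K} (h : W.Nonsingular x y) : xCoord (.some x y h) = x := rfl
@[simp] lemma yCoord_some {x y : K} (h : W.Nonsingular x y) : yCoord (.some x y h) = y := rfl

@[simp] lemma evalPt_some (f : K[X][Y]) {x y : K} (h : W.Nonsingular x y) :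
    evalPt f (.some x y h) = f.evalEval x y := rfl

lemma eventually_ne (P : W.Point) : ∀ᶠ X : W.Point in cofinite, X ≠ P := by
  rw [eventually_cofinite]
  simp

lemma finite_xCoord_eq (x : K) : {P : W.Point | P ≠ 0 ∧ xCoord P = x}.Finite := by
  by_cases h : ∃ P : W.Point, P ≠ 0 ∧ xCoord P = x
  · obtain ⟨P, hP, hx⟩ := h
    refine (Set.toFinite {P, -P}).subset ?_
    rintro Q ⟨hQ, hQx⟩
    rcases P with _ | ⟨x₁, y₁, h₁⟩
    · exact absurd rfl hP
    rcases Q with _ | ⟨x₂, y₂, h₂⟩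
    · exact absurd rfl hQ
    simp only [xCoord_some] at hx hQx
    exact Affine.Point.X_eq_iff.mp (hQx.trans hx.symm)
  · convert! Set.finite_empty
    ext P
    simp only [Set.mem_ofPred_eq, Set.mem_empty_iff_false, iff_false]
    exact fun hP => h ⟨P, hP⟩

lemma eventually_xCoord_notMem {s : Set K} (hs : s.Finite) :
    ∀ᶠ X : W.Point in cofinite, X ≠ 0 ∧ xCoord X ∉ s := by
  refine (eventually_ne 0).and ?_
  rw [eventually_cofinite]
  refine ((Set.finite_singleton (0 : W.Point)).union
    (hs.biUnion fun x _ => finite_xCoord_eq (W := W) x)).subset ?_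
  intro P hP
  simp only [Set.mem_ofPred_eq, not_not] at hP
  by_cases h0 : P = 0
  · exact Or.inl h0
  · exact Or.inr (Set.mem_biUnion hP ⟨h0, rfl⟩)

/-- Evaluation of regular functions at an affine point. -/
def evalAt {x y : K} (h : W.Equation x y) : W.CoordinateRing →+* K :=
  AdjoinRoot.lift (evalRingHom x) y (by
    rw [eval₂_evalRingHom]
    exact h)

@[simp] lemma evalAt_mk {x y : K} (h : W.Equation x y) (f : K[X][Y]) :
    evalAt h (Affine.CoordinateRing.mk W f) = f.evalEval x y := by
  simp [evalAt, eval₂_evalRingHom]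

/-- The norm to K[X] is the product of an element and its conjugate. It reduces zeros and poles of
arbitrary regular functions to those of polynomials in x. -/
lemma exists_dvd_C (a : W.CoordinateRing) (ha : a ≠ 0) :
    ∃ N : K[X], N ≠ 0 ∧ a ∣ algebraMap K[X] W.CoordinateRing N := by
  refine ⟨Algebra.norm K[X] a, ?_, ?_⟩
  · have : Module.Finite K[X] W.CoordinateRing := .of_basis (Affine.CoordinateRing.basis W)
    exact Algebra.norm_ne_zero_iff.mpr ha
  · obtain ⟨p, q, rfl⟩ := Affine.CoordinateRing.exists_smul_basis_eq a
    have := Affine.CoordinateRing.coe_norm_smul_basis (W' := W) p q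
    rw [map_mul] at this
    have h2 : p • (1 : W.CoordinateRing) + q • Affine.CoordinateRing.mk W Y =
        Affine.CoordinateRing.mk W (C p + C q * Y) := by
      simp [Affine.CoordinateRing.smul]
    rw [h2] at this ⊢
    exact ⟨_, this⟩

lemma eventually_evalPt_ne_zero {f : K[X][Y]} (hf : Affine.CoordinateRing.mk W f ≠ 0) :
    ∀ᶠ X : W.Point in cofinite, evalPt f X ≠ 0 := by
  obtain ⟨N, hN, c, hc⟩ := exists_dvd_C _ hf
  filter_upwards [eventually_xCoord_notMem (W := W) (s := {x | N.IsRoot x})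
    (Polynomial.finite_setOfPred_isRoot hN)] with P hP
  rcases P with _ | ⟨x, y, h⟩
  · exact absurd rfl hP.1
  intro h0
  apply hP.2
  have := congrArg (evalAt h.1) hc
  rw [map_mul, evalAt_mk, show f.evalEval x y = 0 from h0, zero_mul] at this
  have h3 : algebraMap K[X] W.CoordinateRing N = Affine.CoordinateRing.mk W (C N) := rfl
  rw [h3, evalAt_mk] at this
  simpa [evalEval] using this

variable (W) in
/-- The germ of functions defined by a polynomial. -/
def polyGerm : K[X][Y] →+* Germ (cofinite : Filter W.Point) K :=
  eval₂RingHom (eval₂RingHom ((Germ.coeRingHom _).comp (Pi.constRingHom W.Point K))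
    ((xCoord : W.Point → K) : Germ cofinite K)) ((yCoord : W.Point → K) : Germ cofinite K)

lemma polyGerm_apply (f : K[X][Y]) : polyGerm W f = ((evalPt f : W.Point → K) : Germ _ K) := by
  have key : ∀ f : K[X][Y], polyGerm W f =
      ((fun P => f.evalEval (xCoord P) (yCoord P) : W.Point → K) : Germ _ K) := by
    intro f
    induction f using Polynomial.induction_on' with
    | add p q hp hq => rw [map_add, hp, hq]; simp only [evalEval_add]; rfl
    | monomial n a =>
      have h1 : ∀ a : K[X], eval₂RingHom ((Germ.coeRingHom _).comp (Pi.constRingHom W.Point K))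
          ((xCoord : W.Point → K) : Germ cofinite K) a =
          ((fun P => a.eval (xCoord P) : W.Point → K) : Germ _ K) := by
        intro a
        induction a using Polynomial.induction_on' with
        | add p q hp hq => rw [map_add, hp, hq]; simp only [eval_add]; rfl
        | monomial n a =>
          simp only [coe_eval₂RingHom, eval₂_monomial, eval_monomial]
          rfl
      have h2 : polyGerm W (monomial n a) =
          eval₂RingHom ((Germ.coeRingHom _).comp (Pi.constRingHom W.Point K))
          ((xCoord : W.Point → K) : Germ cofinite K) a *
          ((yCoord : W.Point → K) : Germ cofinite K) ^ n := by
        simp only [polyGerm, coe_eval₂RingHom, eval₂_monomial]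
      rw [h2, h1]
      simp only [← C_mul_X_pow_eq_monomial, evalEval_mul, evalEval_C, evalEval_pow, evalEval_X]
      rfl
  -- At infinity `evalPt` is 0 by convention, whereas the polynomial at (0, 0) need not vanish.
  -- Germs along the cofinite filter ignore this single point.
  rw [key, Germ.coe_eq]
  filter_upwards [eventually_ne 0] with P hP
  rcases P with _ | ⟨x, y, h⟩
  · exact absurd rfl hP
  · rfl

variable (W) in
/-- The germ of functions defined by a regular function. -/
def regularGerm : W.CoordinateRing →+* Germ (cofinite : Filter W.Point) K :=
  Ideal.Quotient.lift _ (polyGerm W) (by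
    intro f hf
    obtain ⟨g, rfl⟩ := Ideal.mem_span_singleton.mp hf
    rw [map_mul]
    have : polyGerm W W.polynomial = 0 := by
      rw [polyGerm_apply]
      refine Germ.coe_eq.mpr ?_
      filter_upwards with P
      rcases P with _ | ⟨x, y, h⟩
      · rfl
      · exact h.1
    rw [this, zero_mul])

@[simp] lemma regularGerm_mk (f : K[X][Y]) : regularGerm W (Affine.CoordinateRing.mk W f) =
    ((evalPt f : W.Point → K) : Germ _ K) :=
  (Ideal.Quotient.lift_mk _ _ _).trans (polyGerm_apply f)

lemma isUnit_regularGerm {a : W.CoordinateRing} (ha : a ≠ 0) : IsUnit (regularGerm W a) := by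
  obtain ⟨f, rfl⟩ := AdjoinRoot.mk_surjective a
  refine IsUnit.of_mul_eq_one (((fun P => (evalPt f P)⁻¹ : W.Point → K)) : Germ _ K) ?_
  rw [regularGerm_mk]
  refine Germ.coe_eq.mpr ?_
  filter_upwards [eventually_evalPt_ne_zero ha] with P hP
  exact mul_inv_cancel₀ hP

variable (W) (L : Type*) [Field L] [Algebra W.CoordinateRing L] [IsFractionRing W.CoordinateRing L]

/-- The germ of functions defined by a rational function. -/
def germ : L →+* Germ (cofinite : Filter W.Point) K :=
  IsLocalization.lift (M := nonZeroDivisors W.CoordinateRing) (g := regularGerm W)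
    (fun a => isUnit_regularGerm (nonZeroDivisors.ne_zero a.2))

variable {L}

@[simp] lemma germ_algebraMap (a : W.CoordinateRing) :
    germ W L (algebraMap _ L a) = regularGerm W a := IsLocalization.lift_eq _ _

lemma germ_mk (f : K[X][Y]) : germ W L (algebraMap _ L (Affine.CoordinateRing.mk W f)) =
    ((evalPt f : W.Point → K) : Germ _ K) := by rw [germ_algebraMap, regularGerm_mk]

/-- A function on points represents a rational function if it agrees with it almost everywhere. -/
def Rep (h : L) (φ : W.Point → K) : Prop := germ W L h = (φ : Germ cofinite K)

variable {W}

lemma exists_rep (h : L) : ∃ φ, Rep W h φ := by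
  obtain ⟨φ, hφ⟩ := Quotient.exists_rep (germ W L h)
  exact ⟨φ, hφ.symm⟩

namespace Rep

variable {h h' : L} {φ φ' : W.Point → K}

lemma congr (H : Rep W h φ) (H' : φ =ᶠ[cofinite] φ') : Rep W h φ' := by
  rw [Rep, H]; exact Germ.coe_eq.mpr H'

lemma eq (H : Rep W h φ) (H' : Rep W h φ') : φ =ᶠ[cofinite] φ' :=
  Germ.coe_eq.mp (Eq.trans (Eq.symm H) H')

lemma add (H : Rep W h φ) (H' : Rep W h' φ') : Rep W (h + h') (fun P => φ P + φ' P) := by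
  rw [Rep, map_add, H, H']; rfl

lemma sub (H : Rep W h φ) (H' : Rep W h' φ') : Rep W (h - h') (fun P => φ P - φ' P) := by
  rw [Rep, map_sub, H, H']; rfl

lemma mul (H : Rep W h φ) (H' : Rep W h' φ') : Rep W (h * h') (fun P => φ P * φ' P) := by
  rw [Rep, map_mul, H, H']; rfl

lemma neg (H : Rep W h φ) : Rep W (-h) (fun P => -φ P) := by
  rw [Rep, map_neg, H]; rfl

lemma pow (H : Rep W h φ) (n : ℕ) : Rep W (h ^ n) (fun P => φ P ^ n) := by
  rw [Rep, map_pow, H]; rfl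

lemma ne_zero (H : Rep W h φ) (h0 : h ≠ 0) : ∀ᶠ P in cofinite, φ P ≠ 0 := by
  obtain ⟨ψ, hψ⟩ := exists_rep (W := W) h⁻¹
  have h1 := H.mul hψ
  rw [mul_inv_cancel₀ h0, Rep, map_one] at h1
  have h2 : (fun _ => 1 : W.Point → K) =ᶠ[cofinite] _ := Germ.coe_eq.mp h1
  filter_upwards [h2] with P hP h3
  rw [h3, zero_mul] at hP
  exact one_ne_zero hP

lemma inv (H : Rep W h φ) : Rep W h⁻¹ (fun P => (φ P)⁻¹) := by
  by_cases h0 : h = 0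
  · subst h0
    rw [Rep, map_zero] at H
    have h2 : (fun _ => 0 : W.Point → K) =ᶠ[cofinite] _ := Germ.coe_eq.mp H
    rw [Rep, inv_zero, map_zero]
    refine Germ.coe_eq.mpr ?_
    filter_upwards [h2] with P hP
    rw [← hP, inv_zero]
  · obtain ⟨ψ, hψ⟩ := exists_rep (W := W) h⁻¹
    have h1 := H.mul hψ
    rw [mul_inv_cancel₀ h0, Rep, map_one] at h1
    have h2 : (fun _ => 1 : W.Point → K) =ᶠ[cofinite] _ := Germ.coe_eq.mp h1
    refine hψ.congr ?_
    filter_upwards [h2] with P hP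
    exact (inv_eq_of_mul_eq_one_right hP.symm).symm

lemma div (H : Rep W h φ) (H' : Rep W h' φ') : Rep W (h / h') (fun P => φ P / φ' P) := by
  simp only [div_eq_mul_inv]
  exact H.mul H'.inv

end Rep

lemma rep_mk (f : K[X][Y]) : Rep W (algebraMap _ L (Affine.CoordinateRing.mk W f)) (evalPt f) :=
  germ_mk W f

lemma exists_rep_div (h : L) : ∃ a b : K[X][Y], Affine.CoordinateRing.mk W b ≠ 0 ∧
    h = algebraMap _ L (Affine.CoordinateRing.mk W a) /
      algebraMap _ L (Affine.CoordinateRing.mk W b) ∧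
    Rep W h (fun P => evalPt a P / evalPt b P) := by
  obtain ⟨a, b, hb, rfl⟩ := IsFractionRing.div_surjective (A := W.CoordinateRing) h
  obtain ⟨a, rfl⟩ := AdjoinRoot.mk_surjective a
  obtain ⟨b, rfl⟩ := AdjoinRoot.mk_surjective b
  exact ⟨a, b, nonZeroDivisors.ne_zero hb, rfl, (rep_mk a).div (rep_mk b)⟩

end Germs

end EllCount
end

noncomputable section
namespace EllCount
open WeierstrassCurve Polynomial Filter
open scoped Classical Polynomial.Bivariate

set_option linter.unusedSectionVars false

/-! ### Base change of points -/

section PointBase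

variable {K : Type*} [Field K]

lemma point_some_congr {W : Affine K} {x y x' y' : K} {h : W.Nonsingular x y}
    {h' : W.Nonsingular x' y'} (hx : x = x') (hy : y = y') :
    Affine.Point.some x y h = .some x' y' h' := by
  subst hx hy; rfl

lemma pointBase_add (L : Type*) [Field L] [Algebra K L] (E : WeierstrassCurve K)
    (P Q : E.toAffine.Point) : pointBase L E (P + Q) = pointBase L E P + pointBase L E Q := by
  rcases P with _ | ⟨x₁, y₁, h₁⟩
  · simp only [← Affine.Point.zero_def, zero_add]
    exact (zero_add (pointBase L E Q)).symm
  rcases Q with _ | ⟨x₂, y₂, h₂⟩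
  · simp only [← Affine.Point.zero_def, add_zero]
    exact (add_zero (pointBase L E _)).symm
  have inj := (algebraMap K L).injective
  by_cases hxy : x₁ = x₂ ∧ y₁ = E.toAffine.negY x₂ y₂
  · rw [Affine.Point.add_of_Y_eq hxy.1 hxy.2]
    refine (Affine.Point.add_of_Y_eq (congrArg _ hxy.1) ?_).symm
    rw [hxy.2]
    exact (Affine.map_negY (W' := E.toAffine) (algebraMap K L) x₂ y₂).symm
  · rw [Affine.Point.add_some hxy]
    have h' : ¬ (algebraMap K L x₁ = algebraMap K L x₂ ∧
        algebraMap K L y₁ = (E.baseChange L).toAffine.negY (algebraMap K L x₂)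
          (algebraMap K L y₂)) := by
      rintro ⟨hx, hy⟩
      refine hxy ⟨inj hx, inj (hy.trans ?_)⟩
      exact Affine.map_negY (W' := E.toAffine) (algebraMap K L) x₂ y₂
    refine Eq.trans ?_ (Affine.Point.add_some h').symm
    have hs := Affine.map_slope (W := E.toAffine) (algebraMap K L) x₁ x₂ y₁ y₂
    refine point_some_congr ?_ ?_
    · rw [← Affine.map_addX, ← hs]; rfl
    · rw [← Affine.map_addY, ← hs]; rfl

/-- `pointBase` as a group homomorphism. -/
def pointHom (L : Type*) [Field L] [Algebra K L] (E : WeierstrassCurve K) :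
    E.toAffine.Point →+ (E.baseChange L).toAffine.Point :=
  AddMonoidHom.mk' (pointBase L E) (pointBase_add L E)

lemma pointHom_apply (L : Type*) [Field L] [Algebra K L] (E : WeierstrassCurve K)
    (P : E.toAffine.Point) : pointHom L E P = pointBase L E P := rfl

lemma pointHom_some (L : Type*) [Field L] [Algebra K L] (E : WeierstrassCurve K) {x y : K}
    (h : E.toAffine.Nonsingular x y) : pointHom L E (.some x y h) =
      .some (algebraMap K L x) (algebraMap K L y)
      ((Affine.map_nonsingular E (algebraMap K L).injective x y).mpr h) := rfl

lemma pointHom_injective (L : Type*) [Field L] [Algebra K L] (E : WeierstrassCurve K) :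
    Function.Injective (pointHom L E) := by
  rw [injective_iff_map_eq_zero]
  rintro (_ | ⟨x, y, h⟩) h0
  · rfl
  · rw [pointHom_some] at h0
    exact absurd h0 (Affine.Point.some_ne_zero _)

instance (L : Type*) [Field L] [Algebra K L] (E : WeierstrassCurve K) [E.IsElliptic] :
    (E.baseChange L).IsElliptic := inferInstanceAs (E.map (algebraMap K L)).IsElliptic

end PointBase

/-! ### Points over the function field and maps on points -/

section Spec

variable {K : Type*} [Field K] {W : Affine K} {L : Type*} [Field L]
  [Algebra W.CoordinateRing L] [IsFractionRing W.CoordinateRing L] [Algebra K L]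
  [IsScalarTower K W.CoordinateRing L]

lemma rep_const (c : K) : Rep W (algebraMap K L c) (fun _ => c) := by
  rw [IsScalarTower.algebraMap_apply K W.CoordinateRing L]
  have : algebraMap K W.CoordinateRing c = Affine.CoordinateRing.mk W (C (C c)) := rfl
  rw [this]
  refine (rep_mk _).congr ?_
  filter_upwards [eventually_ne 0] with P hP
  rcases P with _ | ⟨x, y, h⟩
  · exact absurd rfl hP
  · simp

variable (W L) in
/-- The coordinate function `x` in the function field. -/
def fX : L := algebraMap W.CoordinateRing L (Affine.CoordinateRing.mk W (C X))

variable (W L) in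
/-- The coordinate function `y` in the function field. -/
def fY : L := algebraMap W.CoordinateRing L (Affine.CoordinateRing.mk W X)

lemma rep_fX : Rep W (fX W L) xCoord := by
  refine (rep_mk _).congr ?_
  filter_upwards [eventually_ne 0] with P hP
  rcases P with _ | ⟨x, y, h⟩
  · exact absurd rfl hP
  · simp [evalEval]

lemma rep_fY : Rep W (fY W L) yCoord := by
  refine (rep_mk _).congr ?_
  filter_upwards [eventually_ne 0] with P hP
  rcases P with _ | ⟨x, y, h⟩
  · exact absurd rfl hP
  · simp

/-- The map `π` on points is given almost everywhere by the point `P` over the function field. -/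
def Spec : (W.baseChange L).toAffine.Point → (W.Point → W.Point) → Prop
  | .zero, π => ∀ᶠ X in cofinite, π X = 0
  | .some x y _, π => (∀ᶠ X in cofinite, π X ≠ 0) ∧ Rep W x (fun X => xCoord (π X)) ∧
      Rep W y (fun X => yCoord (π X))

namespace Spec

variable {P P' : (W.baseChange L).toAffine.Point} {π π' : W.Point → W.Point}

lemma congr (H : Spec P π) (h : π =ᶠ[cofinite] π') : Spec P π' := by
  rcases P with _ | ⟨x, y, hP⟩
  · filter_upwards [show ∀ᶠ X in cofinite, π X = 0 from H, h] with X h1 h2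
    rw [← h2, h1]
  · refine ⟨?_, H.2.1.congr ?_, H.2.2.congr ?_⟩
    · filter_upwards [H.1, h] with X h1 h2
      rwa [← h2]
    · filter_upwards [h] with X h2
      rw [h2]
    · filter_upwards [h] with X h2
      rw [h2]

lemma eq (H : Spec P π) (H' : Spec P π') : π =ᶠ[cofinite] π' := by
  rcases P with _ | ⟨x, y, hP⟩
  · filter_upwards [show ∀ᶠ X in cofinite, π X = 0 from H,
      show ∀ᶠ X in cofinite, π' X = 0 from H'] with X h1 h2
    rw [h1, h2]
  · filter_upwards [H.1, H'.1, H.2.1.eq H'.2.1, H.2.2.eq H'.2.2] with X h1 h2 h3 h4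
    generalize π X = A at *
    generalize π' X = B at *
    rcases A with _ | ⟨x, y, hA⟩
    · exact absurd rfl h1
    rcases B with _ | ⟨x', y', hB⟩
    · exact absurd rfl h2
    · simp_all

lemma neg (H : Spec P π) : Spec (-P) (fun X => -π X) := by
  rcases P with _ | ⟨x, y, hP⟩
  · filter_upwards [show ∀ᶠ X in cofinite, π X = 0 from H] with X h1
    rw [h1, neg_zero]
  · obtain ⟨h0, hx, hy⟩ := H
    refine ⟨?_, hx.congr ?_, ?_⟩
    · filter_upwards [h0] with X hX
      simpa using hX
    · filter_upwards with X
      rcases π X with _ | ⟨x, y, h⟩ <;> rfl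
    · refine (((hy.neg).sub ((rep_const W.a₁).mul hx)).sub (rep_const W.a₃)).congr ?_
      filter_upwards [h0] with X hX
      generalize π X = A at *
      rcases A with _ | ⟨x, y, h⟩
      · exact absurd rfl hX
      · rfl

/-- The formula for the slope depends on equalities between coordinates. An equality in `L` holds at
almost all points and an inequality in `L` also persists at almost all points, so the same branch of
the definition applies pointwise almost everywhere. -/
lemma rep_slope {x₁ x₂ y₁ y₂ : L} {h₁ : (W.baseChange L).toAffine.Nonsingular x₁ y₁}
    {h₂ : (W.baseChange L).toAffine.Nonsingular x₂ y₂}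
    (H : Spec (.some x₁ y₁ h₁) π) (H' : Spec (.some x₂ y₂ h₂) π')
    (hxy : ¬ (x₁ = x₂ ∧ y₁ = (W.baseChange L).toAffine.negY x₂ y₂)) :
    Rep W ((W.baseChange L).toAffine.slope x₁ x₂ y₁ y₂) (fun X =>
      W.slope (xCoord (π X)) (xCoord (π' X)) (yCoord (π X)) (yCoord (π' X))) ∧
    ∀ᶠ X in cofinite, ¬ (xCoord (π X) = xCoord (π' X) ∧
      yCoord (π X) = W.negY (xCoord (π' X)) (yCoord (π' X))) := by
  obtain ⟨h0, hx, hy⟩ := H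
  obtain ⟨h0', hx', hy'⟩ := H'
  by_cases hx12 : x₁ = x₂
  · have hy12 : y₁ ≠ (W.baseChange L).toAffine.negY x₂ y₂ := fun h => hxy ⟨hx12, h⟩
    have hxe := hx.eq (hx12 ▸ hx')
    have hne : ∀ᶠ X in cofinite,
        yCoord (π X) ≠ W.negY (xCoord (π' X)) (yCoord (π' X)) := by
      have := (hy.sub (((hy'.neg).sub ((rep_const W.a₁).mul hx')).sub
        (rep_const W.a₃))).ne_zero (sub_ne_zero.mpr hy12)
      filter_upwards [this] with X hX
      exact sub_ne_zero.mp hX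
    refine ⟨?_, hne.mono fun X hX h => hX h.2⟩
    rw [Affine.slope_of_Y_ne hx12 hy12]
    have := ((((rep_const (L := L) (3 : K)).mul (hx.pow 2)).add (((rep_const (2 : K)).mul
      (rep_const W.a₂)).mul hx)).add (rep_const W.a₄)).sub ((rep_const W.a₁).mul hy)
    have h2 := this.div (hy.sub (((hy.neg).sub ((rep_const W.a₁).mul hx)).sub
        (rep_const W.a₃)))
    simp only [map_ofNat] at h2
    refine Rep.congr h2 ?_
    filter_upwards [hxe, hne] with X h3 h4
    rw [Affine.slope_of_Y_ne h3 h4]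
    rfl
  · have hne : ∀ᶠ X in cofinite, xCoord (π X) ≠ xCoord (π' X) := by
      filter_upwards [(hx.sub hx').ne_zero (sub_ne_zero.mpr hx12)] with X hX
      exact sub_ne_zero.mp hX
    refine ⟨?_, hne.mono fun X hX h => hX h.1⟩
    rw [Affine.slope_of_X_ne hx12]
    refine ((hy.sub hy').div (hx.sub hx')).congr ?_
    filter_upwards [hne] with X h3
    rw [Affine.slope_of_X_ne h3]

/-- The group law over the function field is pointwise addition of maps. Facts about translations
and multiplication by integers can therefore be proved on either side. -/
lemma add (H : Spec P π) (H' : Spec P' π') : Spec (P + P') (fun X => π X + π' X) := by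
  rcases P with _ | ⟨x₁, y₁, h₁⟩
  · rw [← Affine.Point.zero_def, zero_add]
    refine H'.congr ?_
    filter_upwards [show ∀ᶠ X in cofinite, π X = 0 from H] with X hX
    rw [hX, zero_add]
  rcases P' with _ | ⟨x₂, y₂, h₂⟩
  · rw [← Affine.Point.zero_def, add_zero]
    refine H.congr ?_
    filter_upwards [show ∀ᶠ X in cofinite, π' X = 0 from H'] with X hX
    rw [hX, add_zero]
  by_cases hxy : x₁ = x₂ ∧ y₁ = (W.baseChange L).toAffine.negY x₂ y₂
  · rw [Affine.Point.add_of_Y_eq hxy.1 hxy.2]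
    obtain ⟨h0, hx, hy⟩ := H
    obtain ⟨h0', hx', hy'⟩ := H'
    have h3 := (hxy.1 ▸ hx).eq hx'
    have h4 := (hxy.2 ▸ hy).eq (((hy'.neg).sub ((rep_const W.a₁).mul hx')).sub (rep_const W.a₃))
    change ∀ᶠ X in cofinite, π X + π' X = 0
    filter_upwards [h0, h0', h3, h4] with X g1 g2 g3 g4
    generalize π X = A at *
    generalize π' X = B at *
    rcases A with _ | ⟨x, y, hA⟩
    · exact absurd rfl g1
    rcases B with _ | ⟨x', y', hB⟩
    · exact absurd rfl g2
    exact Affine.Point.add_of_Y_eq g3 g4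
  · rw [Affine.Point.add_some hxy]
    obtain ⟨hs, hne⟩ := rep_slope H H' hxy
    obtain ⟨h0, hx, hy⟩ := H
    obtain ⟨h0', hx', hy'⟩ := H'
    have hX := ((((hs.pow 2).add ((rep_const W.a₁).mul hs)).sub (rep_const W.a₂)).sub hx).sub hx'
    have hnY := (hs.mul (hX.sub hx)).add hy
    have hY := ((hnY.neg).sub ((rep_const W.a₁).mul hX)).sub (rep_const W.a₃)
    have key : ∀ᶠ X in cofinite, ∃ h, π X + π' X = .some
        (W.addX (xCoord (π X)) (xCoord (π' X))
          (W.slope (xCoord (π X)) (xCoord (π' X)) (yCoord (π X)) (yCoord (π' X))))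
        (W.addY (xCoord (π X)) (xCoord (π' X)) (yCoord (π X))
          (W.slope (xCoord (π X)) (xCoord (π' X)) (yCoord (π X)) (yCoord (π' X)))) h := by
      filter_upwards [h0, h0', hne] with X g1 g2 g3
      generalize π X = A at *
      generalize π' X = B at *
      rcases A with _ | ⟨x, y, hA⟩
      · exact absurd rfl g1
      rcases B with _ | ⟨x', y', hB⟩
      · exact absurd rfl g2
      exact ⟨_, Affine.Point.add_some g3⟩
    refine ⟨?_, Rep.congr hX ?_, Rep.congr hY ?_⟩
    · filter_upwards [key] with X ⟨h, e⟩
      rw [e]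
      exact Affine.Point.some_ne_zero _
    · filter_upwards [key] with X ⟨h, e⟩
      rw [e]; rfl
    · filter_upwards [key] with X ⟨h, e⟩
      rw [e]; rfl

lemma zero : Spec (0 : (W.baseChange L).toAffine.Point) (fun _ => 0) :=
  Eventually.of_forall fun _ => rfl

lemma nsmul (H : Spec P π) (n : ℕ) : Spec (n • P) (fun X => n • π X) := by
  induction n with
  | zero => simpa using zero
  | succ n ih => simpa [succ_nsmul] using ih.add H

lemma const (S : W.Point) : Spec (pointHom L W S) (fun _ => S) := by
  rcases S with _ | ⟨x, y, h⟩
  · exact zero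
  · exact ⟨Eventually.of_forall fun _ => Affine.Point.some_ne_zero _, rep_const x, rep_const y⟩

variable [Infinite W.Point]

lemma injective (H : Spec P π) (H' : Spec P' π) : P = P' := by
  have H2 : Spec (P - P') (fun _ => 0) := by
    simpa [sub_eq_add_neg] using H.add H'.neg
  rw [← sub_eq_zero]
  generalize P - P' = Q at H2
  rcases Q with _ | ⟨x, y, h⟩
  · rfl
  · have := H2.1.exists
    simp at this

end Spec

lemma algebraMap_mk_eq (f : K[X][Y]) :
    algebraMap W.CoordinateRing L (Affine.CoordinateRing.mk W f) =
      (f.map (mapRingHom (algebraMap K L))).evalEval (fX W L) (fY W L) := by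
  have : (algebraMap W.CoordinateRing L).comp (Affine.CoordinateRing.mk W) =
      (evalEvalRingHom (fX W L) (fY W L)).comp (mapRingHom (mapRingHom (algebraMap K L))) := by
    ext c
    · simp only [RingHom.coe_comp, Function.comp_apply, coe_mapRingHom, map_C, coe_evalRingHom,
        eval_C]
      exact (IsScalarTower.algebraMap_apply K W.CoordinateRing L c).symm
    · simp [fX]
    · simp [fY]
  exact RingHom.congr_fun this f

variable (W L) in
lemma generic_equation : (W.baseChange L).toAffine.Equation (fX W L) (fY W L) := by
  have h := algebraMap_mk_eq (W := W) (L := L) W.polynomial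
  rw [AdjoinRoot.mk_self, map_zero, ← Affine.map_polynomial] at h
  exact h.symm

variable (W L) in
/-- The generic point. -/
def generic [W.IsElliptic] : (W.baseChange L).toAffine.Point :=
  .some (fX W L) (fY W L) (Affine.equation_iff_nonsingular.mp (generic_equation W L))

lemma Spec.generic [W.IsElliptic] : Spec (generic W L) id :=
  ⟨eventually_ne 0, rep_fX, rep_fY⟩

end Spec

lemma infinite_point {K : Type*} [Field K] [IsAlgClosed K] (W : Affine K) [W.IsElliptic] :
    Infinite W.Point := by
  have : Infinite K := IsAlgClosed.instInfinite
  have key : ∀ x : K, ∃ y : K, W.Equation x y := by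
    intro x
    obtain ⟨y, hy⟩ := IsAlgClosed.exists_root (k := K)
      (W.polynomial.map (evalRingHom x)) (by
        rw [Affine.monic_polynomial.degree_map, Affine.degree_polynomial]
        norm_num)
    refine ⟨y, ?_⟩
    rwa [IsRoot, eval_map, eval₂_evalRingHom] at hy
  choose y hy using key
  refine Infinite.of_injective (fun x => (.some x (y x) (Affine.equation_iff_nonsingular.mp (hy x))
    : W.Point)) ?_
  intro x x' h
  simpa using congrArg xCoord h

end EllCount
end

noncomputable section
namespace EllCount
open WeierstrassCurve Polynomial Filter
open scoped Classical Polynomial.Bivariate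

set_option linter.unusedSectionVars false

/-! ### Pullback of rational functions along nonconstant points -/

section Pull

lemma exists_algebraMap_eq_of_isAlgebraic {K L : Type*} [Field K] [Field L] [Algebra K L]
    [IsAlgClosed K] {z : L} (hz : IsAlgebraic K z) : ∃ c, algebraMap K L c = z := by
  have h := IsAlgClosed.degree_eq_one_of_irreducible K (minpoly.irreducible hz.isIntegral)
  exact minpoly.mem_range_of_degree_eq_one K z h

lemma equation_baseChange {K : Type*} [Field K] {W : Affine K} {L : Type*} [Field L]
    [Algebra K L] (x y : L) : (W.baseChange L).toAffine.Equation x y ↔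
    y ^ 2 + algebraMap K L W.a₁ * x * y + algebraMap K L W.a₃ * y =
      x ^ 3 + algebraMap K L W.a₂ * x ^ 2 + algebraMap K L W.a₄ * x + algebraMap K L W.a₆ :=
  Affine.equation_iff x y

section EvalL

variable {K : Type*} [Field K] {W : Affine K} {L : Type*} [Field L] [Algebra K L]

lemma eval₂_polynomial_eq_zero {x y : L} (h : (W.baseChange L).toAffine.Equation x y) :
    eval₂ ((evalRingHom x).comp (mapRingHom (algebraMap K L))) y W.polynomial = 0 := by
  rw [← eval₂_map, eval₂_evalRingHom, ← Affine.map_polynomial]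
  exact h

/-- Evaluation of regular functions at a point over `L`. -/
def evalL {x y : L} (h : (W.baseChange L).toAffine.Equation x y) : W.CoordinateRing →ₐ[K] L where
  __ := AdjoinRoot.lift ((evalRingHom x).comp (mapRingHom (algebraMap K L))) y
    (eval₂_polynomial_eq_zero h)
  commutes' c := by
    have : algebraMap K W.CoordinateRing c = Affine.CoordinateRing.mk W (C (C c)) := rfl
    simp only [RingHom.toMonoidHom_eq_coe, OneHom.toFun_eq_coe, MonoidHom.toOneHom_coe,
      MonoidHom.coe_coe, this, AdjoinRoot.lift_mk]
    simp

lemma evalL_mk {x y : L} (h : (W.baseChange L).toAffine.Equation x y) (f : K[X][Y]) :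
    evalL h (Affine.CoordinateRing.mk W f) =
      (f.map (mapRingHom (algebraMap K L))).evalEval x y := by
  refine (AdjoinRoot.lift_mk (eval₂_polynomial_eq_zero h) f).trans ?_
  rw [← eval₂_map, eval₂_evalRingHom]

lemma evalL_injective {x y : L} (h : (W.baseChange L).toAffine.Equation x y)
    (hx : Transcendental K x) : Function.Injective (evalL h) := by
  rw [injective_iff_map_eq_zero]
  intro a ha
  by_contra h0
  obtain ⟨N, hN, c, hc⟩ := exists_dvd_C a h0
  have h1 := congrArg (evalL h) hc
  rw [map_mul, ha, zero_mul] at h1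
  have h3 : algebraMap K[X] W.CoordinateRing N = Affine.CoordinateRing.mk W (C N) := rfl
  rw [h3, evalL_mk] at h1
  refine hx ⟨N, hN, ?_⟩
  rw [aeval_def, eval₂_eq_eval_map]
  rw [Polynomial.map_C, evalEval_C] at h1
  simpa using h1

end EvalL

variable {K : Type*} [Field K] {W : Affine K} {L : Type*} [Field L]
  [Algebra W.CoordinateRing L] [IsFractionRing W.CoordinateRing L] [Algebra K L]
  [IsScalarTower K W.CoordinateRing L]

/-- With infinitely many points the cofinite filter is proper, so the ring of germs is nontrivial
and a field embeds in it. This is what allows identities in the function field to be checked at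
points. -/
lemma Rep.injective [Infinite W.Point] {h h' : L} {φ : W.Point → K} (H : Rep W h φ)
    (H' : Rep W h' φ) : h = h' := (germ W L).injective (Eq.trans H (Eq.symm H'))

/-- A point over the function field that is not a point over the base field. -/
def Nonconst (P : (W.baseChange L).toAffine.Point) : Prop := ∀ S : W.Point, P ≠ pointHom L W S

lemma Nonconst.ne_zero {P : (W.baseChange L).toAffine.Point} (hP : Nonconst P) : P ≠ 0 :=
  fun h => hP 0 (by rw [h, map_zero])

lemma Nonconst.neg {P : (W.baseChange L).toAffine.Point} (hP : Nonconst P) : Nonconst (-P) :=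
  fun S h => hP (-S) (by rw [map_neg, ← h, neg_neg])

lemma Nonconst.add_const {P : (W.baseChange L).toAffine.Point} (hP : Nonconst P) (S : W.Point) :
    Nonconst (P + pointHom L W S) :=
  fun S' h => hP (S' - S) (by rw [map_sub, ← h, add_sub_cancel_right])

lemma equation_coord {P : W.Point} (hP : P ≠ 0) : W.Equation (xCoord P) (yCoord P) := by
  rcases P with _ | ⟨x, y, h⟩
  · exact absurd rfl hP
  · exact h.1

lemma nonsingular_coord {P : W.Point} (hP : P ≠ 0) : W.Nonsingular (xCoord P) (yCoord P) := by
  rcases P with _ | ⟨x, y, h⟩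
  · exact absurd rfl hP
  · exact h

lemma some_coord {P : W.Point} (hP : P ≠ 0) :
    Affine.Point.some (xCoord P) (yCoord P) (nonsingular_coord hP) = P := by
  rcases P with _ | ⟨x, y, h⟩
  · exact absurd rfl hP
  · rfl

lemma Spec.coord {P : (W.baseChange L).toAffine.Point} {π : W.Point → W.Point} (H : Spec P π)
    (hP : P ≠ 0) : (∀ᶠ X in cofinite, π X ≠ 0) ∧ Rep W (xCoord P) (fun X => xCoord (π X)) ∧
      Rep W (yCoord P) (fun X => yCoord (π X)) := by
  rcases P with _ | ⟨x, y, h⟩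
  · exact absurd rfl hP
  · exact H

/-- An algebraic x lies in K because K is algebraically closed. The curve equation then makes y
integral over K, hence an element of K too, and the point is constant. -/
lemma Nonconst.transcendental [IsAlgClosed K] {P : (W.baseChange L).toAffine.Point}
    (hP : Nonconst P) : Transcendental K (xCoord P) := by
  intro halg
  have hne := hP.ne_zero
  rcases P with _ | ⟨x, y, h⟩
  · exact absurd rfl hne
  obtain ⟨c, rfl⟩ := exists_algebraMap_eq_of_isAlgebraic halg
  have hy : IsIntegral K y := by
    refine ⟨X ^ 2 + C (W.a₁ * c + W.a₃) * X - C (c ^ 3 + W.a₂ * c ^ 2 + W.a₄ * c + W.a₆),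
      ?_, ?_⟩
    · monicity!
    · have := (equation_baseChange _ _).mp h.1
      simp only [eval₂_sub, eval₂_add, eval₂_mul, eval₂_pow, eval₂_X, eval₂_C, map_add, map_mul,
        map_pow]
      linear_combination this
  obtain ⟨d, rfl⟩ := exists_algebraMap_eq_of_isAlgebraic hy.isAlgebraic
  exact hP (.some c d ((Affine.map_nonsingular W (algebraMap K L).injective c d).mp h)) rfl

/-- A nonconstant map has finite fibres: over a given affine point one of the coordinates minus its
value there is a nonzero function, and such a function has finitely many zeros. Properties valid
almost everywhere can thus be pulled back. -/
lemma Nonconst.tendsto {P : (W.baseChange L).toAffine.Point} (hP : Nonconst P)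
    {π : W.Point → W.Point} (H : Spec P π) : Tendsto π cofinite cofinite := by
  rw [Filter.tendsto_def]
  intro s hs
  have key : ∀ S : W.Point, ∀ᶠ X in cofinite, π X ≠ S := by
    intro S
    have hne := hP.ne_zero
    rcases P with _ | ⟨x, y, h⟩
    · exact absurd rfl hne
    rcases S with _ | ⟨a, b, hab⟩
    · exact H.1
    have : x ≠ algebraMap K L a ∨ y ≠ algebraMap K L b := by
      by_contra hcon
      push Not at hcon
      obtain ⟨rfl, rfl⟩ := hcon
      exact hP (.some a b hab) rfl
    rcases this with h1 | h1
    · filter_upwards [(H.2.1.sub (rep_const a)).ne_zero (sub_ne_zero.mpr h1)] with X hX hS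
      rw [hS] at hX
      simp at hX
    · filter_upwards [(H.2.2.sub (rep_const b)).ne_zero (sub_ne_zero.mpr h1)] with X hX hS
      rw [hS] at hX
      simp at hX
  rw [mem_cofinite] at hs ⊢
  have hfin : (⋃ S ∈ sᶜ, {X | π X = S}).Finite := hs.biUnion fun S _ => by
    simpa [eventually_cofinite] using key S
  refine hfin.subset fun X hX => ?_
  simp only [Set.mem_iUnion]
  exact ⟨π X, hX, rfl⟩

lemma rep_evalEval {x y : L} {φ ψ : W.Point → K} (hx : Rep W x φ) (hy : Rep W y ψ) (f : K[X][Y]) :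
    Rep W ((f.map (mapRingHom (algebraMap K L))).evalEval x y)
      (fun P => f.evalEval (φ P) (ψ P)) := by
  have h1 : ∀ p : K[X], Rep W ((p.map (algebraMap K L)).eval x) (fun P => p.eval (φ P)) := by
    intro p
    induction p using Polynomial.induction_on' with
    | add p q hp hq => simpa using hp.add hq
    | monomial n a => simpa using (rep_const a).mul (hx.pow n)
  induction f using Polynomial.induction_on' with
  | add p q hp hq => simpa using hp.add hq
  | monomial n a =>
    have e1 : (((monomial n a : K[X][Y])).map (mapRingHom (algebraMap K L))).evalEval x y =
        (a.map (algebraMap K L)).eval x * y ^ n := by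
      rw [Polynomial.map_monomial, ← C_mul_X_pow_eq_monomial, evalEval_mul, evalEval_C,
        evalEval_pow, evalEval_X, coe_mapRingHom]
    have e2 : ∀ s t : K, ((monomial n a : K[X][Y])).evalEval s t = a.eval s * t ^ n := by
      intro s t
      rw [← C_mul_X_pow_eq_monomial, evalEval_mul, evalEval_C, evalEval_pow, evalEval_X]
    rw [e1]
    simp only [e2]
    exact (h1 a).mul (hy.pow n)

variable [IsAlgClosed K]

/-- Pullback of rational functions along a nonconstant point over the function field. -/
def pull (P : (W.baseChange L).toAffine.Point) (hP : Nonconst P) : L →ₐ[K] L :=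
  IsFractionRing.liftAlgHom (g := evalL (equation_coord hP.ne_zero))
    (evalL_injective _ hP.transcendental)

lemma pull_algebraMap {P : (W.baseChange L).toAffine.Point} (hP : Nonconst P)
    (a : W.CoordinateRing) : pull P hP (algebraMap _ L a) = evalL (equation_coord hP.ne_zero) a :=
  IsFractionRing.lift_algebraMap (evalL_injective _ hP.transcendental) a

@[simp] lemma pull_fX {P : (W.baseChange L).toAffine.Point} (hP : Nonconst P) :
    pull P hP (fX W L) = xCoord P := by
  rw [fX, pull_algebraMap, evalL_mk]
  simp [evalEval]

@[simp] lemma pull_fY {P : (W.baseChange L).toAffine.Point} (hP : Nonconst P) :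
    pull P hP (fY W L) = yCoord P := by
  rw [fY, pull_algebraMap, evalL_mk]
  simp [evalEval]

lemma Rep.pull {P : (W.baseChange L).toAffine.Point} (hP : Nonconst P) {π : W.Point → W.Point}
    (H : Spec P π) {h : L} {φ : W.Point → K} (hφ : Rep W h φ) :
    Rep W (pull P hP h) (fun X => φ (π X)) := by
  have hpoly : ∀ f : K[X][Y], Rep W (EllCount.pull P hP
      (algebraMap _ L (Affine.CoordinateRing.mk W f))) (fun X => evalPt f (π X)) := by
    intro f
    rw [pull_algebraMap, evalL_mk]
    obtain ⟨h0, h1, h2⟩ := H.coord hP.ne_zero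
    refine (rep_evalEval h1 h2 f).congr ?_
    filter_upwards [h0] with X hX
    generalize π X = A at *
    rcases A with _ | ⟨x, y, h⟩
    · exact absurd rfl hX
    · rfl
  obtain ⟨a, b, -, hab, hrep⟩ := exists_rep_div (W := W) h
  have h1 : φ =ᶠ[cofinite] fun P => evalPt a P / evalPt b P := hφ.eq hrep
  rw [hab, map_div₀]
  refine ((hpoly a).div (hpoly b)).congr ?_
  exact ((hP.tendsto H).eventually h1).mono fun X hX => hX.symm

section Elliptic

variable [W.IsElliptic]

variable (W L) in
lemma nonconst_generic : Nonconst (generic W L) := by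
  intro S h
  have := infinite_point W
  have h1 : id =ᶠ[cofinite] fun _ => S := (Spec.generic (W := W) (L := L)).eq (h ▸ Spec.const S)
  obtain ⟨X, hX, hX'⟩ := (h1.and (eventually_ne S)).exists
  exact hX' hX

lemma nonconst_iff_of_spec {P : (W.baseChange L).toAffine.Point} {π : W.Point → W.Point}
    (H : Spec P π) : Nonconst P ↔ ∀ S, ¬ ∀ᶠ X in cofinite, π X = S := by
  have := infinite_point W
  refine forall_congr' fun S => not_congr ⟨?_, ?_⟩
  · rintro rfl
    exact H.eq (Spec.const S)
  · intro h
    exact H.injective ((Spec.const S).congr (h.mono fun X hX => hX.symm))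

variable (L) in
/-- The action of translation by `S` on rational functions. -/
def tau (S : W.Point) : L →ₐ[K] L :=
  pull (generic W L + pointHom L W S) ((nonconst_generic W L).add_const S)

lemma Spec.translate (S : W.Point) :
    Spec (EllCount.generic W L + pointHom L W S) (fun X => X + S) :=
  Spec.generic.add (Spec.const S)

lemma Rep.tau (S : W.Point) {h : L} {φ : W.Point → K} (hφ : Rep W h φ) :
    Rep W (tau L S h) (fun X => φ (X + S)) := hφ.pull _ (Spec.translate S)

lemma tendsto_add (S : W.Point) : Tendsto (fun X : W.Point => X + S) cofinite cofinite :=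
  (add_left_injective S).tendsto_cofinite

lemma tau_zero : tau L (0 : W.Point) = AlgHom.id K L := by
  have := infinite_point W
  ext h
  obtain ⟨φ, hφ⟩ := exists_rep (W := W) h
  exact (hφ.tau 0).injective (hφ.congr (Eventually.of_forall fun X => by simp))

lemma tau_add (S T : W.Point) : tau L (S + T) = (tau L S).comp (tau L T) := by
  have := infinite_point W
  ext h
  obtain ⟨φ, hφ⟩ := exists_rep (W := W) h
  refine (hφ.tau (S + T)).injective (((hφ.tau T).tau S).congr (Eventually.of_forall fun X => ?_))
  simp only [add_assoc]

variable (W L) in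
/-- Translations as automorphisms of the function field. -/
def tauHom : Multiplicative W.Point →* (L ≃ₐ[K] L) where
  toFun S := AlgEquiv.ofAlgHom (tau L S.toAdd) (tau L (-S.toAdd))
    (by rw [← tau_add, add_neg_cancel, tau_zero]) (by rw [← tau_add, neg_add_cancel, tau_zero])
  map_one' := by
    ext h
    simp [tau_zero]
  map_mul' S T := by
    ext h
    simp [tau_add]

lemma tauHom_apply (S : Multiplicative W.Point) (h : L) : tauHom W L S h = tau L S.toAdd h := rfl

lemma tauHom_injective : Function.Injective (tauHom W L) := by
  rw [injective_iff_map_eq_one]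
  intro S hS
  have hx : tau L S.toAdd (fX W L) = fX W L := by rw [← tauHom_apply, hS]; rfl
  have hy : tau L S.toAdd (fY W L) = fY W L := by rw [← tauHom_apply, hS]; rfl
  rw [tau, pull_fX] at hx
  rw [tau, pull_fY] at hy
  have h0 := ((nonconst_generic W L).add_const S.toAdd).ne_zero
  have h1 : generic W L + pointHom L W S.toAdd = generic W L := by
    rw [← some_coord h0]
    exact point_some_congr hx hy
  have h2 : pointHom L W S.toAdd = 0 := by simpa using h1
  exact pointHom_injective L W (h2.trans (map_zero _).symm)

end Elliptic

end Pull

end EllCount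
end

noncomputable section
namespace EllCount
open WeierstrassCurve Polynomial Filter
open scoped Classical Polynomial.Bivariate

set_option linter.unusedSectionVars false

/-! ### The invariant derivation -/

section Derivation

variable {K : Type*} [Field K] (W : Affine K) (L : Type*) [Field L]
  [Algebra W.CoordinateRing L] [IsFractionRing W.CoordinateRing L] [Algebra K L]
  [IsScalarTower K W.CoordinateRing L]

/-- The value of the partial derivative `W_Y` at a point over `L`. -/
def psiY (x y : L) : L := 2 * y + algebraMap K L W.a₁ * x + algebraMap K L W.a₃

/-- The value of the negative of the partial derivative `W_X` at a point over `L`. -/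
def psiX (x y : L) : L := 3 * x ^ 2 + 2 * algebraMap K L W.a₂ * x + algebraMap K L W.a₄ -
  algebraMap K L W.a₁ * y

variable {W L} in
lemma psiY_ne_zero_or {x y : L} (h : (W.baseChange L).toAffine.Nonsingular x y) :
    psiY W L x y ≠ 0 ∨ psiX W L x y ≠ 0 := by
  rcases ((Affine.nonsingular_iff' _ _).mp h).2 with h1 | h1
  · right
    intro h2
    apply h1
    simp only [psiX] at h2
    change algebraMap K L W.a₁ * y - (3 * x ^ 2 + 2 * algebraMap K L W.a₂ * x +
      algebraMap K L W.a₄) = 0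
    linear_combination -h2
  · left
    exact h1

/-- The first order deformation of the generic point along the invariant vector field. -/
def dualHomPoly : K[X][Y] →+* TrivSqZeroExt L L :=
  eval₂RingHom (eval₂RingHom ((TrivSqZeroExt.inlHom L L).comp (algebraMap K L))
    (TrivSqZeroExt.inl (fX W L) + TrivSqZeroExt.inr (psiY W L (fX W L) (fY W L))))
    (TrivSqZeroExt.inl (fY W L) + TrivSqZeroExt.inr (psiX W L (fX W L) (fY W L)))

/-- The vector (W_Y, −W_X) is tangent to the curve: the nilpotent component is W_X·W_Y − W_Y·W_X,
and the other component is the curve equation. -/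
lemma dualHomPoly_polynomial : dualHomPoly W L W.polynomial = 0 := by
  have h := (equation_baseChange _ _).mp (generic_equation W L)
  ext
  · simp [dualHomPoly, Affine.polynomial, pow_succ]
    linear_combination h
  · simp [dualHomPoly, Affine.polynomial, pow_succ, psiX, psiY]
    ring

lemma fst_dualHomPoly (f : K[X][Y]) : (dualHomPoly W L f).fst =
    algebraMap W.CoordinateRing L (Affine.CoordinateRing.mk W f) := by
  have : ((TrivSqZeroExt.fstHom L L L : TrivSqZeroExt L L →ₐ[L] L) : TrivSqZeroExt L L →+* L).comp
      (dualHomPoly W L) = (algebraMap W.CoordinateRing L).comp (Affine.CoordinateRing.mk W) := by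
    ext c
    · simp [dualHomPoly]
      exact (IsScalarTower.algebraMap_apply K W.CoordinateRing L c)
    · simp [dualHomPoly, fX]
    · simp [dualHomPoly, fY]
  exact RingHom.congr_fun this f

/-- The deformation on regular functions. -/
def dualHomReg : W.CoordinateRing →+* TrivSqZeroExt L L :=
  Ideal.Quotient.lift _ (dualHomPoly W L) (by
    intro f hf
    obtain ⟨g, rfl⟩ := Ideal.mem_span_singleton.mp hf
    rw [map_mul, dualHomPoly_polynomial, zero_mul])

lemma dualHomReg_mk (f : K[X][Y]) :
    dualHomReg W L (Affine.CoordinateRing.mk W f) = dualHomPoly W L f := Ideal.Quotient.lift_mk _ _ _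

lemma fst_dualHomReg (a : W.CoordinateRing) :
    (dualHomReg W L a).fst = algebraMap W.CoordinateRing L a := by
  obtain ⟨f, rfl⟩ := AdjoinRoot.mk_surjective a
  rw [dualHomReg_mk, fst_dualHomPoly]

/-- The deformation on rational functions. -/
def dualHom : L →+* TrivSqZeroExt L L :=
  IsLocalization.lift (M := nonZeroDivisors W.CoordinateRing) (g := dualHomReg W L) (by
    intro a
    rw [TrivSqZeroExt.isUnit_iff_isUnit_fst, fst_dualHomReg, isUnit_iff_ne_zero]
    exact (map_ne_zero_iff _ (IsFractionRing.injective W.CoordinateRing L)).mpr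
      (nonZeroDivisors.ne_zero a.2))

lemma dualHom_mk (f : K[X][Y]) :
    dualHom W L (algebraMap _ L (Affine.CoordinateRing.mk W f)) = dualHomPoly W L f := by
  rw [← dualHomReg_mk]
  exact IsLocalization.lift_eq _ _

lemma fst_dualHom (h : L) : (dualHom W L h).fst = h := by
  have : ((TrivSqZeroExt.fstHom L L L : TrivSqZeroExt L L →ₐ[L] L) : TrivSqZeroExt L L →+* L).comp
      (dualHom W L) = RingHom.id L := by
    refine IsLocalization.ringHom_ext (nonZeroDivisors W.CoordinateRing) ?_
    refine RingHom.ext fun a => ?_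
    obtain ⟨f, rfl⟩ := AdjoinRoot.mk_surjective a
    simp [dualHom_mk, fst_dualHomPoly]
  exact RingHom.congr_fun this h

/-- The invariant derivation of the function field. -/
def invD : Derivation K L L where
  toFun h := (dualHom W L h).snd
  map_add' h h' := by simp
  map_smul' c h := by
    have hc : dualHom W L (algebraMap K L c) = TrivSqZeroExt.inl (algebraMap K L c) := by
      rw [IsScalarTower.algebraMap_apply K W.CoordinateRing L]
      have : algebraMap K W.CoordinateRing c = Affine.CoordinateRing.mk W (C (C c)) := rfl
      rw [this, dualHom_mk, ← this, ← IsScalarTower.algebraMap_apply]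
      simp [dualHomPoly]
    rw [Algebra.smul_def, map_mul, hc]
    simp [Algebra.smul_def]
  map_one_eq_zero' := by simp
  leibniz' h h' := by
    simp [fst_dualHom, mul_comm]

lemma invD_fX : invD W L (fX W L) = psiY W L (fX W L) (fY W L) := by
  change (dualHom W L (fX W L)).snd = _
  rw [fX, dualHom_mk]
  simp [dualHomPoly, fX]

lemma invD_fY : invD W L (fY W L) = psiX W L (fX W L) (fY W L) := by
  change (dualHom W L (fY W L)).snd = _
  rw [fY, dualHom_mk]
  simp [dualHomPoly, fY]

variable {W L}

/-- The derivation acts on the coordinates of `P` as `c` times the invariant vector field. -/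
def IsDMul (c : L) (P : (W.baseChange L).toAffine.Point) : Prop :=
  (P = 0 → c = 0) ∧ (P ≠ 0 → invD W L (xCoord P) = c * psiY W L (xCoord P) (yCoord P) ∧
    invD W L (yCoord P) = c * psiX W L (xCoord P) (yCoord P))

lemma IsDMul.unique {c c' : L} {P : (W.baseChange L).toAffine.Point} (h : IsDMul c P)
    (h' : IsDMul c' P) : c = c' := by
  rcases P with _ | ⟨x, y, hP⟩
  · rw [h.1 rfl, h'.1 rfl]
  · obtain ⟨h1, h2⟩ := h.2 (Affine.Point.some_ne_zero _)
    obtain ⟨h1', h2'⟩ := h'.2 (Affine.Point.some_ne_zero _)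
    rcases psiY_ne_zero_or hP with h0 | h0
    · exact mul_right_cancel₀ h0 (h1.symm.trans h1')
    · exact mul_right_cancel₀ h0 (h2.symm.trans h2')

lemma IsDMul.neg {c : L} {P : (W.baseChange L).toAffine.Point} (h : IsDMul c P) :
    IsDMul (-c) (-P) := by
  rcases P with _ | ⟨x, y, hP⟩
  · exact ⟨fun _ => by rw [h.1 rfl, neg_zero], fun h0 => absurd rfl h0⟩
  · refine ⟨fun h0 => absurd h0 (by simp), fun _ => ?_⟩
    obtain ⟨h1, h2⟩ := h.2 (Affine.Point.some_ne_zero _)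
    simp only [Affine.Point.neg_some, xCoord_some, yCoord_some] at *
    have e : (W.baseChange L).toAffine.negY x y =
        -y - algebraMap K L W.a₁ * x - algebraMap K L W.a₃ := rfl
    rw [e]
    constructor
    · rw [h1]; simp only [psiY]; ring
    · simp only [map_sub, map_neg, Derivation.leibniz, Derivation.map_algebraMap, h1, h2,
        smul_eq_mul, psiX, psiY]
      ring

/-- On the line the curve polynomial becomes −(t − x₁)(t − x₂)(t − x₃). The two sides differentiate
this cubic from its coefficients and from its roots. At t = xᵢ one obtains the difference between
−W_X and l·W_Y at the intersection point. -/
lemma derivative_line_eq {F : Type*} [Field F] {E : Affine F} {x₁ x₂ y₁ y₂ : F}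
    (h₁ : E.Equation x₁ y₁) (h₂ : E.Equation x₂ y₂) (hxy : ¬(x₁ = x₂ ∧ y₁ = E.negY x₂ y₂))
    (l x₃ : F) (hl : l = E.slope x₁ x₂ y₁ y₂) (hx₃ : x₃ = E.addX x₁ x₂ l) (t : F) :
    3 * t ^ 2 + 2 * (-l ^ 2 - E.a₁ * l + E.a₂) * t +
      (2 * x₁ * l ^ 2 + (E.a₁ * x₁ - 2 * y₁ - E.a₃) * l + (-E.a₁ * y₁ + E.a₄)) =
      (t - x₁) * (t - x₂) + (t - x₁) * (t - x₃) + (t - x₂) * (t - x₃) := by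
  subst hl hx₃
  have := congrArg (eval t) (Affine.derivative_addPolynomial_slope h₁ h₂ hxy)
  generalize E.addX x₁ x₂ (E.slope x₁ x₂ y₁ y₂) = x₃ at *
  rw [Affine.addPolynomial_eq] at this
  simp only [Cubic.toPoly, derivative_neg, derivative_add, derivative_mul, derivative_C,
    derivative_X_pow, derivative_X, eval_neg, eval_add, eval_mul, eval_C, eval_X, eval_pow,
    eval_sub, zero_mul, mul_one, zero_add, add_zero, eval_natCast, map_natCast] at this
  push_cast at this
  norm_num at this
  linear_combination -this

/-- Once D l is known, D x₃ and D y₃ follow by differentiating the addition formulas, with no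
distinction between chords and tangents. -/
lemma IsDMul.add_aux {D : Derivation K L L} {a₁ a₂ a₃ a₄ x₁ x₂ y₁ y₂ l c c' : L}
    (d₁ : D a₁ = 0) (d₂ : D a₂ = 0) (d₃ : D a₃ = 0) {x₃ y₃ : L}
    (hx₃ : x₃ = l ^ 2 + a₁ * l - a₂ - x₁ - x₂) (hy₃ : y₃ = -(l * (x₃ - x₁) + y₁) - a₁ * x₃ - a₃)
    (hline : l * (x₁ - x₂) = y₁ - y₂)
    (hDl : D l = c * (x₁ - x₃) + c' * (x₂ - x₃))
    (hD : 3 * x₁ ^ 2 + 2 * a₂ * x₁ + a₄ - a₁ * y₁ - l * (2 * y₁ + a₁ * x₁ + a₃) =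
      (x₁ - x₂) * (x₁ - x₃))
    (hE : 3 * x₃ ^ 2 + 2 * a₂ * x₃ + a₄ - a₁ * (l * (x₃ - x₁) + y₁) -
      l * (2 * (l * (x₃ - x₁) + y₁) + a₁ * x₃ + a₃) = (x₃ - x₁) * (x₃ - x₂))
    (hDx : D x₁ = c * (2 * y₁ + a₁ * x₁ + a₃)) (hDx' : D x₂ = c' * (2 * y₂ + a₁ * x₂ + a₃))
    (hDy : D y₁ = c * (3 * x₁ ^ 2 + 2 * a₂ * x₁ + a₄ - a₁ * y₁)) :
    D x₃ = (c + c') * (2 * y₃ + a₁ * x₃ + a₃) ∧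
      D y₃ = (c + c') * (3 * x₃ ^ 2 + 2 * a₂ * x₃ + a₄ - a₁ * y₃) := by
  have hy₂ : y₂ = y₁ - l * (x₁ - x₂) := by rw [hline]; ring
  have e1 : D x₃ = (c + c') * (2 * y₃ + a₁ * x₃ + a₃) := by
    have : D x₃ = 2 * l * D l + a₁ * D l - D x₁ - D x₂ := by
      rw [hx₃]
      simp only [map_sub, map_add, Derivation.leibniz, Derivation.leibniz_pow, d₁, d₂,
        smul_eq_mul, nsmul_eq_mul]
      push_cast
      ring
    rw [this, hDl, hDx, hDx', hy₃, hy₂]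
    ring
  refine ⟨e1, ?_⟩
  have : D y₃ = -((x₃ - x₁) * D l + l * (D x₃ - D x₁) + D y₁) - a₁ * D x₃ := by
    rw [hy₃]
    simp only [map_sub, map_add, map_neg, Derivation.leibniz, d₁, d₃, smul_eq_mul]
    ring
  rw [this, e1, hDl, hDx, hDy, hy₃]
  linear_combination (-c) * hD + (c + c') * (-1) * hE

/-- The vector field is invariant under translation, so the multipliers of two maps add.
Consequently [n] acts on it as the scalar n. -/
lemma IsDMul.add {c c' : L} {P P' : (W.baseChange L).toAffine.Point} (h : IsDMul c P)
    (h' : IsDMul c' P') : IsDMul (c + c') (P + P') := by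
  have hd : P = P' → c = c' := fun e => h.unique (e ▸ h')
  rcases P with _ | ⟨x₁, y₁, h₁⟩
  · rw [h.1 rfl, ← Affine.Point.zero_def, zero_add, zero_add]
    exact h'
  rcases P' with _ | ⟨x₂, y₂, h₂⟩
  · rw [h'.1 rfl, ← Affine.Point.zero_def, add_zero, add_zero]
    exact h
  by_cases hxy : x₁ = x₂ ∧ y₁ = (W.baseChange L).toAffine.negY x₂ y₂
  · rw [Affine.Point.add_of_Y_eq hxy.1 hxy.2]
    refine ⟨fun _ => ?_, fun h0 => absurd rfl h0⟩
    have e : (Affine.Point.some x₁ y₁ h₁) = -(.some x₂ y₂ h₂) := point_some_congr hxy.1 hxy.2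
    rw [e] at h
    rw [h.unique h'.neg, neg_add_cancel]
  rw [Affine.Point.add_some hxy]
  refine ⟨fun h0 => absurd h0 (Affine.Point.some_ne_zero _), fun _ => ?_⟩
  obtain ⟨g1, g2⟩ := h.2 (Affine.Point.some_ne_zero _)
  obtain ⟨g1', g2'⟩ := h'.2 (Affine.Point.some_ne_zero _)
  simp only [xCoord_some, yCoord_some] at *
  have key := derivative_line_eq h₁.1 h₂.1 hxy _ _ rfl rfl
  set l := (W.baseChange L).toAffine.slope x₁ x₂ y₁ y₂ with hl
  set x₃ := (W.baseChange L).toAffine.addX x₁ x₂ l with hx₃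
  have hx₃' : x₃ = l ^ 2 + algebraMap K L W.a₁ * l - algebraMap K L W.a₂ - x₁ - x₂ := hx₃
  change ∀ t, 3 * t ^ 2 + 2 * (-l ^ 2 - algebraMap K L W.a₁ * l + algebraMap K L W.a₂) * t +
      (2 * x₁ * l ^ 2 + (algebraMap K L W.a₁ * x₁ - 2 * y₁ - algebraMap K L W.a₃) * l +
        (-algebraMap K L W.a₁ * y₁ + algebraMap K L W.a₄)) =
      (t - x₁) * (t - x₂) + (t - x₁) * (t - x₃) + (t - x₂) * (t - x₃) at key
  have hline : l * (x₁ - x₂) = y₁ - y₂ := by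
    by_cases hx : x₁ = x₂
    · have := Affine.Y_eq_of_Y_ne h₁.1 h₂.1 hx (fun h => hxy ⟨hx, h⟩)
      rw [hx, this, sub_self, sub_self, mul_zero]
    · rw [hl, Affine.slope_of_X_ne hx, div_mul_cancel₀ _ (sub_ne_zero.mpr hx)]
  have hD : psiX W L x₁ y₁ - l * psiY W L x₁ y₁ = (x₁ - x₂) * (x₁ - x₃) := by
    simp only [psiX, psiY]
    linear_combination key x₁
  have hD2 : psiX W L x₂ y₂ - l * psiY W L x₂ y₂ = (x₂ - x₁) * (x₂ - x₃) := by
    have e : y₂ = y₁ - l * (x₁ - x₂) := by rw [hline]; ring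
    simp only [psiX, psiY]
    rw [e]
    linear_combination key x₂
  refine IsDMul.add_aux (D := invD W L) (l := l) (x₁ := x₁) (x₂ := x₂) (y₁ := y₁) (y₂ := y₂)
    (Derivation.map_algebraMap _ _)
    (Derivation.map_algebraMap _ _) (Derivation.map_algebraMap _ _) hx₃' rfl hline ?_ hD ?_ g1 g1' g2
  -- For D l one differentiates the relation that defines l. On a tangent this is l·W_Y = −W_X, the
  -- two points coincide and so do their multipliers by uniqueness. On a chord it is l(x₁ − x₂) = y₁
  -- − y₂.
  · by_cases hx : x₁ = x₂
    · have hY : y₁ ≠ (W.baseChange L).toAffine.negY x₂ y₂ := fun h => hxy ⟨hx, h⟩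
      have hy := Affine.Y_eq_of_Y_ne h₁.1 h₂.1 hx hY
      have hc := hd (point_some_congr hx hy)
      subst hc
      have hpsi : psiY W L x₁ y₁ ≠ 0 := by
        intro h0
        apply hY
        rw [← hx, ← hy]
        change y₁ = -y₁ - algebraMap K L W.a₁ * x₁ - algebraMap K L W.a₃
        simp only [psiY] at h0
        linear_combination h0
      have e1 : l * psiY W L x₁ y₁ = psiX W L x₁ y₁ := by
        rw [← sub_eq_zero, ← neg_eq_zero, neg_sub, hD, hx]; ring
      have e2 := congrArg (invD W L) e1
      rw [Derivation.leibniz] at e2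
      have e3 : invD W L (psiY W L x₁ y₁) = c * (2 * psiX W L x₁ y₁ +
          algebraMap K L W.a₁ * psiY W L x₁ y₁) := by
        have : invD W L (2 : L) = 0 := by exact_mod_cast (invD W L).map_natCast 2
        simp only [psiY, map_add, Derivation.leibniz, Derivation.map_algebraMap, this, smul_eq_mul]
        rw [g1, g2]; simp only [psiY]; ring
      have e4 : invD W L (psiX W L x₁ y₁) = c * ((6 * x₁ + 2 * algebraMap K L W.a₂) *
          psiY W L x₁ y₁ - algebraMap K L W.a₁ * psiX W L x₁ y₁) := by
        have h2 : invD W L (2 : L) = 0 := by exact_mod_cast (invD W L).map_natCast 2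
        have h3 : invD W L (3 : L) = 0 := by exact_mod_cast (invD W L).map_natCast 3
        simp only [psiX, map_add, map_sub, Derivation.leibniz, Derivation.leibniz_pow,
          Derivation.map_algebraMap, h2, h3, smul_eq_mul, nsmul_eq_mul]
        rw [g1, g2]; simp only [psiX]; push_cast; ring
      rw [e3, e4, ← e1] at e2
      simp only [smul_eq_mul] at e2
      apply mul_right_cancel₀ hpsi
      rw [hx₃', ← hx]
      linear_combination e2
    · have hx' := sub_ne_zero.mpr hx
      have e2 := congrArg (invD W L) hline
      rw [Derivation.leibniz, map_sub, map_sub, g1, g2, g1', g2'] at e2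
      simp only [smul_eq_mul] at e2
      apply mul_right_cancel₀ hx'
      linear_combination e2 + c * hD - c' * hD2
  · linear_combination key x₃

lemma IsDMul.generic [W.IsElliptic] : IsDMul 1 (generic W L) := by
  refine ⟨fun h0 => absurd h0 (Affine.Point.some_ne_zero _), fun _ => ?_⟩
  simp only [one_mul]
  exact ⟨invD_fX W L, invD_fY W L⟩

lemma IsDMul.nsmul_generic [W.IsElliptic] (n : ℕ) : IsDMul (n : L) (n • EllCount.generic W L) := by
  induction n with
  | zero =>
    rw [zero_smul]
    exact ⟨fun _ => Nat.cast_zero, fun h0 => absurd rfl h0⟩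
  | succ n ih =>
    rw [succ_nsmul, Nat.cast_succ]
    exact ih.add IsDMul.generic

lemma IsDMul.const (S : W.Point) : IsDMul (0 : L) (pointHom L W S) := by
  rcases S with _ | ⟨x, y, h⟩
  · exact ⟨fun _ => rfl, fun h0 => absurd rfl h0⟩
  · refine ⟨fun _ => rfl, fun _ => ?_⟩
    rw [pointHom_some, zero_mul, zero_mul]
    exact ⟨Derivation.map_algebraMap _ _, Derivation.map_algebraMap _ _⟩

/-- Constant points have multiplier 0 and n times the generic point has multiplier n. -/
lemma nonconst_nsmul_of_cast_ne_zero [W.IsElliptic] {n : ℕ} (hn : (n : K) ≠ 0) :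
    Nonconst (n • EllCount.generic W L) := by
  intro S h
  have h1 := IsDMul.nsmul_generic (W := W) (L := L) n
  rw [h] at h1
  have h2 := h1.unique (IsDMul.const S)
  rw [← map_natCast (algebraMap K L)] at h2
  exact hn ((algebraMap K L).injective (h2.trans (map_zero _).symm))

end Derivation

end EllCount
end

noncomputable section
namespace EllCount
open WeierstrassCurve Polynomial Filter
open scoped Classical Polynomial.Bivariate

set_option linter.unusedSectionVars false

/-! ### Multiplication by `n` is not constant -/

section Torsion

variable {K : Type*} [Field K] [IsAlgClosed K] (W : Affine K) [W.IsElliptic]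

lemma exists_point_of_xCoord (x : K) : ∃ P : W.Point, P ≠ 0 ∧ xCoord P = x := by
  obtain ⟨y, hy⟩ := IsAlgClosed.exists_root (k := K) (W.polynomial.map (evalRingHom x)) (by
    rw [Affine.monic_polynomial.degree_map, Affine.degree_polynomial]
    norm_num)
  rw [IsRoot, eval_map, eval₂_evalRingHom] at hy
  exact ⟨.some x y (Affine.equation_iff_nonsingular.mp hy), Affine.Point.some_ne_zero _, rfl⟩

/-- The 2-division polynomial is a genuine cubic because 4 ≠ 0. Over a root of it the ordinate −(a₁x
+ a₃)/2 is fixed by negation. -/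
lemma exists_two_torsion (h2 : (2 : K) ≠ 0) : ∃ P : W.Point, P ≠ 0 ∧ 2 • P = 0 := by
  obtain ⟨e, he⟩ := IsAlgClosed.exists_root (k := K)
    (Cubic.toPoly ⟨4, W.b₂, 2 * W.b₄, W.b₆⟩) (by
      rw [Cubic.degree_of_a_ne_zero (by
        change (4 : K) ≠ 0
        have : (4 : K) = 2 * 2 := by norm_num
        rw [this]; exact mul_ne_zero h2 h2)]
      norm_num)
  have he' : 4 * e ^ 3 + W.b₂ * e ^ 2 + 2 * W.b₄ * e + W.b₆ = 0 := by
    simpa [Cubic.toPoly, IsRoot] using he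
  simp only [WeierstrassCurve.b₂, WeierstrassCurve.b₄, WeierstrassCurve.b₆] at he'
  set y := -(W.a₁ * e + W.a₃) / 2 with hy
  have hy2 : 2 * y = -(W.a₁ * e + W.a₃) := by rw [hy]; field_simp
  have heq : W.Equation e y := by
    rw [Affine.equation_iff]
    have h4 : (4 : K) ≠ 0 := by
      have : (4 : K) = 2 * 2 := by norm_num
      rw [this]; exact mul_ne_zero h2 h2
    apply mul_left_cancel₀ h4
    linear_combination (2 * y + (W.a₁ * e + W.a₃)) * hy2 - he'
  refine ⟨.some e y (Affine.equation_iff_nonsingular.mp heq), Affine.Point.some_ne_zero _, ?_⟩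
  rw [two_nsmul]
  refine Affine.Point.add_self_of_Y_eq ?_
  simp only [Affine.negY]
  linear_combination hy2

/-- In characteristic 2 a point is killed by 2 only if a₁x + a₃ = 0. If this held for every x, then
a₁ = a₃ = 0, and the discriminant would be a multiple of 2. -/
lemma exists_two_nsmul_ne_zero (h2 : (2 : K) = 0) : ∃ P : W.Point, 2 • P ≠ 0 := by
  by_contra hcon
  push Not at hcon
  have key : ∀ x : K, W.a₁ * x + W.a₃ = 0 := by
    intro x
    obtain ⟨P, hP, hx⟩ := exists_point_of_xCoord W x
    have h := hcon P
    rcases P with _ | ⟨x', y, h'⟩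
    · exact absurd rfl hP
    rw [two_nsmul, add_eq_zero_iff_eq_neg, Affine.Point.neg_some, Affine.Point.some.injEq] at h
    have := h.2
    simp only [Affine.negY] at this
    simp only [xCoord_some] at hx
    subst hx
    linear_combination this - y * h2
  have h3 : W.a₃ = 0 := by simpa using key 0
  have h1 : W.a₁ = 0 := by simpa [h3] using key 1
  apply (W.isUnit_Δ).ne_zero
  simp only [WeierstrassCurve.Δ, WeierstrassCurve.b₂, WeierstrassCurve.b₄, WeierstrassCurve.b₆,
    WeierstrassCurve.b₈, h1, h3]
  linear_combination (-(8 * W.a₂^2 * (4 * W.a₂ * W.a₆ - W.a₄^2)) - 32 * W.a₄^3 -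
    216 * W.a₆^2 + 144 * W.a₂ * W.a₄ * W.a₆) * h2

variable {W}

lemma finite_fiber {n : ℕ} (h : {X : W.Point | n • X = 0}.Finite) (S : W.Point) :
    {X : W.Point | n • X = S}.Finite := by
  by_cases hS : ∃ X₀ : W.Point, n • X₀ = S
  · obtain ⟨X₀, rfl⟩ := hS
    refine (h.image (fun X => X + X₀)).subset ?_
    intro X hX
    refine ⟨X - X₀, ?_, by simp⟩
    simp only [Set.mem_ofPred_eq] at hX ⊢
    rw [smul_sub, hX, sub_self]
  · convert! Set.finite_empty
    ext X
    simp only [Set.mem_ofPred_eq, Set.mem_empty_iff_false, iff_false]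
    exact fun h => hS ⟨X, h⟩

lemma finite_torsion_mul {a b : ℕ} (ha : {X : W.Point | a • X = 0}.Finite)
    (hb : {X : W.Point | b • X = 0}.Finite) : {X : W.Point | (a * b) • X = 0}.Finite := by
  refine (hb.biUnion fun S _ => finite_fiber ha S).subset ?_
  intro X hX
  simp only [Set.mem_iUnion]
  refine ⟨a • X, ?_, rfl⟩
  simp only [Set.mem_ofPred_eq] at hX ⊢
  rwa [← mul_smul, mul_comm]

/-- Compare the value at X with the value at X + Z, for X outside a finite set. -/
lemma torsion_of_eventually {n : ℕ} {S : W.Point} (h : ∀ᶠ X : W.Point in cofinite, n • X = S)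
    (Z : W.Point) : n • Z = 0 := by
  have := infinite_point W
  obtain ⟨X, h1, h2⟩ := (h.and ((tendsto_add Z).eventually h)).exists
  rw [smul_add, h1] at h2
  simpa using h2

variable {L : Type*} [Field L]
  [Algebra W.CoordinateRing L] [IsFractionRing W.CoordinateRing L] [Algebra K L]
  [IsScalarTower K W.CoordinateRing L]

lemma spec_nsmul_generic (n : ℕ) : Spec (n • generic W L) (fun X => n • X) := Spec.generic.nsmul n

lemma nonconst_nsmul_of_finite {n : ℕ} (h : {X : W.Point | n • X = 0}.Finite) :
    Nonconst (n • generic W L) := by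
  rw [nonconst_iff_of_spec (spec_nsmul_generic n)]
  intro S hS
  have := infinite_point W
  exact (Set.infinite_univ (α := W.Point)) (h.subset fun X _ => torsion_of_eventually hS X)

lemma finite_of_nonconst_nsmul {n : ℕ} (h : Nonconst (n • generic W L)) :
    {X : W.Point | n • X = 0}.Finite := by
  have := (h.tendsto (spec_nsmul_generic n)).eventually (eventually_ne 0)
  simpa [eventually_cofinite] using this

lemma torsion_of_not_nonconst {n : ℕ} (h : ¬ Nonconst (n • generic W L)) (Z : W.Point) :
    n • Z = 0 := by
  rw [nonconst_iff_of_spec (spec_nsmul_generic n)] at h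
  push Not at h
  obtain ⟨S, hS⟩ := h
  exact torsion_of_eventually hS Z

/-- The function field, as a type that does not unfold. -/
def FF {K : Type*} [Field K] (W : Affine K) := W.FunctionField

section

variable {K : Type*} [Field K] (W : Affine K)

instance : Field (FF W) := inferInstanceAs (Field W.FunctionField)
instance : Algebra W.CoordinateRing (FF W) :=
  inferInstanceAs (Algebra W.CoordinateRing W.FunctionField)
instance : IsFractionRing W.CoordinateRing (FF W) :=
  inferInstanceAs (IsFractionRing W.CoordinateRing W.FunctionField)
instance : Algebra K (FF W) :=
  ((algebraMap W.CoordinateRing (FF W)).comp (algebraMap K W.CoordinateRing)).toAlgebra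
instance : IsScalarTower K W.CoordinateRing (FF W) := IsScalarTower.of_algebraMap_eq' rfl

end

variable (W) in
-- Multiplicativity reduces to a prime p. If E[p] were infinite, [p] would be constant, so p = 0 in
-- K by the derivation, and p would kill every point. For p = 2 this contradicts
-- `exists_two_nsmul_ne_zero`. For odd p it contradicts the existence of a point of order 2.
lemma finite_torsion {n : ℕ} (hn : n ≠ 0) : {X : W.Point | n • X = 0}.Finite := by
  induction n using Nat.recOnMul with
  | zero => exact absurd rfl hn
  | one => simp
  | prime p hp =>
    by_contra hinf
    have hnc : ¬ Nonconst (p • generic W (FF W)) := fun h =>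
      hinf (finite_of_nonconst_nsmul h)
    have htors := torsion_of_not_nonconst hnc
    have hpK : (p : K) = 0 := by
      by_contra h0
      exact hnc (nonconst_nsmul_of_cast_ne_zero h0)
    by_cases h2 : (2 : K) = 0
    · have hp2 : p = 2 := by
        have hc : CharP K p := (CharP.charP_iff_prime_eq_zero hp).mpr hpK
        have := (CharP.cast_eq_zero_iff K p 2).mp (by exact_mod_cast h2)
        exact (Nat.prime_dvd_prime_iff_eq hp Nat.prime_two).mp this
      subst hp2
      obtain ⟨P, hP⟩ := exists_two_nsmul_ne_zero W h2
      exact hP (htors P)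
    · obtain ⟨P, hP, h2P⟩ := exists_two_torsion W h2
      have hp2 : p ≠ 2 := by
        rintro rfl
        exact h2 (by exact_mod_cast hpK)
      have hcop : Nat.Coprime p 2 := (Nat.coprime_primes hp Nat.prime_two).mpr hp2
      have h1 := addOrderOf_dvd_of_nsmul_eq_zero (htors P)
      have h3 := addOrderOf_dvd_of_nsmul_eq_zero h2P
      have := Nat.eq_one_of_dvd_coprimes hcop h1 h3
      exact hP (AddMonoid.addOrderOf_eq_one_iff.mp this)
  | mul a b iha ihb =>
    exact finite_torsion_mul (iha (by rintro rfl; simp at hn)) (ihb (by rintro rfl; simp at hn))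

variable (W L) in
lemma nonconst_nsmul_generic {n : ℕ} (hn : n ≠ 0) : Nonconst (n • generic W L) :=
  nonconst_nsmul_of_finite (finite_torsion W hn)

end Torsion

end EllCount
end

noncomputable section
namespace EllCount
open WeierstrassCurve Polynomial Filter
open scoped Classical Polynomial.Bivariate

set_option linter.unusedSectionVars false

/-! ### The degree of multiplication by `n` -/

section Heights

section PolynomialLemmas

variable {K : Type*} [Field K]

lemma exists_coprime_rep (u v : K[X]) (hv : v ≠ 0) : ∃ g N D : K[X], u = g * N ∧ v = g * D ∧
    IsCoprime N D ∧ g ≠ 0 ∧ D ≠ 0 := by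
  have hg : EuclideanDomain.gcd u v ≠ 0 := fun h =>
    hv (EuclideanDomain.gcd_eq_zero_iff.mp h).2
  have h := EuclideanDomain.gcd_eq_gcd_ab u v
  have h1 := EuclideanDomain.gcd_dvd_left u v
  have h2 := EuclideanDomain.gcd_dvd_right u v
  generalize EuclideanDomain.gcd u v = g at *
  obtain ⟨N, hN⟩ := h1
  obtain ⟨D, hD⟩ := h2
  refine ⟨g, N, D, hN, hD, ⟨EuclideanDomain.gcdA u v, EuclideanDomain.gcdB u v, ?_⟩, hg, ?_⟩
  · apply mul_left_cancel₀ hg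
    linear_combination -h - EuclideanDomain.gcdA u v * hN - EuclideanDomain.gcdB u v * hD
  · rintro rfl
    rw [mul_zero] at hD
    exact hv hD

/-- This is Gauss's lemma: the three polynomials are the coefficients of the product of the
primitive linear forms D s + N t and D' s + N' t, so no maximal ideal contains all of them. -/
lemma span_symm_eq_top {N D N' D' : K[X]} (h : IsCoprime N D) (h' : IsCoprime N' D') :
    ∃ α β γ : K[X], α * (D * D') + β * (N * D' + N' * D) + γ * (N * N') = 1 := by
  have key : Ideal.span {D * D', N * D' + N' * D, N * N'} = (⊤ : Ideal K[X]) := by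
    by_contra hne
    obtain ⟨M, hM, hle⟩ := Ideal.exists_le_maximal _ hne
    have hp := hM.isPrime
    have m1 : D * D' ∈ M := hle (Ideal.subset_span (by simp))
    have m2 : N * D' + N' * D ∈ M := hle (Ideal.subset_span (by simp))
    have m3 : N * N' ∈ M := hle (Ideal.subset_span (by simp))
    have hc : ¬ (N ∈ M ∧ D ∈ M) := by
      rintro ⟨hN, hD⟩
      obtain ⟨a, b, hab⟩ := h
      exact hM.ne_top ((Ideal.eq_top_iff_one _).mpr
        (hab ▸ M.add_mem (M.mul_mem_left _ hN) (M.mul_mem_left _ hD)))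
    have hc' : ¬ (N' ∈ M ∧ D' ∈ M) := by
      rintro ⟨hN, hD⟩
      obtain ⟨a, b, hab⟩ := h'
      exact hM.ne_top ((Ideal.eq_top_iff_one _).mpr
        (hab ▸ M.add_mem (M.mul_mem_left _ hN) (M.mul_mem_left _ hD)))
    rcases hp.mem_or_mem m1 with hD | hD
    · have : N * D' ∈ M := (Ideal.add_mem_iff_left M (M.mul_mem_left _ hD)).mp m2
      rcases hp.mem_or_mem this with hN | hD'
      · exact hc ⟨hN, hD⟩
      · rcases hp.mem_or_mem m3 with hN | hN'
        · exact hc ⟨hN, hD⟩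
        · exact hc' ⟨hN', hD'⟩
    · have : N' * D ∈ M := (Ideal.add_mem_iff_right M (M.mul_mem_left _ hD)).mp m2
      rcases hp.mem_or_mem this with hN' | hD'
      · exact hc' ⟨hN', hD⟩
      · rcases hp.mem_or_mem m3 with hN | hN'
        · exact hc ⟨hN, hD'⟩
        · exact hc' ⟨hN', hD⟩
  have h1 : (1 : K[X]) ∈ Ideal.span {D * D', N * D' + N' * D, N * N'} := by
    rw [key]; trivial
  rw [Ideal.mem_span_insert] at h1
  obtain ⟨α, z, hz, h1⟩ := h1
  rw [Ideal.mem_span_pair] at hz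
  obtain ⟨β, γ, rfl⟩ := hz
  exact ⟨α, β, γ, by linear_combination -h1⟩

lemma natDegree_le_of_eq_mul {a b s : K[X]} (h : b = s * a) (hs : s ≠ 0) :
    a.natDegree ≤ b.natDegree := by
  by_cases ha : a = 0
  · simp [ha]
  · rw [h, natDegree_mul hs ha]; omega

/-- The key inequality behind the parallelogram law for heights. -/
lemma max_natDegree_add_le {N D N' D' A B C : K[X]} (h : IsCoprime N D) (h' : IsCoprime N' D')
    (hD : D ≠ 0) (hD' : D' ≠ 0) (hC : C ≠ 0) (hB : (N * D' + N' * D) * C = D * D' * B)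
    (hA : N * N' * C = D * D' * A) {k : ℕ} (kA : A.natDegree ≤ k) (kB : B.natDegree ≤ k)
    (kC : C.natDegree ≤ k) :
    max N.natDegree D.natDegree + max N'.natDegree D'.natDegree ≤ k := by
  obtain ⟨α, β, γ, h1⟩ := span_symm_eq_top h h'
  have hDD : D * D' ≠ 0 := mul_ne_zero hD hD'
  -- The triple (C, B, A) is proportional to a primitive triple, hence equals s times it with s a
  -- polynomial. Passing to the primitive triple can only lower degrees.
  set s := α * C + β * B + γ * A with hs
  have eC : C = s * (D * D') := by
    linear_combination -C * h1 + β * hB + γ * hA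
  have hs0 : s ≠ 0 := by
    intro h0
    rw [h0, zero_mul] at eC
    exact hC eC
  have eB : B = s * (N * D' + N' * D) := by
    apply mul_left_cancel₀ hDD
    linear_combination -hB + (N * D' + N' * D) * eC
  have eA : A = s * (N * N') := by
    apply mul_left_cancel₀ hDD
    linear_combination -hA + (N * N') * eC
  have dC := natDegree_le_of_eq_mul eC hs0
  have dB := natDegree_le_of_eq_mul eB hs0
  have dA := natDegree_le_of_eq_mul eA hs0
  rw [natDegree_mul hD hD'] at dC
  -- Depending on which of numerator and denominator has the larger degree in each fraction, one of
  -- the three coefficients has degree exactly equal to the sum of the two heights.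
  rcases le_or_gt N.natDegree D.natDegree with c | c
  · rcases le_or_gt N'.natDegree D'.natDegree with c' | c'
    · rw [max_eq_right c, max_eq_right c']; omega
    · have hN' : N' ≠ 0 := by rintro rfl; simp at c'
      have : (N * D' + N' * D).natDegree = N'.natDegree + D.natDegree := by
        rw [natDegree_add_eq_right_of_natDegree_lt, natDegree_mul hN' hD]
        rw [natDegree_mul hN' hD]
        exact (natDegree_mul_le).trans_lt (by omega)
      rw [max_eq_right c, max_eq_left c'.le]; omega
  · have hN : N ≠ 0 := by rintro rfl; simp at c
    rcases le_or_gt N'.natDegree D'.natDegree with c' | c'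
    · have : (N * D' + N' * D).natDegree = N.natDegree + D'.natDegree := by
        rw [natDegree_add_eq_left_of_natDegree_lt, natDegree_mul hN hD']
        rw [natDegree_mul hN hD']
        exact (natDegree_mul_le).trans_lt (by omega)
      rw [max_eq_left c.le, max_eq_right c']; omega
    · have hN' : N' ≠ 0 := by rintro rfl; simp at c'
      rw [natDegree_mul hN hN'] at dA
      rw [max_eq_left c.le, max_eq_left c'.le]; omega

end PolynomialLemmas

section Formulas

variable {F : Type*} [Field F] {E : Affine F}

lemma addX_add_addX_sub {x₁ x₂ y₁ y₂ : F} (h₁ : E.Equation x₁ y₁) (h₂ : E.Equation x₂ y₂)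
    (hx : x₁ ≠ x₂) :
    (E.addX x₁ x₂ (E.slope x₁ x₂ y₁ y₂) + E.addX x₁ x₂ (E.slope x₁ x₂ y₁ (E.negY x₂ y₂))) *
      (x₁ - x₂) ^ 2 = 2 * x₁ * x₂ * (x₁ + x₂) + E.b₂ * x₁ * x₂ + E.b₄ * (x₁ + x₂) + E.b₆ := by
  rw [Affine.slope_of_X_ne hx, Affine.slope_of_X_ne hx]
  rw [Affine.equation_iff] at h₁ h₂
  have hd := sub_ne_zero.mpr hx
  simp only [Affine.addX, Affine.negY, WeierstrassCurve.b₂, WeierstrassCurve.b₄,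
    WeierstrassCurve.b₆]
  field_simp
  linear_combination 2 * h₁ + 2 * h₂

lemma addX_mul_addX_sub {x₁ x₂ y₁ y₂ : F} (h₁ : E.Equation x₁ y₁) (h₂ : E.Equation x₂ y₂)
    (hx : x₁ ≠ x₂) :
    (E.addX x₁ x₂ (E.slope x₁ x₂ y₁ y₂) * E.addX x₁ x₂ (E.slope x₁ x₂ y₁ (E.negY x₂ y₂))) *
      (x₁ - x₂) ^ 2 = x₁ ^ 2 * x₂ ^ 2 - E.b₄ * x₁ * x₂ - E.b₆ * (x₁ + x₂) - E.b₈ := by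
  rw [Affine.slope_of_X_ne hx, Affine.slope_of_X_ne hx]
  rw [Affine.equation_iff] at h₁ h₂
  have hd := sub_ne_zero.mpr hx
  simp only [Affine.addX, Affine.negY, WeierstrassCurve.b₄,
    WeierstrassCurve.b₆, WeierstrassCurve.b₈]
  set d := x₁ - x₂ with hdef
  set u := y₁ - y₂ with hu
  set v := y₁ - (-y₂ - E.a₁ * x₂ - E.a₃) with hv
  set s := E.a₂ + x₁ + x₂ with hs
  set w := x₁ ^ 2 + x₁ * x₂ + x₂ ^ 2 + E.a₂ * (x₁ + x₂) + E.a₄ with hw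
  -- Subtracting the two curve equations shows that u·v is divisible by d, which removes the
  -- denominator d⁴ down to d² in the product.
  have huv : u * v = d * (w - E.a₁ * y₁) := by
    rw [hu, hv, hdef, hw]; linear_combination h₁ - h₂
  have hsum : u ^ 2 + v ^ 2 + E.a₁ * d * (u + v) =
      2 * (x₁ ^ 3 + E.a₂ * x₁ ^ 2 + E.a₄ * x₁ + E.a₆) +
      2 * (x₂ ^ 3 + E.a₂ * x₂ ^ 2 + E.a₄ * x₂ + E.a₆) + (E.a₁ * x₂ + E.a₃) ^ 2 +
      E.a₁ * d * (E.a₁ * x₂ + E.a₃) := by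
    rw [hu, hv, hdef]; linear_combination 2 * h₁ + 2 * h₂
  have e1 : ((u / d) ^ 2 + E.a₁ * (u / d) - E.a₂ - x₁ - x₂) * d ^ 2 =
      u ^ 2 + E.a₁ * d * u - s * d ^ 2 := by
    rw [hs]; field_simp; ring
  have e2 : ((v / d) ^ 2 + E.a₁ * (v / d) - E.a₂ - x₁ - x₂) * d ^ 2 =
      v ^ 2 + E.a₁ * d * v - s * d ^ 2 := by
    rw [hs]; field_simp; ring
  apply mul_right_cancel₀ (pow_ne_zero 2 hd)
  have e3 : (u ^ 2 + E.a₁ * d * u - s * d ^ 2) * (v ^ 2 + E.a₁ * d * v - s * d ^ 2) =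
      (d * (w - E.a₁ * y₁)) ^ 2 + E.a₁ * d * (d * (w - E.a₁ * y₁)) * (u + v) +
      E.a₁ ^ 2 * d ^ 2 * (d * (w - E.a₁ * y₁)) -
      s * d ^ 2 * (2 * (x₁ ^ 3 + E.a₂ * x₁ ^ 2 + E.a₄ * x₁ + E.a₆) +
      2 * (x₂ ^ 3 + E.a₂ * x₂ ^ 2 + E.a₄ * x₂ + E.a₆) + (E.a₁ * x₂ + E.a₃) ^ 2 +
      E.a₁ * d * (E.a₁ * x₂ + E.a₃)) + s ^ 2 * d ^ 4 := by
    rw [← huv, ← hsum]; ring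
  calc _ = (((u / d) ^ 2 + E.a₁ * (u / d) - E.a₂ - x₁ - x₂) * d ^ 2) *
      (((v / d) ^ 2 + E.a₁ * (v / d) - E.a₂ - x₁ - x₂) * d ^ 2) := by ring
    _ = _ := by
      rw [e1, e2, e3, hu, hv, hw, hs, hdef]
      linear_combination (-E.a₁ ^ 2 * (x₁ - x₂) ^ 2) * h₁

lemma addX_self {x y : F} (h : E.Equation x y) (hy : y ≠ E.negY x y) :
    E.addX x x (E.slope x x y y) * (4 * x ^ 3 + E.b₂ * x ^ 2 + 2 * E.b₄ * x + E.b₆) =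
      x ^ 4 - E.b₄ * x ^ 2 - 2 * E.b₆ * x - E.b₈ := by
  rw [Affine.slope_of_Y_ne rfl hy]
  rw [Affine.equation_iff] at h
  have hd := sub_ne_zero.mpr hy
  simp only [Affine.addX, WeierstrassCurve.b₂, WeierstrassCurve.b₄,
    WeierstrassCurve.b₆, WeierstrassCurve.b₈]
  set d := y - E.negY x y with hdef
  have hd' : d = 2 * y + E.a₁ * x + E.a₃ := by rw [hdef, Affine.negY]; ring
  have e1 : 4 * x ^ 3 + (E.a₁ ^ 2 + 4 * E.a₂) * x ^ 2 + 2 * (2 * E.a₄ + E.a₁ * E.a₃) * x +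
      (E.a₃ ^ 2 + 4 * E.a₆) = d ^ 2 := by
    rw [hd']; linear_combination -4 * h
  rw [e1]
  field_simp
  rw [hd']
  linear_combination (-E.a₁ ^ 2 - 8 * x - 4 * E.a₂) * h

end Formulas

end Heights

end EllCount
end

noncomputable section
namespace EllCount
open WeierstrassCurve Polynomial Filter
open scoped Classical Polynomial.Bivariate

set_option linter.unusedSectionVars false

/-! ### Heights of multiples of the generic point, and surjectivity of multiplication -/

section MulDegree

section Formulas

variable {F : Type*} [Field F] {E : Affine F} {P Q : E.Point}

lemma xCoord_neg (P : E.Point) : xCoord (-P) = xCoord P := by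
  rcases P with _ | ⟨x, y, h⟩ <;> rfl

lemma xCoord_add_of_xCoord_ne (hP : P ≠ 0) (hQ : Q ≠ 0) (hx : xCoord P ≠ xCoord Q) :
    xCoord (P + Q) = E.addX (xCoord P) (xCoord Q)
      (E.slope (xCoord P) (xCoord Q) (yCoord P) (yCoord Q)) := by
  rcases P with _ | ⟨x₁, y₁, h₁⟩
  · exact absurd rfl hP
  rcases Q with _ | ⟨x₂, y₂, h₂⟩
  · exact absurd rfl hQ
  rw [Affine.Point.add_some (fun h : x₁ = x₂ ∧ _ => hx h.1)]
  rfl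

lemma yCoord_neg (hQ : Q ≠ 0) : yCoord (-Q) = E.negY (xCoord Q) (yCoord Q) := by
  rcases Q with _ | ⟨x₂, y₂, h₂⟩
  · exact absurd rfl hQ
  rfl

lemma xCoord_sub_of_xCoord_ne (hP : P ≠ 0) (hQ : Q ≠ 0) (hx : xCoord P ≠ xCoord Q) :
    xCoord (P - Q) = E.addX (xCoord P) (xCoord Q)
      (E.slope (xCoord P) (xCoord Q) (yCoord P) (E.negY (xCoord Q) (yCoord Q))) := by
  rw [sub_eq_add_neg, xCoord_add_of_xCoord_ne hP (neg_ne_zero.mpr hQ) (by rwa [xCoord_neg]),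
    xCoord_neg, yCoord_neg hQ]

lemma xCoord_add_add_xCoord_sub (hP : P ≠ 0) (hQ : Q ≠ 0) (hx : xCoord P ≠ xCoord Q) :
    (xCoord (P + Q) + xCoord (P - Q)) * (xCoord P - xCoord Q) ^ 2 =
      2 * xCoord P * xCoord Q * (xCoord P + xCoord Q) + E.b₂ * xCoord P * xCoord Q +
        E.b₄ * (xCoord P + xCoord Q) + E.b₆ := by
  rw [xCoord_add_of_xCoord_ne hP hQ hx, xCoord_sub_of_xCoord_ne hP hQ hx]
  exact addX_add_addX_sub (equation_coord hP) (equation_coord hQ) hx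

lemma xCoord_add_mul_xCoord_sub (hP : P ≠ 0) (hQ : Q ≠ 0) (hx : xCoord P ≠ xCoord Q) :
    (xCoord (P + Q) * xCoord (P - Q)) * (xCoord P - xCoord Q) ^ 2 =
      xCoord P ^ 2 * xCoord Q ^ 2 - E.b₄ * xCoord P * xCoord Q -
        E.b₆ * (xCoord P + xCoord Q) - E.b₈ := by
  rw [xCoord_add_of_xCoord_ne hP hQ hx, xCoord_sub_of_xCoord_ne hP hQ hx]
  exact addX_mul_addX_sub (equation_coord hP) (equation_coord hQ) hx

lemma eq_or_eq_neg_of_xCoord_eq (hP : P ≠ 0) (hQ : Q ≠ 0) (hx : xCoord P = xCoord Q) :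
    P = Q ∨ P = -Q := by
  rcases P with _ | ⟨x₁, y₁, h₁⟩
  · exact absurd rfl hP
  rcases Q with _ | ⟨x₂, y₂, h₂⟩
  · exact absurd rfl hQ
  change x₁ = x₂ at hx
  rcases Affine.Y_eq_of_X_eq h₁.1 h₂.1 hx with h | h
  · left; exact point_some_congr hx h
  · right; exact point_some_congr hx h

end Formulas

lemma natDegree_add_le_of_le' {K : Type*} [Field K] {p q : K[X]} {k : ℕ} (hp : p.natDegree ≤ k)
    (hq : q.natDegree ≤ k) : (p + q).natDegree ≤ k :=
  (natDegree_add_le_of_le hp hq).trans (by simp)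

/-- With x₁ = N'/D', the sum and the product of the abscissae of P ± G, where t = x(G), are written
over the common denominator (N' − tD')². The degrees are at most twice the height of x₁, plus 2 from
t. This is the upper half of the parallelogram law. -/
lemma exists_quadratic_forms {K L : Type*} [Field K] [Field L] [Algebra K L] {t : L}
    (ht : Function.Injective (aeval t : K[X] → L)) {N' D' : K[X]} {x₀ x₁ x₂ : L} (hD' : D' ≠ 0)
    (h' : x₁ * aeval t D' = aeval t N') (hx : x₁ ≠ t) {b₂ b₄ b₆ b₈ : K}
    (hs : (x₂ + x₀) * (x₁ - t) ^ 2 = 2 * x₁ * t * (x₁ + t) + algebraMap K L b₂ * x₁ * t +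
      algebraMap K L b₄ * (x₁ + t) + algebraMap K L b₆)
    (hp : (x₂ * x₀) * (x₁ - t) ^ 2 = x₁ ^ 2 * t ^ 2 - algebraMap K L b₄ * x₁ * t -
      algebraMap K L b₆ * (x₁ + t) - algebraMap K L b₈) :
    ∃ A B c : K[X], A.natDegree ≤ 2 * max N'.natDegree D'.natDegree + 2 ∧
      B.natDegree ≤ 2 * max N'.natDegree D'.natDegree + 2 ∧
      c.natDegree ≤ 2 * max N'.natDegree D'.natDegree + 2 ∧ c ≠ 0 ∧
      (x₂ + x₀) * aeval t c = aeval t B ∧ (x₂ * x₀) * aeval t c = aeval t A := by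
  set d' := max N'.natDegree D'.natDegree with hd'
  have dN : N'.natDegree ≤ d' := le_max_left _ _
  have dD : D'.natDegree ≤ d' := le_max_right _ _
  have dND : (N' * D').natDegree ≤ 2 * d' := natDegree_mul_le.trans (by omega)
  have dDD : (D' ^ 2).natDegree ≤ 2 * d' := natDegree_pow_le.trans (by omega)
  have dNN : (N' ^ 2).natDegree ≤ 2 * d' := natDegree_pow_le.trans (by omega)
  have dXp : ∀ p : K[X], p.natDegree ≤ 2 * d' → (X * p).natDegree ≤ 2 * d' + 2 := fun p hp =>
    natDegree_mul_le.trans (by rw [natDegree_X]; omega)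
  have dXXp : ∀ p : K[X], p.natDegree ≤ 2 * d' → (X ^ 2 * p).natDegree ≤ 2 * d' + 2 := fun p hp =>
    natDegree_mul_le.trans (by rw [natDegree_X_pow]; omega)
  have dCp : ∀ (a : K) (p : K[X]), p.natDegree ≤ 2 * d' + 2 → (C a * p).natDegree ≤ 2 * d' + 2 :=
    fun a p hp => (natDegree_C_mul_le a p).trans hp
  have hD'0 : aeval t D' ≠ 0 := (map_ne_zero_iff _ ht).mpr hD'
  have e2 : algebraMap K L 2 = 2 := map_ofNat _ _
  have ec : aeval t ((N' - X * D') ^ 2) = (x₁ - t) ^ 2 * aeval t D' ^ 2 := by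
    simp only [map_pow, map_sub, map_mul, aeval_X]
    rw [← h']; ring
  refine ⟨X ^ 2 * N' ^ 2 + C (-b₄) * (X * (N' * D')) + C (-b₆) * (N' * D') +
    C (-b₆) * (X * D' ^ 2) + C (-b₈) * D' ^ 2, C 2 * (X * N' ^ 2) + C 2 * (X ^ 2 * (N' * D')) +
    C b₂ * (X * (N' * D')) + C b₄ * (N' * D') + C b₄ * (X * D' ^ 2) + C b₆ * D' ^ 2,
    (N' - X * D') ^ 2, ?_, ?_, ?_, ?_, ?_, ?_⟩
  · refine natDegree_add_le_of_le' (natDegree_add_le_of_le' (natDegree_add_le_of_le' (natDegree_add_le_of_le' ?_ ?_) ?_) ?_) ?_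
    · exact dXXp _ dNN
    · exact dCp _ _ (dXp _ dND)
    · exact dCp _ _ (dND.trans (by omega))
    · exact dCp _ _ (dXp _ dDD)
    · exact dCp _ _ (dDD.trans (by omega))
  · refine natDegree_add_le_of_le' (natDegree_add_le_of_le' (natDegree_add_le_of_le' (natDegree_add_le_of_le' (natDegree_add_le_of_le' ?_ ?_) ?_) ?_) ?_) ?_
    · exact dCp _ _ (dXp _ dNN)
    · exact dCp _ _ (dXXp _ dND)
    · exact dCp _ _ (dXp _ dND)
    · exact dCp _ _ (dND.trans (by omega))
    · exact dCp _ _ (dXp _ dDD)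
    · exact dCp _ _ (dDD.trans (by omega))
  · refine natDegree_pow_le.trans ?_
    have : (N' - X * D').natDegree ≤ d' + 1 := (natDegree_sub_le _ _).trans
      (max_le (by omega) (natDegree_mul_le.trans (by rw [natDegree_X]; omega)))
    omega
  · intro h0
    rw [h0, map_zero] at ec
    exact mul_ne_zero (pow_ne_zero 2 (sub_ne_zero.mpr hx)) (pow_ne_zero 2 hD'0) ec.symm
  · rw [ec]
    simp only [map_add, map_mul, map_pow, aeval_X, aeval_C, e2]
    rw [← h']
    linear_combination (aeval t D') ^ 2 * hs
  · rw [ec]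
    simp only [map_add, map_mul, map_pow, map_neg, aeval_X, aeval_C]
    rw [← h']
    linear_combination (aeval t D') ^ 2 * hp

variable {K : Type*} [Field K] {W : Affine K} (L : Type*) [Field L]
  [Algebra W.CoordinateRing L] [IsFractionRing W.CoordinateRing L] [Algebra K L]
  [IsScalarTower K W.CoordinateRing L]

variable {L} in
lemma rep_aeval_fX (p : K[X]) : Rep W (aeval (fX W L) p) (fun X => p.eval (xCoord X)) := by
  have := rep_evalEval (W := W) (L := L) rep_fX rep_fY (C p)
  simpa [evalEval, aeval_def, eval_map] using this

variable [IsAlgClosed K] [W.IsElliptic]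

lemma transcendental_fX : Transcendental K (fX W L) := (nonconst_generic W L).transcendental

lemma aeval_fX_injective : Function.Injective (aeval (fX W L) : K[X] → L) :=
  transcendental_iff_injective.mp (transcendental_fX L)

lemma aeval_fX_ne_zero {p : K[X]} (hp : p ≠ 0) : aeval (fX W L) p ≠ 0 :=
  (map_ne_zero_iff _ (aeval_fX_injective L)).mpr hp

/-- The first coordinate of a point is a reduced fraction in `x`. -/
structure XRep (P : (W.baseChange L).toAffine.Point) (N D : K[X]) : Prop where
  coprime : IsCoprime N D
  ne_zero : D ≠ 0
  eq : xCoord P * aeval (fX W L) D = aeval (fX W L) N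

variable {L}

lemma exists_xRep {P : (W.baseChange L).toAffine.Point} {u v : K[X]} (hv : v ≠ 0)
    (h : xCoord P * aeval (fX W L) v = aeval (fX W L) u) : ∃ N D g : K[X], XRep L P N D ∧
    u = g * N ∧ v = g * D ∧ g ≠ 0 := by
  obtain ⟨g, N, D, rfl, rfl, hc, hg, hD⟩ := exists_coprime_rep u v hv
  refine ⟨N, D, g, ⟨hc, hD, ?_⟩, rfl, rfl, hg⟩
  apply mul_left_cancel₀ (aeval_fX_ne_zero (W := W) L hg)
  rw [map_mul, map_mul] at h
  linear_combination h

lemma nsmul_generic_ne_zero {n : ℕ} (hn : n ≠ 0) : n • generic W L ≠ 0 :=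
  (nonconst_nsmul_generic W L hn).ne_zero

/-- The parallelogram inequality for (k+1)G and G reads h((k+2)G) + h(kG) ≤ 2h((k+1)G) + 2. -/
lemma exists_xRep_succ {k : ℕ} (hk : k ≠ 0) {N D N' D' : K[X]}
    (h : XRep L (k • generic W L) N D) (h' : XRep L ((k + 1) • generic W L) N' D') :
    ∃ N'' D'', XRep L ((k + 2) • generic W L) N'' D'' ∧
      max N''.natDegree D''.natDegree + max N.natDegree D.natDegree ≤
        2 * max N'.natDegree D'.natDegree + 2 := by
  have hG : generic W L ≠ 0 := (nonconst_generic W L).ne_zero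
  have hP := nsmul_generic_ne_zero (W := W) (L := L) k.succ_ne_zero
  have e1 : (k + 1) • generic W L + generic W L = (k + 2) • generic W L := by
    rw [← succ_nsmul]
  have e2 : (k + 1) • generic W L - generic W L = k • generic W L := by
    rw [succ_nsmul, add_sub_cancel_right]
  have hx : xCoord ((k + 1) • generic W L) ≠ xCoord (generic W L) := by
    intro hx
    rcases eq_or_eq_neg_of_xCoord_eq hP hG hx with h1 | h1
    · rw [← sub_eq_zero, e2] at h1
      exact nsmul_generic_ne_zero hk h1
    · rw [eq_neg_iff_add_eq_zero, e1] at h1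
      exact nsmul_generic_ne_zero (by omega) h1
  have hs := xCoord_add_add_xCoord_sub hP hG hx
  have hp := xCoord_add_mul_xCoord_sub hP hG hx
  rw [e1, e2] at hs hp
  have hxG : xCoord (generic W L) = fX W L := rfl
  rw [hxG] at hs hp hx
  have b2 : (W.baseChange L).b₂ = algebraMap K L W.b₂ := WeierstrassCurve.map_b₂ _ _
  have b4 : (W.baseChange L).b₄ = algebraMap K L W.b₄ := WeierstrassCurve.map_b₄ _ _
  have b6 : (W.baseChange L).b₆ = algebraMap K L W.b₆ := WeierstrassCurve.map_b₆ _ _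
  have b8 : (W.baseChange L).b₈ = algebraMap K L W.b₈ := WeierstrassCurve.map_b₈ _ _
  rw [b2, b4, b6] at hs
  rw [b4, b6, b8] at hp
  obtain ⟨A, B, c, dA, dB, dC, hc0, hs', hp'⟩ := exists_quadratic_forms (aeval_fX_injective (W := W) L)
    h'.ne_zero h'.eq hx hs hp
  -- The abscissa of (k+2)G is the sum B/c minus the abscissa N/D of kG, brought to a common
  -- denominator before reduction.
  obtain ⟨N'', D'', g, h'', -, -, -⟩ := exists_xRep (P := (k + 2) • generic W L)
    (u := B * D - N * c) (v := c * D) (mul_ne_zero hc0 h.ne_zero) (by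
      simp only [map_mul, map_sub, ← h.eq, ← hs']; ring)
  refine ⟨N'', D'', h'', ?_⟩
  refine max_natDegree_add_le h''.coprime h.coprime h''.ne_zero h.ne_zero hc0 (B := B) (A := A)
    ?_ ?_ dA dB dC
  · apply aeval_fX_injective (W := W) L
    simp only [map_mul, map_add, ← h.eq, ← hs', ← h''.eq]; ring
  · apply aeval_fX_injective (W := W) L
    simp only [map_mul, ← h.eq, ← hp', ← h''.eq]; ring

lemma xRep_generic : XRep L (generic W L) X 1 :=
  ⟨isCoprime_one_right, one_ne_zero, by rw [map_one, mul_one, aeval_X]; rfl⟩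

lemma exists_xRep_two : ∃ N D, XRep L (2 • generic W L) N D ∧
    max N.natDegree D.natDegree ≤ 4 := by
  have hE := generic_equation W L
  have hy : fY W L ≠ (W.baseChange L).toAffine.negY (fX W L) (fY W L) := by
    intro h
    apply nsmul_generic_ne_zero (W := W) (L := L) two_ne_zero
    rw [two_nsmul]
    exact Affine.Point.add_of_Y_eq rfl h
  have e : xCoord (2 • generic W L) = (W.baseChange L).toAffine.addX (fX W L) (fX W L)
      ((W.baseChange L).toAffine.slope (fX W L) (fX W L) (fY W L) (fY W L)) := by
    rw [two_nsmul, generic, Affine.Point.add_some (fun h => hy h.2)]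
    rfl
  have h := addX_self hE hy
  have b2 : (W.baseChange L).b₂ = algebraMap K L W.b₂ := WeierstrassCurve.map_b₂ _ _
  have b4 : (W.baseChange L).b₄ = algebraMap K L W.b₄ := WeierstrassCurve.map_b₄ _ _
  have b6 : (W.baseChange L).b₆ = algebraMap K L W.b₆ := WeierstrassCurve.map_b₆ _ _
  have b8 : (W.baseChange L).b₈ = algebraMap K L W.b₈ := WeierstrassCurve.map_b₈ _ _
  rw [← e, b2, b4, b6, b8] at h
  set u : K[X] := X ^ 4 - C W.b₄ * X ^ 2 - C (2 * W.b₆) * X - C W.b₈ with hu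
  set v : K[X] := C 4 * X ^ 3 + C W.b₂ * X ^ 2 + C (2 * W.b₄) * X + C W.b₆ with hv
  have eu : aeval (fX W L) u = fX W L ^ 4 - algebraMap K L W.b₄ * fX W L ^ 2 -
      2 * algebraMap K L W.b₆ * fX W L - algebraMap K L W.b₈ := by
    simp [hu, map_ofNat]
  have ev : aeval (fX W L) v = 4 * fX W L ^ 3 + algebraMap K L W.b₂ * fX W L ^ 2 +
      2 * algebraMap K L W.b₄ * fX W L + algebraMap K L W.b₆ := by
    have e2 : algebraMap K L 2 = 2 := map_ofNat _ _
    have e4 : algebraMap K L 4 = 4 := map_ofNat _ _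
    simp only [hv, map_add, map_mul, map_pow, aeval_X, aeval_C, e2, e4]
  have hv0 : v ≠ 0 := by
    intro h0
    rw [h0, map_zero] at ev
    apply pow_ne_zero 2 (sub_ne_zero.mpr hy)
    rw [← b2, ← b4, ← b6] at ev
    rw [Affine.equation_iff] at hE
    rw [ev]
    simp only [Affine.negY, WeierstrassCurve.b₂, WeierstrassCurve.b₄, WeierstrassCurve.b₆]
    linear_combination 4 * hE
  obtain ⟨N, D, g, hND, e1, e2, hg⟩ := exists_xRep (P := 2 • generic W L) hv0 (u := u) (by
    rw [eu, ev]; exact h)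
  refine ⟨N, D, hND, max_le ?_ ?_⟩
  · refine (natDegree_le_of_eq_mul e1 hg).trans ?_
    rw [hu]; compute_degree!
  · refine (natDegree_le_of_eq_mul e2 hg).trans ?_
    rw [hv]; compute_degree!

variable (W L) in
-- The second differences of the heights are at most 2, and h(G) = 1, h(2G) ≤ 4, so h(nG) ≤ n². The
-- induction carries the bound 2k + 3 on the current increment, because that is what the
-- parallelogram inequality propagates.
lemma exists_xRep_nsmul {n : ℕ} (hn : n ≠ 0) : ∃ N D, XRep L (n • generic W L) N D ∧
    max N.natDegree D.natDegree ≤ n ^ 2 := by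
  have key : ∀ k : ℕ, ∃ N D N' D', XRep L ((k + 1) • generic W L) N D ∧
      XRep L ((k + 2) • generic W L) N' D' ∧
      max N'.natDegree D'.natDegree ≤ max N.natDegree D.natDegree + (2 * k + 3) ∧
      max N.natDegree D.natDegree ≤ (k + 1) ^ 2 := by
    intro k
    induction k with
    | zero =>
      obtain ⟨N, D, h, hd⟩ := exists_xRep_two (W := W) (L := L)
      refine ⟨X, 1, N, D, by simpa using xRep_generic, h, ?_, ?_⟩
      · simpa using hd
      · simp
    | succ k ih =>
      obtain ⟨N, D, N', D', h, h', hd, hk⟩ := ih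
      obtain ⟨N'', D'', h'', hd''⟩ := exists_xRep_succ k.succ_ne_zero h h'
      exact ⟨N', D', N'', D'', h', h'', by omega, by nlinarith⟩
  obtain ⟨k, rfl⟩ := Nat.exists_eq_succ_of_ne_zero hn
  obtain ⟨N, D, -, -, h, -, -, hk⟩ := key k
  exact ⟨N, D, h, hk⟩

lemma XRep.eval_right_ne_zero {P : (W.baseChange L).toAffine.Point} {N D : K[X]} (h : XRep L P N D)
    {x : K} (hx : D.eval x = 0) : N.eval x ≠ 0 := by
  intro h0
  obtain ⟨a, b, hab⟩ := h.coprime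
  have := congrArg (eval x) hab
  simp [hx, h0] at this

variable (W) in
/-- Multiplication by `n ≠ 0` is surjective on points over an algebraically closed field. -/
lemma nsmul_surjective {n : ℕ} (hn : n ≠ 0) : Function.Surjective (fun X : W.Point => n • X) := by
  have := infinite_point W
  obtain ⟨N, D, h, -⟩ := exists_xRep_nsmul W (FF W) hn
  have hG := nonconst_nsmul_generic W (FF W) hn
  obtain ⟨hev, hrep, -⟩ := (spec_nsmul_generic (W := W) (L := FF W) n).coord hG.ne_zero
  have hid := ((hrep.mul (rep_aeval_fX D)).eq (h.eq ▸ rep_aeval_fX N)).and hev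
  set bad := {X : W.Point | ¬ ((fun X => xCoord (n • X) * D.eval (xCoord X)) X = N.eval (xCoord X) ∧
    n • X ≠ 0)} with hbad
  have hbfin : bad.Finite := hid
  -- For almost every c the equation N = cD has a root. Two exceptional values of c would make N and
  -- D constant, against the transcendence of x(nG).
  have hdeg : {c : K | (N - C c * D).natDegree = 0}.Finite := by
    by_contra hinf
    obtain ⟨c, hc, c', hc', hne⟩ := (show Set.Infinite _ from hinf).nontrivial
    obtain ⟨a, ha⟩ := natDegree_eq_zero.mp hc
    obtain ⟨a', ha'⟩ := natDegree_eq_zero.mp hc'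
    have hcc : c - c' ≠ 0 := sub_ne_zero.mpr hne
    have hD : D = C ((a' - a) / (c - c')) := by
      have : C (c - c') * D = C (a' - a) := by
        rw [map_sub, map_sub]; linear_combination ha - ha'
      rw [div_eq_mul_inv, map_mul, ← this, mul_assoc, mul_comm D, ← mul_assoc, ← map_mul,
        mul_inv_cancel₀ hcc, map_one, one_mul]
    have hN : N = C (a + c * ((a' - a) / (c - c'))) := by
      rw [map_add, map_mul, ha, ← hD]; ring
    apply hG.transcendental
    have heq := h.eq
    have hD0 : (a' - a) / (c - c') ≠ 0 := fun h0 => h.ne_zero (by rw [hD, h0, map_zero])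
    rw [hD, hN, aeval_C, aeval_C] at heq
    have : xCoord (n • generic W (FF W)) = algebraMap K (FF W)
        ((a + c * ((a' - a) / (c - c'))) / ((a' - a) / (c - c'))) := by
      rw [map_div₀, eq_div_iff ((_root_.map_ne_zero _).mpr hD0), heq]
    rw [this]
    exact isAlgebraic_algebraMap _
  have hgood : ∀ᶠ S : W.Point in cofinite, ∃ X : W.Point, n • X = S := by
    have hfin := hdeg.union (hbfin.image (fun X => N.eval (xCoord X) / D.eval (xCoord X)))
    filter_upwards [eventually_xCoord_notMem hfin] with S hS
    obtain ⟨hS0, hS⟩ := hS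
    rw [Set.mem_union, not_or] at hS
    obtain ⟨x₁, hx₁⟩ := IsAlgClosed.exists_root (N - C (xCoord S) * D) (by
      intro h0
      exact hS.1 (natDegree_eq_of_degree_eq_some h0))
    have hx₁' : N.eval x₁ = xCoord S * D.eval x₁ := by
      simpa [IsRoot, sub_eq_zero] using hx₁
    have hD₁ : D.eval x₁ ≠ 0 := by
      intro h0
      exact h.eval_right_ne_zero h0 (by rw [hx₁', h0, mul_zero])
    obtain ⟨P, hP0, rfl⟩ := exists_point_of_xCoord W x₁
    have hPgood : P ∉ bad := by
      intro hPb
      refine hS.2 ⟨P, hPb, ?_⟩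
      change N.eval (xCoord P) / D.eval (xCoord P) = _
      rw [hx₁', mul_div_assoc, div_self hD₁, mul_one]
    rw [hbad, Set.mem_ofPred_eq, not_not] at hPgood
    obtain ⟨h1, h2⟩ := hPgood
    have h3 : xCoord (n • P) = xCoord S := mul_right_cancel₀ hD₁ (h1.trans hx₁')
    rcases eq_or_eq_neg_of_xCoord_eq h2 hS0 h3 with h4 | h4
    · exact ⟨P, h4⟩
    · exact ⟨-P, by rw [smul_neg, h4, neg_neg]⟩
  -- The image of [n] misses only finitely many points, so some T and T + S both lie in it, and S is
  -- the difference of two multiples of n.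
  intro S
  obtain ⟨T, ⟨X₁, h1⟩, ⟨X₂, h2⟩⟩ := (hgood.and ((tendsto_add S).eventually hgood)).exists
  exact ⟨X₂ - X₁, by change n • (X₂ - X₁) = S; rw [smul_sub, h1, h2]; abel⟩

end MulDegree

end EllCount
end

noncomputable section
namespace EllCount
open WeierstrassCurve Polynomial Filter
open scoped Classical Polynomial.Bivariate

set_option linter.unusedSectionVars false

/-! ### The degree of the function field over the pullback along [n], and the size of E[n] -/

section FieldDegree

open IntermediateField Module

lemma finrank_adjoin_simple_le {k L : Type*} [Field k] [Field L] [Algebra k L] {z : L} {p : k[X]}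
    (hp : p ≠ 0) (h : aeval z p = 0) : FiniteDimensional k k⟮z⟯ ∧ finrank k k⟮z⟯ ≤ p.natDegree := by
  have hi : IsIntegral k z := isAlgebraic_iff_isIntegral.mp ⟨p, hp, h⟩
  refine ⟨adjoin.finiteDimensional hi, ?_⟩
  rw [adjoin.finrank hi]
  exact natDegree_le_natDegree (minpoly.degree_le_of_ne_zero k z hp h)

variable {K : Type*} [Field K] {W : Affine K} {L : Type*} [Field L]
  [Algebra W.CoordinateRing L] [IsFractionRing W.CoordinateRing L] [Algebra K L]
  [IsScalarTower K W.CoordinateRing L]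

lemma mem_of_coord_mem (S : Subfield L) (hK : ∀ c, algebraMap K L c ∈ S) (hx : fX W L ∈ S)
    (hy : fY W L ∈ S) (h : L) : h ∈ S := by
  have key : ∀ a : W.CoordinateRing, algebraMap _ L a ∈ S := by
    intro a
    obtain ⟨f, rfl⟩ := AdjoinRoot.mk_surjective a
    change algebraMap _ L (Affine.CoordinateRing.mk W f) ∈ S
    induction f using Polynomial.induction_on' with
    | add p q hp hq => rw [map_add, map_add]; exact S.add_mem hp hq
    | monomial n p =>
      rw [← C_mul_X_pow_eq_monomial, map_mul, map_mul, map_pow, map_pow]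
      refine S.mul_mem ?_ (S.pow_mem hy n)
      induction p using Polynomial.induction_on' with
      | add p q hp hq => rw [map_add, map_add, map_add]; exact S.add_mem hp hq
      | monomial n p =>
        rw [← C_mul_X_pow_eq_monomial, map_mul, map_mul, map_mul, map_pow, map_pow, map_pow]
        refine S.mul_mem ?_ (S.pow_mem hx n)
        have := hK p
        rwa [IsScalarTower.algebraMap_apply K W.CoordinateRing L] at this
  obtain ⟨a, b, -, rfl⟩ := IsFractionRing.div_surjective (A := W.CoordinateRing) h
  exact S.div_mem (key a) (key b)

variable [IsAlgClosed K] [W.IsElliptic]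

lemma fY_ne_negY : fY W L ≠ (W.baseChange L).toAffine.negY (fX W L) (fY W L) := by
  intro h
  apply nsmul_generic_ne_zero (W := W) (L := L) two_ne_zero
  rw [two_nsmul]
  exact Affine.Point.add_of_Y_eq rfl h

/-- Pullback along negation fixes K(x) and moves y. -/
lemma fY_notMem_adjoin : fY W L ∉ K⟮fX W L⟯ := by
  intro hy
  have hG := (nonconst_generic W L).neg
  have key : ∀ z ∈ K⟮fX W L⟯, pull _ hG z = z := by
    intro z hz
    induction hz using adjoin_induction with
    | mem z hz =>
      rw [Set.mem_singleton_iff] at hz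
      rw [hz, pull_fX]; rfl
    | algebraMap c => exact AlgHom.commutes _ _
    | add a b _ _ ha hb => rw [map_add, ha, hb]
    | inv a _ ha => rw [map_inv₀, ha]
    | mul a b _ _ ha hb => rw [map_mul, ha, hb]
  have h := key _ hy
  rw [pull_fY] at h
  exact fY_ne_negY h.symm

variable (W L) in
/-- Pullback of functions by multiplication by `n`. -/
def mulPull {n : ℕ} (hn : n ≠ 0) : L →ₐ[K] L := pull _ (nonconst_nsmul_generic W L hn)

lemma Rep.mulPull {n : ℕ} (hn : n ≠ 0) {h : L} {φ : W.Point → K} (H : Rep W h φ) :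
    Rep W (mulPull W L hn h) (fun X => φ (n • X)) := H.pull _ (spec_nsmul_generic n)

variable (W L) in
-- Put x_n = x(nG) = N/D. Then x is a root of N(X) − x_n D(X), of degree at most n², and y is
-- quadratic over K(x). So the whole field has degree at most 2n² over K(x_n). The image of [n]*
-- lies strictly above K(x_n), which accounts for a factor of at least 2.
lemma finrank_mulPull {n : ℕ} (hn : n ≠ 0) :
    FiniteDimensional (mulPull W L hn).fieldRange L ∧
      finrank (mulPull W L hn).fieldRange L ≤ n ^ 2 := by
  obtain ⟨N, D, h, hdeg⟩ := exists_xRep_nsmul W L hn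
  have hG := nonconst_nsmul_generic W L hn
  set xn := xCoord (n • generic W L) with hxn
  set μ := mulPull W L hn with hμ
  have hμx : μ (fX W L) = xn := pull_fX hG
  set k : IntermediateField K L := K⟮xn⟯ with hk
  let t : k := ⟨xn, mem_adjoin_simple_self K xn⟩
  let p : k[X] := N.map (algebraMap K k) - C t * D.map (algebraMap K k)
  have hp0 : p ≠ 0 := by
    intro h0
    obtain ⟨i, hi⟩ : ∃ i, D.coeff i ≠ 0 := by
      by_contra! hcon
      exact h.ne_zero (Polynomial.ext hcon)
    have h1 := congrArg (fun q : k[X] => ((q.coeff i : k) : L)) h0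
    simp only [p, coeff_sub, coeff_map, coeff_C_mul, coeff_zero] at h1
    have h2 : algebraMap K L (N.coeff i) - xn * algebraMap K L (D.coeff i) = 0 := h1
    apply hG.transcendental
    have : xn = algebraMap K L (N.coeff i / D.coeff i) := by
      rw [map_div₀, eq_div_iff ((_root_.map_ne_zero _).mpr hi)]
      linear_combination -h2
    rw [← hxn, this]
    exact isAlgebraic_algebraMap _
  have hpd : p.natDegree ≤ n ^ 2 := by
    refine le_trans ?_ hdeg
    refine (natDegree_sub_le _ _).trans (max_le_max natDegree_map_le ?_)
    exact (natDegree_C_mul_le _ _).trans natDegree_map_le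
  have hpx : aeval (fX W L) p = 0 := by
    have e : ∀ q : K[X], aeval (fX W L) (q.map (algebraMap K k)) = aeval (fX W L) q :=
      fun q => aeval_map_algebraMap k (fX W L) q
    simp only [p, map_sub, map_mul, e, aeval_C]
    rw [← h.eq]
    exact sub_self _
  obtain ⟨f1, d1⟩ := finrank_adjoin_simple_le hp0 hpx
  set k' := k⟮fX W L⟯ with hk'
  let s : k' := ⟨fX W L, mem_adjoin_simple_self k (fX W L)⟩
  have hE := (equation_baseChange _ _).mp (generic_equation W L)
  let c : K → k' := algebraMap K k'
  let r : k'[X] := X ^ 2 + C (c W.a₁ * s + c W.a₃) * X +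
    C (-(s ^ 3 + c W.a₂ * s ^ 2 + c W.a₄ * s + c W.a₆))
  have hrd : r.natDegree = 2 := by simp only [r]; compute_degree!
  have hr0 : r ≠ 0 := by
    intro h0
    rw [h0] at hrd
    simp at hrd
  have hry : aeval (fY W L) r = 0 := by
    simp only [r, map_add, map_mul, map_pow, aeval_X, aeval_C]
    change fY W L ^ 2 + (algebraMap K L W.a₁ * fX W L + algebraMap K L W.a₃) * fY W L +
      -(fX W L ^ 3 + algebraMap K L W.a₂ * fX W L ^ 2 + algebraMap K L W.a₄ * fX W L +
      algebraMap K L W.a₆) = 0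
    linear_combination hE
  obtain ⟨f2, d2⟩ := finrank_adjoin_simple_le hr0 hry
  have htop : k'⟮fY W L⟯ = ⊤ := by
    refine eq_top_iff.mpr fun z _ => ?_
    refine mem_of_coord_mem (W := W) k'⟮fY W L⟯.toSubfield (fun c => ?_) ?_ ?_ z
    · exact k'⟮fY W L⟯.algebraMap_mem (algebraMap K k' c)
    · exact k'⟮fY W L⟯.algebraMap_mem s
    · exact mem_adjoin_simple_self k' (fY W L)
  have f3 : FiniteDimensional k' L := by
    rw [htop] at f2
    exact Module.Finite.equiv topEquiv.toLinearEquiv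
  have d3 : finrank k' L ≤ 2 := by
    rw [htop, hrd, finrank_top'] at d2
    exact d2
  have f4 : FiniteDimensional k L := FiniteDimensional.trans k k' L
  have d4 : finrank k L ≤ n ^ 2 * 2 := by
    have := Module.Free.of_divisionRing k k'
    have := Module.Free.of_divisionRing k' L
    rw [← finrank_mul_finrank k k' L]
    exact Nat.mul_le_mul (d1.trans hpd) d3
  have hkM : k ≤ μ.fieldRange := by
    rw [hk, adjoin_simple_le_iff, ← hμx]
    exact ⟨_, rfl⟩
  have hmul := relfinrank_mul_finrank_top hkM
  have hpos : 0 < finrank k L := finrank_pos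
  -- K(x_n) is the image of K(x) under the injective map [n]*, and y ∉ K(x).
  have hrel1 : relfinrank k μ.fieldRange ≠ 1 := by
    rw [Ne, relfinrank_eq_one_iff]
    intro hle
    have hy : μ (fY W L) ∈ k := hle ⟨_, rfl⟩
    have hkm : k = K⟮fX W L⟯.map μ := by
      rw [adjoin_map, Set.image_singleton, hμx]
    rw [hkm, IntermediateField.mem_map] at hy
    obtain ⟨z, hz, hzy⟩ := hy
    rw [μ.toRingHom.injective hzy] at hz
    exact fY_notMem_adjoin hz
  have hrel0 : relfinrank k μ.fieldRange ≠ 0 := by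
    intro h0
    rw [h0, zero_mul] at hmul
    omega
  have hM0 : finrank μ.fieldRange L ≠ 0 := by
    intro h0
    rw [h0, mul_zero] at hmul
    omega
  refine ⟨FiniteDimensional.of_finrank_pos (Nat.pos_of_ne_zero hM0), ?_⟩
  have : 2 ≤ relfinrank k μ.fieldRange := by omega
  nlinarith

/-- The `n`-torsion of a commutative group. -/
abbrev tors (A : Type*) [AddCommGroup A] (n : ℕ) : AddSubgroup A := AddSubgroup.torsionBy A (n : ℤ)

lemma mem_tors {A : Type*} [AddCommGroup A] {n : ℕ} {a : A} : a ∈ tors A n ↔ n • a = 0 := by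
  rw [← natCast_zsmul]; rfl

variable (W) in
lemma finite_tors {n : ℕ} (hn : n ≠ 0) : Finite (tors W.Point n) := by
  refine ((finite_torsion W hn).subset ?_).to_subtype
  intro X hX
  exact mem_tors.mp hX

variable (W L) in
/-- Translations by points of order dividing `n`. -/
def torsGal (n : ℕ) : Subgroup (L ≃ₐ[K] L) :=
  (AddSubgroup.toSubgroup (tors W.Point n)).map (tauHom W L)

lemma card_torsGal (n : ℕ) : Nat.card (torsGal W L n) = Nat.card (tors W.Point n) :=
  Subgroup.card_map_of_injective tauHom_injective

lemma tau_mulPull {n : ℕ} (hn : n ≠ 0) {S : W.Point} (hS : n • S = 0) (h : L) :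
    tau L S (mulPull W L hn h) = mulPull W L hn h := by
  have := infinite_point W
  obtain ⟨φ, hφ⟩ := exists_rep (W := W) h
  refine ((hφ.mulPull hn).tau S).injective ((hφ.mulPull hn).congr
    (Eventually.of_forall fun X => ?_))
  simp only [smul_add, hS, add_zero]

lemma mulPull_fieldRange_le {n : ℕ} (hn : n ≠ 0) :
    (mulPull W L hn).fieldRange.toSubfield ≤ FixedPoints.subfield (torsGal W L n) L := by
  rintro _ ⟨h, rfl⟩ ⟨_, S, hS, rfl⟩
  exact tau_mulPull hn (mem_tors.mp hS) h

/-- By Artin's theorem the degree over the field fixed by the translations is the number of torsion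
points. That field contains the image of [n]*. -/
lemma relfinrank_mul_card {n : ℕ} (hn : n ≠ 0) :
    Subfield.relfinrank (mulPull W L hn).fieldRange.toSubfield
      (FixedPoints.subfield (torsGal W L n) L) * Nat.card (tors W.Point n) =
      finrank (mulPull W L hn).fieldRange L := by
  have := finite_tors W hn
  have hfin : Finite (torsGal W L n) := Nat.finite_of_card_ne_zero (by
    rw [card_torsGal]; exact Nat.card_pos.ne')
  have := Fintype.ofFinite (torsGal W L n)
  rw [← card_torsGal (W := W) (L := L), Nat.card_eq_fintype_card,
    ← FixedPoints.finrank_eq_card (torsGal W L n) L]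
  exact Subfield.relfinrank_mul_finrank_top (mulPull_fieldRange_le hn)

variable (W) in
lemma card_tors_le {n : ℕ} (hn : n ≠ 0) : Nat.card (tors W.Point n) ≤ n ^ 2 := by
  obtain ⟨hf, hd⟩ := finrank_mulPull W (FF W) hn
  have h := relfinrank_mul_card (W := W) (L := FF W) hn
  have hpos : 0 < finrank (mulPull W (FF W) hn).fieldRange (FF W) := finrank_pos
  have : Subfield.relfinrank (mulPull W (FF W) hn).fieldRange.toSubfield
      (FixedPoints.subfield (torsGal W (FF W) n) (FF W)) ≠ 0 := by
    intro h0
    rw [h0, zero_mul] at h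
    omega
  have : 1 ≤ Subfield.relfinrank (mulPull W (FF W) hn).fieldRange.toSubfield
      (FixedPoints.subfield (torsGal W (FF W) n) (FF W)) := by omega
  nlinarith

/-- If #E[n] = n², the degree bound n² leaves no room for an intermediate index above 1. -/
lemma fixedPoints_le {n : ℕ} (hn : n ≠ 0) (hc : Nat.card (tors W.Point n) = n ^ 2) :
    FixedPoints.subfield (torsGal W L n) L ≤ (mulPull W L hn).fieldRange.toSubfield := by
  rw [← Subfield.relfinrank_eq_one_iff]
  obtain ⟨hf, hd⟩ := finrank_mulPull W L hn
  have h := relfinrank_mul_card (W := W) (L := L) hn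
  have hpos : 0 < finrank (mulPull W L hn).fieldRange L := finrank_pos
  rw [hc] at h
  have hn2 : 0 < n ^ 2 := by positivity
  set r := Subfield.relfinrank (mulPull W L hn).fieldRange.toSubfield
      (FixedPoints.subfield (torsGal W L n) L)
  have h0 : r ≠ 0 := by
    intro h0
    rw [h0, zero_mul] at h
    omega
  by_contra h1
  have : 2 ≤ r := by omega
  nlinarith

/-- If all `n²` points of order dividing `n` exist, then functions invariant under translation by
them are pulled back along multiplication by `n`. -/
lemma exists_mulPull_eq {n : ℕ} (hn : n ≠ 0) (hc : Nat.card (tors W.Point n) = n ^ 2) {h : L}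
    (hh : ∀ S : W.Point, n • S = 0 → tau L S h = h) : ∃ h', mulPull W L hn h' = h := by
  have : h ∈ FixedPoints.subfield (torsGal W L n) L := by
    rintro ⟨_, S, hS, rfl⟩
    exact hh S.toAdd (mem_tors.mp hS)
  exact fixedPoints_le hn hc this

lemma invD_mulPull {n : ℕ} (hn : n ≠ 0) (h0 : (n : K) = 0) (h : L) :
    invD W L (mulPull W L hn h) = 0 := by
  have hG := nonconst_nsmul_generic W L hn
  have hD := (IsDMul.nsmul_generic (W := W) (L := L) n).2 hG.ne_zero
  have hL : (n : L) = 0 := by rw [← map_natCast (algebraMap K L), h0, map_zero]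
  rw [hL, zero_mul, zero_mul] at hD
  -- The functions whose pullback has derivative zero form a subfield. It contains the constants,
  -- and x and y because [n] has multiplier n = 0.
  let S : Subfield L :=
    { carrier := {z | invD W L (mulPull W L hn z) = 0}
      mul_mem' := by
        intro a b ha hb
        simp only [Set.mem_ofPred_eq] at *
        rw [map_mul, Derivation.leibniz, ha, hb]; simp
      one_mem' := by simp
      add_mem' := by
        intro a b ha hb
        simp only [Set.mem_ofPred_eq] at *
        rw [map_add, map_add, ha, hb, add_zero]
      zero_mem' := by simp
      neg_mem' := by
        intro a ha
        simp only [Set.mem_ofPred_eq] at *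
        rw [map_neg, map_neg, ha, neg_zero]
      inv_mem' := by
        intro a ha
        simp only [Set.mem_ofPred_eq] at *
        rw [map_inv₀, Derivation.leibniz_inv, ha, smul_zero] }
  refine mem_of_coord_mem (W := W) S ?_ ?_ ?_ h
  · intro c
    change invD W L (mulPull W L hn (algebraMap K L c)) = 0
    rw [AlgHom.commutes, Derivation.map_algebraMap]
  · change invD W L (mulPull W L hn (fX W L)) = 0
    rw [mulPull, pull_fX, hD.1]
  · change invD W L (mulPull W L hn (fY W L)) = 0
    rw [mulPull, pull_fY, hD.2]

variable (W) in
-- With n² torsion points the fixed field is the image of [n]*, on which the derivation vanishes.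
-- The function field is separable over that fixed field, so the derivation is zero everywhere. This
-- contradicts D x = W_Y and D y = −W_X, which are not both zero.
lemma card_tors_lt {n : ℕ} (hn : n ≠ 0) (h0 : (n : K) = 0) :
    Nat.card (tors W.Point n) < n ^ 2 := by
  refine lt_of_le_of_ne (card_tors_le W hn) fun hc => ?_
  have := finite_tors W hn
  have hfin : Finite (torsGal W (FF W) n) := Nat.finite_of_card_ne_zero (by
    rw [card_torsGal]; exact Nat.card_pos.ne')
  set M := FixedPoints.subfield (torsGal W (FF W) n) (FF W) with hM
  have hDM : ∀ c : M, invD W (FF W) (c : FF W) = 0 := by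
    intro c
    obtain ⟨z, hz⟩ := fixedPoints_le hn hc c.2
    rw [← hz]
    exact invD_mulPull hn h0 z
  let D : Derivation M (FF W) (FF W) := Derivation.mk'
    { toFun := invD W (FF W)
      map_add' := map_add _
      map_smul' := by
        intro c z
        rw [Subfield.smul_def, smul_eq_mul, Derivation.leibniz, hDM, smul_zero, add_zero]
        rfl }
    (fun a b => Derivation.leibniz _ a b)
  have hD0 : ∀ z, invD W (FF W) z = 0 := by
    intro z
    have h1 := D.map_aeval (minpoly M z) z
    rw [minpoly.aeval, map_zero] at h1
    have h2 := (Algebra.IsSeparable.isSeparable M z).aeval_derivative_ne_zero (minpoly.aeval M z)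
    exact (mul_eq_zero.mp h1.symm).resolve_left h2
  have hns := Affine.equation_iff_nonsingular.mp (generic_equation W (FF W))
  rcases psiY_ne_zero_or hns with h | h
  · exact h (by rw [← invD_fX, hD0])
  · exact h (by rw [← invD_fY, hD0])

end FieldDegree

end EllCount
end

noncomputable section
namespace EllCount
open WeierstrassCurve Polynomial Filter
open scoped Classical Polynomial.Bivariate

set_option linter.unusedSectionVars false

/-! ### Functions with divisor m(T) − m(O) and their values along lines -/

section Reciprocity

section Units

variable {K : Type*} [Field K] {W : Affine K}

/-- The norm of p + qY has degree max(2 deg p, 2 deg q + 3), which is 0 for a unit, so q = 0 and p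
is constant. Functions are therefore determined by their divisors up to constants. -/
lemma exists_C_of_isUnit {a : W.CoordinateRing} (ha : IsUnit a) :
    ∃ c : K, c ≠ 0 ∧ a = Affine.CoordinateRing.mk W (C (C c)) := by
  obtain ⟨p, q, rfl⟩ := Affine.CoordinateRing.exists_smul_basis_eq a
  have hN := ha.map (Algebra.norm K[X])
  have hd := Affine.CoordinateRing.degree_norm_smul_basis (W' := W) p q
  rw [degree_eq_zero_of_isUnit hN] at hd
  have hq : q = 0 := by
    by_contra hq
    have h1 : 2 • q.degree + 3 ≤ (0 : WithBot ℕ) := hd ▸ le_max_right _ _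
    rw [degree_eq_natDegree hq] at h1
    have : (2 * q.natDegree + 3 : ℕ) ≤ (0 : ℕ) := by
      have h2 : ((2 * q.natDegree + 3 : ℕ) : WithBot ℕ) ≤ ((0 : ℕ) : WithBot ℕ) := by
        refine le_trans (le_of_eq ?_) h1
        rw [nsmul_eq_mul]; push_cast; rfl
      exact_mod_cast h2
    omega
  subst hq
  have hp0 : p ≠ 0 := by
    rintro rfl
    simp at ha
  have hp : p.degree = 0 := by
    have h1 : 2 • p.degree ≤ (0 : WithBot ℕ) := hd ▸ le_max_left _ _
    rw [degree_eq_natDegree hp0] at h1 ⊢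
    have : 2 * p.natDegree ≤ 0 := by
      have h2 : ((2 * p.natDegree : ℕ) : WithBot ℕ) ≤ ((0 : ℕ) : WithBot ℕ) := by
        refine le_trans (le_of_eq ?_) h1
        rw [nsmul_eq_mul]; push_cast; rfl
      exact_mod_cast h2
    have : p.natDegree = 0 := by omega
    rw [this]; rfl
  rw [eq_C_of_degree_eq_zero hp] at hp0 ⊢
  refine ⟨p.coeff 0, fun h => hp0 (by rw [h, map_zero]), ?_⟩
  rw [zero_smul, add_zero, Affine.CoordinateRing.smul, mul_one]

lemma isUnit_of_span_eq {A : Type*} [CommRing A] [IsDomain A] {a b : A}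
    (h : Ideal.span {a} = Ideal.span {b}) : ∃ u, IsUnit u ∧ b = a * u := by
  obtain ⟨u, hu⟩ := Ideal.span_singleton_eq_span_singleton.mp h
  exact ⟨u, u.isUnit, hu.symm⟩

lemma pointIdeal_some {x y : K} (h : W.Nonsingular x y) :
    pointIdeal (.some x y h) = Affine.CoordinateRing.XYIdeal W x (C y) := rfl

lemma pointIdeal_zero : pointIdeal (0 : W.Point) = ⊤ := rfl

lemma pointIdeal_mul_neg {T : W.Point} (hT : T ≠ 0) : pointIdeal T * pointIdeal (-T) =
    Ideal.span {Affine.CoordinateRing.mk W (C (X - C (xCoord T)))} := by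
  rcases T with _ | ⟨x, y, h⟩
  · exact absurd rfl hT
  rw [mul_comm]
  exact Affine.CoordinateRing.XYIdeal_neg_mul h

lemma evalAt_pointIdeal {x y : K} (h : W.Equation x y) {T : W.Point}
    (hle : pointIdeal T ≤ RingHom.ker (evalAt h)) : T ≠ 0 ∧ xCoord T = x ∧ yCoord T = y := by
  rcases T with _ | ⟨x', y', h'⟩
  · exact absurd (RingHom.mem_ker.mp (hle Submodule.mem_top) : evalAt h 1 = 0) (by
      rw [map_one]; exact one_ne_zero)
  refine ⟨Affine.Point.some_ne_zero _, ?_, ?_⟩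
  · have h1 : evalAt h (Affine.CoordinateRing.mk W (C (X - C x'))) = 0 :=
      hle (Ideal.subset_span (by simp [Affine.CoordinateRing.XClass]))
    rw [evalAt_mk] at h1
    simp [evalEval] at h1
    exact (sub_eq_zero.mp h1).symm
  · have h1 : evalAt h (Affine.CoordinateRing.mk W (X - C (C y'))) = 0 :=
      hle (Ideal.subset_span (by simp [Affine.CoordinateRing.YClass]))
    rw [evalAt_mk] at h1
    simp [evalEval] at h1
    exact (sub_eq_zero.mp h1).symm

/-- The kernel of evaluation is prime and contains a power of the ideal of T. So a function with
divisor m(T) − m(O) has no affine zero other than T. -/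
lemma eq_of_evalEval_eq_zero {f : K[X][Y]} {T : W.Point} {m : ℕ}
    (hf : Ideal.span {Affine.CoordinateRing.mk W f} = pointIdeal T ^ m) {x y : K}
    (h : W.Equation x y) (h0 : f.evalEval x y = 0) : T ≠ 0 ∧ xCoord T = x ∧ yCoord T = y := by
  apply evalAt_pointIdeal h
  have hp : (RingHom.ker (evalAt h)).IsPrime := RingHom.ker_isPrime _
  apply hp.le_of_pow_le (n := m)
  rw [← hf, Ideal.span_singleton_le_iff_mem, RingHom.mem_ker, evalAt_mk, h0]

lemma pointIdeal_ne_bot (T : W.Point) : pointIdeal T ≠ ⊥ := by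
  intro h1
  rcases T with _ | ⟨x, y, h⟩
  · exact top_ne_bot (h1 : (⊤ : Ideal W.CoordinateRing) = ⊥)
  · have h2 : Affine.CoordinateRing.XClass W x ∈ pointIdeal (.some x y h) :=
      Ideal.subset_span (by simp)
    rw [h1] at h2
    exact Affine.CoordinateRing.XClass_ne_zero x h2

lemma mk_ne_zero_of_span {f : K[X][Y]} {T : W.Point} {m : ℕ}
    (hf : Ideal.span {Affine.CoordinateRing.mk W f} = pointIdeal T ^ m) :
    Affine.CoordinateRing.mk W f ≠ 0 := by
  intro h0
  rw [h0, Ideal.span_singleton_eq_bot.mpr rfl] at hf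
  exact pow_ne_zero m (pointIdeal_ne_bot T) hf.symm

/-- The complementary function, with divisor `m(-T) - m(O)`. -/
lemma exists_mul_eq_X_sub_pow {f : K[X][Y]} {T : W.Point} (hT : T ≠ 0) {m : ℕ}
    (hf : Ideal.span {Affine.CoordinateRing.mk W f} = pointIdeal T ^ m) :
    ∃ f' : K[X][Y], Affine.CoordinateRing.mk W f * Affine.CoordinateRing.mk W f' =
      Affine.CoordinateRing.mk W (C (X - C (xCoord T))) ^ m ∧
      Ideal.span {Affine.CoordinateRing.mk W f'} = pointIdeal (-T) ^ m := by
  have h1 : Ideal.span {Affine.CoordinateRing.mk W f} * pointIdeal (-T) ^ m =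
      Ideal.span {Affine.CoordinateRing.mk W (C (X - C (xCoord T))) ^ m} := by
    rw [hf, ← mul_pow, pointIdeal_mul_neg hT, Ideal.span_singleton_pow]
  have h2 : Affine.CoordinateRing.mk W (C (X - C (xCoord T))) ^ m ∈
      Ideal.span {Affine.CoordinateRing.mk W f} * pointIdeal (-T) ^ m := by
    rw [h1]; exact Ideal.mem_span_singleton_self _
  obtain ⟨g, hg, hfg⟩ := Ideal.mem_span_singleton_mul.mp h2
  obtain ⟨f', rfl⟩ := AdjoinRoot.mk_surjective g
  refine ⟨f', hfg, ?_⟩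
  rw [← hfg, ← Ideal.span_singleton_mul_span_singleton] at h1
  have h3 := Ideal.span_singleton_mul_right_inj (mk_ne_zero_of_span hf) |>.mp h1
  exact h3.symm

end Units

section LineResultant

variable {K : Type*} [Field K] (L : Type*) [CommRing L] [Algebra K L]

/-- The value at a pair of elements of an algebra. -/
def evL (f : K[X][Y]) (x y : L) : L := (f.map (mapRingHom (algebraMap K L))).evalEval x y

/-- Evaluation of bivariate polynomials as a ring homomorphism. -/
def evHom (x y : L) : K[X][Y] →+* L :=
  (evalEvalRingHom x y).comp (mapRingHom (mapRingHom (algebraMap K L)))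

lemma evHom_apply (x y : L) (f : K[X][Y]) : evHom L x y f = evL L f x y := rfl

lemma evHom_C_C (x y : L) (c : K) : evHom L x y (C (C c)) = algebraMap K L c := by
  simp [evHom]

lemma evHom_C_X (x y : L) : evHom (K := K) L x y (C X) = x := by
  simp [evHom]

lemma evHom_X (x y : L) : evHom (K := K) L x y X = y := by
  simp [evHom]

lemma eval_eval_eq {B : Type*} [CommRing B] (p : B[X][Y]) (q : B[X]) (x : B) :
    (p.eval q).eval x = p.evalEval x (q.eval x) := by
  induction p using Polynomial.induction_on' with
  | add p p' h h' => simp [h, h']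
  | monomial n a => simp [evalEval]

/-- The restriction of a polynomial to the line `Y = lX + n`. -/
def restrictLine (f : K[X][Y]) (l n : L) : L[X] :=
  (f.map (mapRingHom (algebraMap K L))).eval (Affine.linePolynomial 0 n l)

lemma eval_restrictLine (f : K[X][Y]) (l n x : L) :
    (restrictLine L f l n).eval x = evL L f x (l * x + n) := by
  rw [restrictLine, eval_eval_eq, evL]
  simp [Affine.linePolynomial]

variable (W : Affine K)

/-- The product of the values of `f` at the intersection points of the curve with the line
`Y = lX + n`, as a polynomial in `l` and `n`. -/
def lineRes (f : K[X][Y]) : K[X][Y] :=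
  resultant (-(W.baseChange K[X][Y]).toAffine.addPolynomial 0 X (C X))
    (restrictLine K[X][Y] f (C X) X) 3 (restrictLine K[X][Y] f (C X) X).natDegree

end LineResultant

section LineResultantField

variable {K : Type*} [Field K] {W : Affine K} {L : Type*} [Field L] [Algebra K L]

lemma map_restrictLine (f : K[X][Y]) (l n : L) :
    (restrictLine K[X][Y] f (C X) X).map (evHom L l n) = restrictLine L f l n := by
  have hc : (evHom L l n).comp (algebraMap K K[X][Y]) = algebraMap K L := by
    ext c
    exact evHom_C_C L l n c
  rw [restrictLine, restrictLine, ← coe_mapRingHom, hom_eval₂_eq, Affine.linePolynomial,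
    Affine.linePolynomial]
  rw [Polynomial.map_map, mapRingHom_comp, hc]
  congr 1
  simp [evHom_X, evHom_C_X]
where
  hom_eval₂_eq {A B : Type _} [CommRing A] [CommRing B] (φ : A[X] →+* B[X]) (p : A[X][Y])
      (q : A[X]) : φ (p.eval q) = (p.map φ).eval (φ q) := by
    rw [eval_map, ← Polynomial.eval₂_hom]

/-- A resultant with prescribed formal degrees commutes with specialisation. After specialisation
the first polynomial is a monic split cubic, so the resultant is the product of the values at its
roots. -/
lemma evHom_lineRes (f : K[X][Y]) {l n x₁ x₂ x₃ : L}
    (h : (W.baseChange L).toAffine.addPolynomial 0 n l =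
      -((X - C x₁) * (X - C x₂) * (X - C x₃))) :
    evHom L l n (lineRes W f) =
      evL L f x₁ (l * x₁ + n) * evL L f x₂ (l * x₂ + n) * evL L f x₃ (l * x₃ + n) := by
  have hc : (evHom L l n).comp (algebraMap K K[X][Y]) = algebraMap K L := by
    ext c
    exact evHom_C_C L l n c
  have hadd : (-(W.baseChange K[X][Y]).toAffine.addPolynomial 0 X (C X)).map (evHom L l n) =
      (X - C x₁) * (X - C x₂) * (X - C x₃) := by
    rw [Polynomial.map_neg, ← Affine.map_addPolynomial, map_zero, evHom_X, evHom_C_X]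
    have : (W.baseChange K[X][Y]).map (evHom L l n) = W.baseChange L := by
      exact (WeierstrassCurve.map_map _ _ _).trans (by rw [hc]; rfl)
    rw [this]
    exact neg_eq_iff_eq_neg.mpr h
  rw [lineRes, ← resultant_map_map, hadd, map_restrictLine]
  set g := restrictLine L f l n with hg
  have hd : ((X - C x₁) * (X - C x₂) * (X - C x₃)).natDegree = 3 := by
    rw [natDegree_mul (mul_ne_zero (X_sub_C_ne_zero _) (X_sub_C_ne_zero _)) (X_sub_C_ne_zero _),
      natDegree_mul (X_sub_C_ne_zero _) (X_sub_C_ne_zero _)]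
    simp
  have hroots : ((X - C x₁) * (X - C x₂) * (X - C x₃)).roots = {x₁, x₂, x₃} := by
    rw [roots_mul (mul_ne_zero (mul_ne_zero (X_sub_C_ne_zero _) (X_sub_C_ne_zero _))
      (X_sub_C_ne_zero _)), roots_mul (mul_ne_zero (X_sub_C_ne_zero _) (X_sub_C_ne_zero _))]
    simp only [roots_X_sub_C]
    rfl
  have hm : ((X - C x₁) * (X - C x₂) * (X - C x₃)).Monic :=
    ((monic_X_sub_C _).mul (monic_X_sub_C _)).mul (monic_X_sub_C _)
  have := resultant_eq_prod_eval ((X - C x₁) * (X - C x₂) * (X - C x₃)) g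
    (restrictLine K[X][Y] f (C X) X).natDegree
    (by rw [hg, ← map_restrictLine]; exact natDegree_map_le)
    (((Splits.X_sub_C _).mul (Splits.X_sub_C _)).mul (Splits.X_sub_C _))
  rw [hd, hroots, hm.leadingCoeff, one_pow, one_mul] at this
  rw [this]
  simp [hg, eval_restrictLine, mul_assoc]

variable (W) in
lemma exists_roots_addPolynomial [IsAlgClosed L] (l n : L) : ∃ x₁ x₂ x₃ : L,
    (W.baseChange L).toAffine.addPolynomial 0 n l = -((X - C x₁) * (X - C x₂) * (X - C x₃)) := by
  have hs := IsAlgClosed.splits (-(W.baseChange L).toAffine.addPolynomial 0 n l)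
  rw [Affine.addPolynomial_eq, neg_neg] at hs
  rw [Affine.addPolynomial_eq]
  set P : Cubic L := ⟨1, _, _, _⟩ with hP
  have ha : P.a ≠ 0 := one_ne_zero
  obtain ⟨x₁, x₂, x₃, h3⟩ := (Cubic.splits_iff_roots_eq_three (φ := RingHom.id L) ha).mp (by
    rwa [Polynomial.map_id])
  have := Cubic.eq_prod_three_roots ha h3
  simp only [Cubic.map_toPoly, Polynomial.map_id, RingHom.id_apply] at this
  refine ⟨x₁, x₂, x₃, ?_⟩
  rw [this]
  simp [hP]

lemma equation_of_root {l n x₁ x₂ x₃ : L}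
    (h : (W.baseChange L).toAffine.addPolynomial 0 n l =
      -((X - C x₁) * (X - C x₂) * (X - C x₃))) {x : L} (hx : x = x₁ ∨ x = x₂ ∨ x = x₃) :
    (W.baseChange L).toAffine.Equation x (l * x + n) := by
  have h1 := congrArg (eval x) h
  rw [Affine.addPolynomial, eval_eval_eq] at h1
  simp only [Affine.linePolynomial, eval_add, eval_mul, eval_C, eval_sub, eval_X, sub_zero,
    eval_neg] at h1
  rw [Affine.Equation, h1]
  rcases hx with rfl | rfl | rfl <;> simp

/-- The value of the line `Y = lX + n` at a point. -/
def lineAt (T : W.Point) : K[X][Y] := C (C (yCoord T) - X * C (xCoord T)) - X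

lemma evHom_lineAt (T : W.Point) (l n : L) : evHom L l n (lineAt T) =
    algebraMap K L (yCoord T) - l * algebraMap K L (xCoord T) - n := by
  simp only [lineAt, map_sub, map_mul, evHom_X, evHom_C_X, evHom_C_C]

/-- At the abscissa of T the curve polynomial in Y factors as (Y − y(T))(Y − y(−T)). Substituting
the line there and comparing with the cubic −∏(X − xᵢ) gives the identity. -/
lemma lineAt_mul_neg {T : W.Point} (hT : T ≠ 0) {l n x₁ x₂ x₃ : L}
    (h : (W.baseChange L).toAffine.addPolynomial 0 n l =
      -((X - C x₁) * (X - C x₂) * (X - C x₃))) :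
    evHom L l n (lineAt T) * evHom L l n (lineAt (-T)) =
      (x₁ - algebraMap K L (xCoord T)) * (x₂ - algebraMap K L (xCoord T)) *
        (x₃ - algebraMap K L (xCoord T)) := by
  have h1 := congrArg (eval (algebraMap K L (xCoord T))) h
  rw [Affine.addPolynomial, eval_eval_eq] at h1
  have hE := (equation_baseChange (L := L) (W := W) (algebraMap K L (xCoord T))
    (algebraMap K L (yCoord T))).mp ((Affine.map_equation W (algebraMap K L).injective _ _).mpr
      (equation_coord hT))
  rw [evHom_lineAt, evHom_lineAt, xCoord_neg, yCoord_neg hT, Affine.negY]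
  simp only [Affine.linePolynomial, eval_add, eval_mul, eval_C, eval_sub, eval_X, sub_zero,
    eval_neg] at h1
  rw [Affine.evalEval_polynomial] at h1
  simp only [map_sub, map_mul, map_neg]
  have e1 : (W.baseChange L).a₁ = algebraMap K L W.a₁ := rfl
  have e2 : (W.baseChange L).a₂ = algebraMap K L W.a₂ := rfl
  have e3 : (W.baseChange L).a₃ = algebraMap K L W.a₃ := rfl
  have e4 : (W.baseChange L).a₄ = algebraMap K L W.a₄ := rfl
  have e6 : (W.baseChange L).a₆ = algebraMap K L W.a₆ := rfl
  rw [e1, e2, e3, e4, e6] at h1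
  linear_combination h1 - hE

end LineResultantField

section Main

variable {K : Type*} [Field K] {W : Affine K}

/-- An algebraically closed field containing the bivariate polynomials. -/
abbrev BigField (K : Type*) [Field K] := AlgebraicClosure (FractionRing K[X][Y])

lemma evHom_bigField (f : K[X][Y]) : evHom (BigField K) (algebraMap K[X][Y] (BigField K) (C X))
    (algebraMap K[X][Y] (BigField K) X) f = algebraMap K[X][Y] (BigField K) f := by
  have : evHom (BigField K) (algebraMap K[X][Y] (BigField K) (C X))
    (algebraMap K[X][Y] (BigField K) X) = algebraMap K[X][Y] (BigField K) := by
    ext c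
    · simp only [RingHom.comp_apply, evHom_C_C]
      rw [IsScalarTower.algebraMap_apply K K[X][Y] (BigField K)]; rfl
    · simp only [RingHom.comp_apply, evHom_C_X]
    · simp only [evHom_X]
  rw [this]

lemma algebraMap_bigField_injective :
    Function.Injective (algebraMap K[X][Y] (BigField K)) := by
  rw [IsScalarTower.algebraMap_eq K[X][Y] (FractionRing K[X][Y]) (BigField K)]
  exact (algebraMap (FractionRing K[X][Y]) (BigField K)).injective.comp
    (IsFractionRing.injective _ _)

lemma evL_eq_evalL {L : Type*} [Field L] [Algebra K L] (f : K[X][Y]) {x y : L}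
    (h : (W.baseChange L).toAffine.Equation x y) :
    evL L f x y = evalL h (Affine.CoordinateRing.mk W f) := (evalL_mk h f).symm

/-- Over an algebraically closed field containing the indeterminate slope and intercept, the line
meets the curve in three points. Multiply the relation f·f' = (x − x(T))^m over them. -/
lemma lineRes_mul_lineRes {f f' : K[X][Y]} {T : W.Point} (hT : T ≠ 0) {m : ℕ}
    (h : Affine.CoordinateRing.mk W f * Affine.CoordinateRing.mk W f' =
      Affine.CoordinateRing.mk W (C (X - C (xCoord T))) ^ m) :
    lineRes W f * lineRes W f' = lineAt T ^ m * lineAt (-T) ^ m := by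
  apply algebraMap_bigField_injective
  set l := algebraMap K[X][Y] (BigField K) (C X) with hl
  set n := algebraMap K[X][Y] (BigField K) X with hn
  simp only [map_mul, map_pow, ← evHom_bigField, ← hl, ← hn]
  obtain ⟨x₁, x₂, x₃, hx⟩ := exists_roots_addPolynomial W l n
  have key : ∀ x, (x = x₁ ∨ x = x₂ ∨ x = x₃) → evL (BigField K) f x (l * x + n) *
      evL (BigField K) f' x (l * x + n) = (x - algebraMap K _ (xCoord T)) ^ m := by
    intro x hxx
    have hE := equation_of_root hx hxx
    rw [evL_eq_evalL f hE, evL_eq_evalL f' hE, ← map_mul, h, map_pow, ← evL_eq_evalL]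
    simp [evL, evalEval]
  rw [evHom_lineRes f hx, evHom_lineRes f' hx, ← mul_pow, lineAt_mul_neg hT hx, mul_pow, mul_pow,
    ← key x₁ (by simp), ← key x₂ (by simp), ← key x₃ (by simp)]
  ring

lemma lineRes_const_mul {f f' : K[X][Y]} {u : K} (h : Affine.CoordinateRing.mk W f' =
    Affine.CoordinateRing.mk W f * Affine.CoordinateRing.mk W (C (C u))) :
    lineRes W f' = C (C (u ^ 3)) * lineRes W f := by
  apply algebraMap_bigField_injective
  set l := algebraMap K[X][Y] (BigField K) (C X) with hl
  set n := algebraMap K[X][Y] (BigField K) X with hn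
  simp only [map_mul, ← evHom_bigField, ← hl, ← hn]
  obtain ⟨x₁, x₂, x₃, hx⟩ := exists_roots_addPolynomial W l n
  have key : ∀ x, (x = x₁ ∨ x = x₂ ∨ x = x₃) → evL (BigField K) f' x (l * x + n) =
      evL (BigField K) f x (l * x + n) * algebraMap K _ u := by
    intro x hxx
    have hE := equation_of_root hx hxx
    rw [evL_eq_evalL f hE, evL_eq_evalL f' hE, h, map_mul, ← evL_eq_evalL _ hE]
    congr 1
    exact (evL_eq_evalL _ hE).symm.trans (evHom_C_C (BigField K) x (l * x + n) u)
  rw [evHom_lineRes f hx, evHom_lineRes f' hx, key x₁ (by simp), key x₂ (by simp),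
    key x₃ (by simp), evHom_C_C, map_pow]
  ring

lemma lineAt_eq (T : W.Point) :
    lineAt T = -(X - C (C (yCoord T) - X * C (xCoord T)) : K[X][Y]) := by
  rw [lineAt]; ring

lemma prime_lineAt (T : W.Point) : Prime (lineAt T) := by
  rw [lineAt_eq]
  exact (prime_X_sub_C _).neg

lemma natDegree_lineAt_pow (T : W.Point) (m : ℕ) : (lineAt T ^ m).natDegree = m := by
  rw [natDegree_pow, lineAt_eq, natDegree_neg, natDegree_X_sub_C, mul_one]

/-- Specialise to the horizontal line through −T, on which the equation of lines through −T
vanishes. The function f vanishes only at T, and T lies off this line when T ≠ −T. -/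
lemma not_lineAt_neg_dvd [IsAlgClosed K] {f : K[X][Y]} {T : W.Point} {m : ℕ}
    (hf : Ideal.span {Affine.CoordinateRing.mk W f} = pointIdeal T ^ m) (hT : T ≠ 0)
    (hneg : T ≠ -T) : ¬ lineAt (-T) ∣ lineRes W f := by
  rintro ⟨g, hg⟩
  have h1 := congrArg (evHom K 0 (yCoord (-T))) hg
  rw [map_mul, evHom_lineAt, zero_mul, sub_zero, Algebra.algebraMap_self_apply, sub_self,
    zero_mul] at h1
  obtain ⟨x₁, x₂, x₃, hx⟩ := exists_roots_addPolynomial W (0 : K) (yCoord (-T))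
  have hbc : W.baseChange K = W := WeierstrassCurve.map_id W
  have key : ∀ x, (x = x₁ ∨ x = x₂ ∨ x = x₃) → evL K f x (0 * x + yCoord (-T)) ≠ 0 := by
    intro x hxx h0
    have hE := equation_of_root hx hxx
    rw [hbc] at hE
    have h0' : f.evalEval x (0 * x + yCoord (-T)) = 0 := by
      simpa [evL] using h0
    obtain ⟨-, hxT, hyT⟩ := eq_of_evalEval_eq_zero hf hE h0'
    rw [zero_mul, zero_add] at hyT
    apply hneg
    have hT' := neg_ne_zero.mpr hT
    refine (some_coord hT).symm.trans (Eq.trans ?_ (some_coord hT'))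
    exact point_some_congr (xCoord_neg T).symm hyT
  rw [evHom_lineRes f hx] at h1
  exact mul_ne_zero (mul_ne_zero (key x₁ (by simp)) (key x₂ (by simp))) (key x₃ (by simp)) h1

lemma exists_C_C_of_isUnit {s : K[X][Y]} (hs : IsUnit s) : ∃ c : K, c ≠ 0 ∧ s = C (C c) := by
  obtain ⟨r, hr, rfl⟩ := Polynomial.isUnit_iff.mp hs
  obtain ⟨c, hc, rfl⟩ := Polynomial.isUnit_iff.mp hr
  exact ⟨c, hc.ne_zero, rfl⟩

/-- Reciprocity between a function with divisor `m(T) - m(O)` and lines. -/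
theorem exists_lineRes_eq [IsAlgClosed K] {f : K[X][Y]} {T : W.Point} {m : ℕ} (hT : T ≠ 0)
    (hf : Ideal.span {Affine.CoordinateRing.mk W f} = pointIdeal T ^ m) :
    ∃ c : K, c ≠ 0 ∧ lineRes W f = C (C c) * lineAt T ^ m := by
  obtain ⟨f', hff', hf'⟩ := exists_mul_eq_X_sub_pow hT hf
  have hmul := lineRes_mul_lineRes hT hff'
  have h0 : ∀ T : W.Point, lineAt T ^ m ≠ 0 := fun T => pow_ne_zero m (prime_lineAt T).ne_zero
  by_cases hneg : T = -T
  -- For T = −T the complementary function is a constant multiple of f, so up to a constant the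
  -- square of `lineRes W f` is a power of one prime. The exponent is then read off from the degree
  -- in Y.
  · rw [← hneg] at hmul hf'
    obtain ⟨u, hu, hfu⟩ := isUnit_of_span_eq (hf.trans hf'.symm)
    obtain ⟨u, hu0, rfl⟩ := exists_C_of_isUnit hu
    rw [lineRes_const_mul hfu] at hmul
    have hdvd : lineRes W f ∣ lineAt T ^ (m + m) :=
      ⟨C (C (u ^ 3)) * lineRes W f, by rw [pow_add, ← hmul]⟩
    obtain ⟨i, -, hi⟩ := (dvd_prime_pow (prime_lineAt T) _).mp hdvd
    obtain ⟨v, hv⟩ := hi.symm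
    obtain ⟨c, hc, hvc⟩ := exists_C_C_of_isUnit v.isUnit
    rw [hvc] at hv
    refine ⟨c, hc, ?_⟩
    have hd := congrArg natDegree hmul
    have hcc : ∀ c : K, c ≠ 0 → (C (C c) : K[X][Y]) ≠ 0 := fun c hc => by simpa using hc
    rw [← hv, natDegree_mul (mul_ne_zero (pow_ne_zero i (prime_lineAt T).ne_zero) (hcc c hc))
      (mul_ne_zero (hcc _ (pow_ne_zero 3 hu0)) (mul_ne_zero
        (pow_ne_zero i (prime_lineAt T).ne_zero) (hcc c hc))),
      natDegree_mul (hcc _ (pow_ne_zero 3 hu0)) (mul_ne_zero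
        (pow_ne_zero i (prime_lineAt T).ne_zero) (hcc c hc)),
      natDegree_mul (pow_ne_zero i (prime_lineAt T).ne_zero) (hcc c hc),
      natDegree_mul (h0 T) (h0 T), natDegree_lineAt_pow, natDegree_lineAt_pow, natDegree_C,
      natDegree_C] at hd
    have : i = m := by omega
    rw [← hv, this, mul_comm]
  -- The equation of lines through T and that of lines through −T are primes, and neither factor is
  -- divisible by the wrong one. So each factor absorbs its own full m-th power, and the remaining
  -- cofactors are units.
  · have hT' : -T ≠ 0 := neg_ne_zero.mpr hT
    have d1 : lineAt T ^ m ∣ lineRes W f := by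
      refine (prime_lineAt T).pow_dvd_of_dvd_mul_right m ?_ (Dvd.intro _ hmul.symm)
      have := not_lineAt_neg_dvd hf' hT' (by rw [neg_neg]; exact fun h => hneg h.symm)
      rwa [neg_neg] at this
    have d2 : lineAt (-T) ^ m ∣ lineRes W f' :=
      (prime_lineAt (-T)).pow_dvd_of_dvd_mul_left m (not_lineAt_neg_dvd hf hT hneg)
        (Dvd.intro_left _ hmul.symm)
    obtain ⟨s, hs⟩ := d1
    obtain ⟨s', hs'⟩ := d2
    have hss : s * s' = 1 := by
      apply mul_left_cancel₀ (mul_ne_zero (h0 T) (h0 (-T)))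
      rw [mul_one]
      nth_rw 2 [← hmul]
      rw [hs, hs']; ring
    obtain ⟨c, hc, rfl⟩ := exists_C_C_of_isUnit (IsUnit.of_mul_eq_one _ hss)
    exact ⟨c, hc, by rw [hs, mul_comm]⟩

end Main

end Reciprocity

end EllCount
end

noncomputable section
namespace EllCount
open WeierstrassCurve Polynomial Filter
open scoped Classical Polynomial.Bivariate

set_option linter.unusedSectionVars false

/-! ### Ideals of points, principal powers and the conjugation of the coordinate ring -/

section PointIdeals

variable {K : Type*} [Field K] {W : Affine K}

/-- In the ideal class group the class of P + Q is the product of the classes of P and Q. The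
multipliers are the equations of the chord and of the vertical line through P + Q. -/
lemma exists_span_mul_pointIdeal (P Q : W.Point) : ∃ u v : W.CoordinateRing, u ≠ 0 ∧ v ≠ 0 ∧
    Ideal.span {v} * (pointIdeal P * pointIdeal Q) = Ideal.span {u} * pointIdeal (P + Q) := by
  by_cases hP : P = 0
  · subst hP
    refine ⟨1, 1, one_ne_zero, one_ne_zero, ?_⟩
    rw [zero_add, pointIdeal_zero, Ideal.top_mul]
  by_cases hQ : Q = 0
  · subst hQ
    refine ⟨1, 1, one_ne_zero, one_ne_zero, ?_⟩
    rw [add_zero, pointIdeal_zero, Ideal.mul_top]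
  by_cases hPQ : P + Q = 0
  · rw [add_eq_zero_iff_neg_eq] at hPQ
    subst hPQ
    refine ⟨_, 1, Affine.CoordinateRing.XClass_ne_zero (xCoord P), one_ne_zero, ?_⟩
    rw [add_neg_cancel, pointIdeal_zero, Ideal.mul_top, pointIdeal_mul_neg hP,
      Ideal.span_singleton_one, Ideal.top_mul]
    rfl
  · rcases P with _ | ⟨x₁, y₁, h₁⟩
    · exact absurd rfl hP
    rcases Q with _ | ⟨x₂, y₂, h₂⟩
    · exact absurd rfl hQ
    have hxy : ¬(x₁ = x₂ ∧ y₁ = W.negY x₂ y₂) := fun h =>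
      hPQ (Affine.Point.add_of_Y_eq h.1 h.2)
    refine ⟨_, _, Affine.CoordinateRing.YClass_ne_zero
      (Affine.linePolynomial x₁ y₁ <| W.slope x₁ x₂ y₁ y₂),
      Affine.CoordinateRing.XClass_ne_zero (W.addX x₁ x₂ <| W.slope x₁ x₂ y₁ y₂), ?_⟩
    rw [Affine.Point.add_some hxy]
    exact Affine.CoordinateRing.XYIdeal_mul_XYIdeal h₁.1 h₂.1 hxy

lemma exists_span_mul_pointIdeal_pow (T : W.Point) (k : ℕ) : ∃ u v : W.CoordinateRing, u ≠ 0 ∧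
    v ≠ 0 ∧ Ideal.span {v} * pointIdeal T ^ k = Ideal.span {u} * pointIdeal (k • T) := by
  induction k with
  | zero =>
    refine ⟨1, 1, one_ne_zero, one_ne_zero, ?_⟩
    rw [zero_smul, pow_zero, pointIdeal_zero, Ideal.one_eq_top]
  | succ k ih =>
    obtain ⟨u, v, hu, hv, h⟩ := ih
    obtain ⟨u', v', hu', hv', h'⟩ := exists_span_mul_pointIdeal (k • T) T
    refine ⟨u * u', v * v', mul_ne_zero hu hu', mul_ne_zero hv hv', ?_⟩
    rw [succ_nsmul, ← Ideal.span_singleton_mul_span_singleton,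
      ← Ideal.span_singleton_mul_span_singleton, mul_assoc, mul_assoc, ← h', pow_succ]
    calc _ = Ideal.span {v'} * (Ideal.span {v} * pointIdeal T ^ k) * pointIdeal T := by ring
      _ = _ := by rw [h]; ring

/-- A function with divisor `m(T) - m(O)`. -/
lemma exists_span_eq_pointIdeal_pow {T : W.Point} {m : ℕ} (h : m • T = 0) :
    ∃ f : K[X][Y], Ideal.span {Affine.CoordinateRing.mk W f} = pointIdeal T ^ m := by
  obtain ⟨u, v, hu, hv, huv⟩ := exists_span_mul_pointIdeal_pow T m
  rw [h, pointIdeal_zero, Ideal.mul_top] at huv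
  have hmem : u ∈ Ideal.span {v} * pointIdeal T ^ m := by
    rw [huv]; exact Ideal.mem_span_singleton_self _
  obtain ⟨g, hg, rfl⟩ := Ideal.mem_span_singleton_mul.mp hmem
  obtain ⟨f, rfl⟩ := AdjoinRoot.mk_surjective g
  refine ⟨f, ?_⟩
  rw [← Ideal.span_singleton_mul_span_singleton] at huv
  exact (Ideal.span_singleton_mul_right_inj hv |>.mp huv).symm

variable (W) in
/-- The involution of the coordinate ring induced by negation. -/
def conjA : W.CoordinateRing →+* W.CoordinateRing :=
  Ideal.Quotient.lift _ ((Affine.CoordinateRing.mk W).comp (compRingHom W.negPolynomial)) (by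
    intro f hf
    obtain ⟨g, rfl⟩ := Ideal.mem_span_singleton.mp hf
    have : W.polynomial.comp W.negPolynomial = W.polynomial := by
      rw [Affine.polynomial, Affine.negPolynomial]
      simp only [sub_comp, add_comp, mul_comp, pow_comp, X_comp, C_comp]
      ring
    rw [map_mul]
    simp only [RingHom.comp_apply, coe_compRingHom_apply, this]
    rw [AdjoinRoot.mk_self, zero_mul])

lemma conjA_mk (f : K[X][Y]) : conjA W (Affine.CoordinateRing.mk W f) =
    Affine.CoordinateRing.mk W (f.comp W.negPolynomial) := Ideal.Quotient.lift_mk _ _ _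

lemma conjA_C (p : K[X]) : conjA W (Affine.CoordinateRing.mk W (C p)) =
    Affine.CoordinateRing.mk W (C p) := by rw [conjA_mk, C_comp]

lemma mk_norm (a : W.CoordinateRing) :
    Affine.CoordinateRing.mk W (C (Algebra.norm K[X] a)) = a * conjA W a := by
  obtain ⟨p, q, rfl⟩ := Affine.CoordinateRing.exists_smul_basis_eq a
  have h := Affine.CoordinateRing.coe_norm_smul_basis (W' := W) p q
  refine Eq.trans h ?_
  rw [Affine.CoordinateRing.smul, Affine.CoordinateRing.smul, mul_one]
  simp only [map_add, map_mul, map_sub, map_neg, conjA_mk, X_comp, C_comp, Affine.negPolynomial]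

lemma conjA_mem_pointIdeal {T : W.Point} {a : W.CoordinateRing} (ha : a ∈ pointIdeal T) :
    conjA W a ∈ pointIdeal (-T) := by
  rcases T with _ | ⟨x, y, h⟩
  · exact Submodule.mem_top
  have key : pointIdeal (.some x y h) ≤ (pointIdeal (-.some x y h)).comap (conjA W) := by
    rw [pointIdeal_some, Affine.CoordinateRing.XYIdeal, Ideal.span_le]
    have h1 : Affine.CoordinateRing.mk W (C (X - C x)) ∈ pointIdeal (-.some x y h) :=
      Ideal.subset_span (by simp [Affine.CoordinateRing.XClass])
    have h2 : Affine.CoordinateRing.mk W (X - C (C (W.negY x y))) ∈ pointIdeal (-.some x y h) :=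
      Ideal.subset_span (by simp [Affine.CoordinateRing.YClass])
    rintro b (rfl | rfl)
    · rw [SetLike.mem_coe, Ideal.mem_comap, Affine.CoordinateRing.XClass, conjA_C]
      exact h1
    · rw [SetLike.mem_coe, Ideal.mem_comap, Affine.CoordinateRing.YClass, conjA_mk]
      have : (X - C (C y) : K[X][Y]).comp W.negPolynomial = -(X - C (C (W.negY x y))) -
          C (C W.a₁) * C (X - C x) := by
        simp only [sub_comp, X_comp, C_comp, Affine.negPolynomial, Affine.negY, map_sub, map_add,
          map_mul, map_neg]
        ring
      rw [this, map_sub, map_neg, map_mul]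
      exact Ideal.sub_mem _ (Ideal.neg_mem_iff _ |>.mpr h2) (Ideal.mul_mem_left _ _ h1)
  exact key ha

lemma conjA_mem_pointIdeal_pow {T : W.Point} {m : ℕ} {a : W.CoordinateRing}
    (ha : a ∈ pointIdeal T ^ m) : conjA W a ∈ pointIdeal (-T) ^ m := by
  have h1 : (pointIdeal T).map (conjA W) ≤ pointIdeal (-T) :=
    Ideal.map_le_iff_le_comap.mpr fun a ha => conjA_mem_pointIdeal ha
  have h2 := Ideal.mem_map_of_mem (conjA W) ha
  rw [Ideal.map_pow] at h2
  exact Ideal.pow_right_mono h1 m h2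

/-- `f(P) f(-P) = c (x(P) - x(T)) ^ m` for a function `f` with divisor `m(T) - m(O)`. -/
lemma exists_mul_conjA {f : K[X][Y]} {T : W.Point} (hT : T ≠ 0) {m : ℕ}
    (hf : Ideal.span {Affine.CoordinateRing.mk W f} = pointIdeal T ^ m) :
    ∃ c : K, c ≠ 0 ∧ Affine.CoordinateRing.mk W f * conjA W (Affine.CoordinateRing.mk W f) =
      Affine.CoordinateRing.mk W (C (C c)) *
        Affine.CoordinateRing.mk W (C (X - C (xCoord T))) ^ m := by
  obtain ⟨f', hff', hf'⟩ := exists_mul_eq_X_sub_pow hT hf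
  set a := Affine.CoordinateRing.mk W f with ha
  set a' := Affine.CoordinateRing.mk W f' with ha'
  set b := Affine.CoordinateRing.mk W (C (X - C (xCoord T))) with hb
  have hb0 : b ≠ 0 := Affine.CoordinateRing.XClass_ne_zero _
  have m1 : conjA W a ∈ Ideal.span {a'} := by
    rw [hf']
    exact conjA_mem_pointIdeal_pow (hf ▸ Ideal.mem_span_singleton_self a)
  have m2 : conjA W a' ∈ Ideal.span {a} := by
    rw [hf]
    have := conjA_mem_pointIdeal_pow (hf' ▸ Ideal.mem_span_singleton_self a' :
      a' ∈ pointIdeal (-T) ^ m)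
    rwa [neg_neg] at this
  obtain ⟨h, hh⟩ := Ideal.mem_span_singleton.mp m1
  obtain ⟨h', hh'⟩ := Ideal.mem_span_singleton.mp m2
  -- Conjugation exchanges the ideals of f and f' and fixes b = x − x(T). Conjugating f·f' = b^m
  -- shows that the two cofactors are inverse units.
  have e : b ^ m * (h * h') = b ^ m * 1 := by
    have := congrArg (conjA W) hff'
    rw [map_mul, map_pow, hb, conjA_C, ← hb, hh, hh', ← hff'] at this
    calc b ^ m * (h * h') = a * a' * (h * h') := by rw [hff']
      _ = a' * h * (a * h') := by ring
      _ = b ^ m * 1 := by rw [this, hff', mul_one]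
  obtain ⟨c, hc, hhc⟩ := exists_C_of_isUnit
    (IsUnit.of_mul_eq_one _ (mul_left_cancel₀ (pow_ne_zero m hb0) e))
  exact ⟨c, hc, by rw [hh, hhc, ← hff']; ring⟩

end PointIdeals

/-! ### The addition formula for a function with divisor m(T) − m(O) -/

section PointValues

variable {K : Type*} [Field K] {W : Affine K} {L : Type*} [Field L] [Algebra K L]

/-- The value of a function at a point over an extension field. -/
def fAt (f : K[X][Y]) (P : (W.baseChange L).toAffine.Point) : L :=
  evL L f (xCoord P) (yCoord P)

lemma fAt_eq (f : K[X][Y]) {P : (W.baseChange L).toAffine.Point} (hP : P ≠ 0) :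
    fAt f P = evalL (equation_coord hP) (Affine.CoordinateRing.mk W f) :=
  evL_eq_evalL f (equation_coord hP)

lemma evL_comp_negPolynomial (f : K[X][Y]) (x y : L) : evL L (f.comp W.negPolynomial) x y =
    evL L f x ((W.baseChange L).toAffine.negY x y) := by
  induction f using Polynomial.induction_on' with
  | add p q hp hq =>
    rw [add_comp]
    simp only [← evHom_apply, map_add] at hp hq ⊢
    rw [hp, hq]
  | monomial n a =>
    rw [← C_mul_X_pow_eq_monomial, mul_comp, pow_comp, C_comp, X_comp]
    have hC : ∀ z w : L, evHom L z w (C a) = (a.map (algebraMap K L)).eval z := by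
      intro z w; simp [evHom]
    simp only [← evHom_apply, map_mul, map_pow, hC, evHom_X]
    rw [Affine.negPolynomial, Affine.negY]
    simp only [map_sub, map_neg, evHom_X, map_add, map_mul, evHom_C_X, evHom_C_C]
    change _ * (_) ^ n = _ * (-y - algebraMap K L W.a₁ * x - algebraMap K L W.a₃) ^ n
    congr 2; ring

lemma fAt_neg (f : K[X][Y]) {P : (W.baseChange L).toAffine.Point} (hP : P ≠ 0) :
    fAt f (-P) = evalL (equation_coord hP) (conjA W (Affine.CoordinateRing.mk W f)) := by
  rw [conjA_mk, ← evL_eq_evalL, evL_comp_negPolynomial, fAt, xCoord_neg, yCoord_neg hP]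

lemma fAt_mul_fAt_neg {f : K[X][Y]} {T : W.Point} {m : ℕ} {c : K}
    (h : Affine.CoordinateRing.mk W f * conjA W (Affine.CoordinateRing.mk W f) =
      Affine.CoordinateRing.mk W (C (C c)) *
        Affine.CoordinateRing.mk W (C (X - C (xCoord T))) ^ m)
    {P : (W.baseChange L).toAffine.Point} (hP : P ≠ 0) :
    fAt f P * fAt f (-P) = algebraMap K L c *
      (xCoord P - algebraMap K L (xCoord T)) ^ m := by
  rw [fAt_eq f hP, fAt_neg f hP, ← map_mul, h, map_mul, map_pow, ← evL_eq_evalL, ← evL_eq_evalL,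
    ← evHom_apply, ← evHom_apply, evHom_C_C, C_sub, map_sub, evHom_C_X, evHom_C_C]

/-- The slope of the line through two points. -/
def chordSlope (P Q : (W.baseChange L).toAffine.Point) : L :=
  (W.baseChange L).toAffine.slope (xCoord P) (xCoord Q) (yCoord P) (yCoord Q)

/-- The value at `T` of the equation of the line through `P` and `Q`. -/
def chordAt (P Q : (W.baseChange L).toAffine.Point) (T : W.Point) : L :=
  algebraMap K L (yCoord T) - chordSlope P Q * (algebraMap K L (xCoord T) - xCoord P) - yCoord P

lemma addPolynomial_chord {P Q : (W.baseChange L).toAffine.Point} (hP : P ≠ 0) (hQ : Q ≠ 0)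
    (hPQ : P + Q ≠ 0) :
    (W.baseChange L).toAffine.addPolynomial 0 (yCoord P - chordSlope P Q * xCoord P)
        (chordSlope P Q) =
      -((X - C (xCoord P)) * (X - C (xCoord Q)) * (X - C (xCoord (P + Q)))) ∧
    chordSlope P Q * xCoord Q + (yCoord P - chordSlope P Q * xCoord P) = yCoord Q ∧
    chordSlope P Q * xCoord (P + Q) + (yCoord P - chordSlope P Q * xCoord P) =
      yCoord (-(P + Q)) := by
  rcases P with _ | ⟨x₁, y₁, h₁⟩
  · exact absurd rfl hP
  rcases Q with _ | ⟨x₂, y₂, h₂⟩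
  · exact absurd rfl hQ
  have hxy : ¬(x₁ = x₂ ∧ y₁ = (W.baseChange L).toAffine.negY x₂ y₂) := fun h =>
    hPQ (Affine.Point.add_of_Y_eq h.1 h.2)
  have h := Affine.addPolynomial_slope h₁.1 h₂.1 hxy
  rw [yCoord_neg hPQ, Affine.Point.add_some hxy]
  simp only [chordSlope, xCoord_some, yCoord_some]
  set l := (W.baseChange L).toAffine.slope x₁ x₂ y₁ y₂ with hl
  refine ⟨?_, ?_, ?_⟩
  · rw [← h, Affine.addPolynomial, Affine.addPolynomial]
    congr 1
    simp only [Affine.linePolynomial, map_sub, map_mul, map_zero]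
    ring
  · by_cases hx : x₁ = x₂
    · have hy : y₁ ≠ (W.baseChange L).toAffine.negY x₂ y₂ := fun h => hxy ⟨hx, h⟩
      have := Affine.Y_eq_of_Y_ne h₁.1 h₂.1 hx hy
      rw [← hx, ← this]; ring
    · rw [hl, Affine.slope_of_X_ne hx]
      field_simp [sub_ne_zero.mpr hx]
      ring
  · rw [Affine.negY, Affine.addY, Affine.negY, Affine.negAddY]
    ring

/-- The addition formula for a function with divisor `m(T) - m(O)`. -/
theorem exists_fAt_add [IsAlgClosed K] {f : K[X][Y]} {T : W.Point} {m : ℕ} (hT : T ≠ 0)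
    (hf : Ideal.span {Affine.CoordinateRing.mk W f} = pointIdeal T ^ m) (L : Type*) [Field L]
    [Algebra K L] :
    ∃ c : K, c ≠ 0 ∧ ∀ P Q : (W.baseChange L).toAffine.Point, P ≠ 0 → Q ≠ 0 → P + Q ≠ 0 →
      fAt f P * fAt f Q * (xCoord (P + Q) - algebraMap K L (xCoord T)) ^ m =
        algebraMap K L c * chordAt P Q T ^ m * fAt f (P + Q) := by
  obtain ⟨c₁, hc₁, h1⟩ := exists_lineRes_eq hT hf
  obtain ⟨c₂, hc₂, h2⟩ := exists_mul_conjA hT hf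
  refine ⟨c₁ / c₂, div_ne_zero hc₁ hc₂, fun P Q hP hQ hPQ => ?_⟩
  obtain ⟨e1, e2, e3⟩ := addPolynomial_chord hP hQ hPQ
  -- Reciprocity for the chord gives f(P) f(Q) f(−(P+Q)) as a constant times the m-th power of the
  -- chord at T. The last factor is replaced using f(R) f(−R) = c₂ (x(R) − x(T))^m.
  have h3 := evHom_lineRes f e1
  rw [h1, e2, e3, map_mul, map_pow, evHom_C_C, evHom_lineAt] at h3
  have e4 : chordSlope P Q * xCoord P + (yCoord P - chordSlope P Q * xCoord P) = yCoord P := by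
    ring
  rw [e4] at h3
  have h4 := fAt_mul_fAt_neg h2 hPQ
  have h5 : fAt f (-(P + Q)) = evL L f (xCoord (P + Q)) (yCoord (-(P + Q))) := by
    rw [fAt, xCoord_neg]
  rw [← h5] at h3
  have hc : algebraMap K L c₂ ≠ 0 := (_root_.map_ne_zero _).mpr hc₂
  have h6 : chordAt P Q T = algebraMap K L (yCoord T) - chordSlope P Q *
      algebraMap K L (xCoord T) - (yCoord P - chordSlope P Q * xCoord P) := by
    rw [chordAt]; ring
  rw [map_div₀, h6, div_mul_eq_mul_div, div_mul_eq_mul_div, eq_div_iff hc, h3]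
  change fAt f P * fAt f Q * _ * _ = fAt f P * fAt f Q * _ * _
  linear_combination -(fAt f P * fAt f Q) * h4

end PointValues

/-! ### The m-th root of f ∘ [m] -/

section Roots

variable {K : Type*} [Field K] {W : Affine K} {L : Type*} [Field L]
  [Algebra W.CoordinateRing L] [IsFractionRing W.CoordinateRing L] [Algebra K L]
  [IsScalarTower K W.CoordinateRing L] [IsAlgClosed K] [W.IsElliptic]

variable (L) in
/-- A polynomial as an element of the function field. -/
abbrev toFF (W : Affine K) [Algebra W.CoordinateRing L] (f : K[X][Y]) : L :=
  algebraMap W.CoordinateRing L (Affine.CoordinateRing.mk W f)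

lemma toFF_ne_zero {f : K[X][Y]} (hf : Affine.CoordinateRing.mk W f ≠ 0) : toFF L W f ≠ 0 :=
  (map_ne_zero_iff _ (IsFractionRing.injective W.CoordinateRing L)).mpr hf

lemma pull_toFF {P : (W.baseChange L).toAffine.Point} (hP : Nonconst P) (f : K[X][Y]) :
    pull P hP (toFF L W f) = fAt f P := by
  rw [pull_algebraMap, fAt_eq f hP.ne_zero]

lemma toFF_eq_fAt (f : K[X][Y]) : toFF L W f = fAt f (generic W L) :=
  algebraMap_mk_eq f

/-- If `f` has divisor `m(T) - m(O)`, then `f ∘ [m]` is an `m`-th power. -/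
theorem exists_pow_eq_mulPull {f : K[X][Y]} {T : W.Point} {m : ℕ} (hm : m ≠ 0) (hT : T ≠ 0)
    (hf : Ideal.span {Affine.CoordinateRing.mk W f} = pointIdeal T ^ m) :
    ∃ g : L, g ^ m = mulPull W L hm (toFF L W f) := by
  obtain ⟨c, hc, hadd⟩ := exists_fAt_add hT hf L
  have hf0 := mk_ne_zero_of_span hf
  have hne : ∀ j : ℕ, j ≠ 0 → fAt f (j • generic W L) ≠ 0 := by
    intro j hj
    rw [← pull_toFF (nonconst_nsmul_generic W L hj)]
    exact (_root_.map_ne_zero _).mpr (toFF_ne_zero hf0)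
  have hxne : ∀ j : ℕ, j ≠ 0 →
      xCoord (j • generic W L) - algebraMap K L (xCoord T) ≠ 0 := by
    intro j hj h0
    apply (nonconst_nsmul_generic W L hj).transcendental
    rw [sub_eq_zero.mp h0]
    exact isAlgebraic_algebraMap _
  -- Modulo constants and m-th powers the addition formula makes f multiplicative, so f(jG) is
  -- f(G)^j up to these. For j = m this is itself an m-th power, and constants have m-th roots in K.
  have key : ∀ j : ℕ, ∃ b : K, ∃ r : L, fAt f ((j + 1) • generic W L) =
      algebraMap K L b * fAt f (generic W L) ^ (j + 1) * r ^ m := by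
    intro j
    induction j with
    | zero => exact ⟨1, 1, by simp⟩
    | succ j ih =>
      obtain ⟨b, r, hr⟩ := ih
      have h1 := hadd ((j + 1) • generic W L) (generic W L) (nsmul_generic_ne_zero j.succ_ne_zero)
        (nonconst_generic W L).ne_zero (by
          rw [← succ_nsmul]; exact nsmul_generic_ne_zero (by omega))
      rw [← succ_nsmul] at h1
      set ch := chordAt ((j + 1) • generic W L) (generic W L) T with hch
      set xx := xCoord ((j + 1 + 1) • generic W L) - algebraMap K L (xCoord T) with hxx
      have hlhs : algebraMap K L c * ch ^ m * fAt f ((j + 1 + 1) • generic W L) ≠ 0 := by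
        rw [← h1]
        have hG := hne 1 one_ne_zero
        rw [one_smul] at hG
        exact mul_ne_zero (mul_ne_zero (hne _ (by omega)) hG)
          (pow_ne_zero m (hxne _ (by omega)))
      have hch0 : ch ^ m ≠ 0 := right_ne_zero_of_mul (left_ne_zero_of_mul hlhs)
      have hch1 : ch ≠ 0 := fun h => hch0 (by rw [h, zero_pow hm])
      have hcL : algebraMap K L c ≠ 0 := (_root_.map_ne_zero _).mpr hc
      refine ⟨b / c, r * xx / ch, ?_⟩
      rw [map_div₀]
      apply mul_left_cancel₀ (mul_ne_zero hcL hch0)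
      rw [← h1, hr, div_pow, mul_pow]
      field_simp
      ring
  obtain ⟨j, rfl⟩ := Nat.exists_eq_succ_of_ne_zero hm
  obtain ⟨b, r, hr⟩ := key j
  obtain ⟨b', hb'⟩ := IsAlgClosed.exists_pow_nat_eq b (Nat.pos_of_ne_zero hm)
  refine ⟨algebraMap K L b' * fAt f (generic W L) * r, ?_⟩
  rw [mulPull, pull_toFF]
  refine Eq.trans ?_ hr.symm
  rw [mul_pow, mul_pow, ← map_pow, hb']

end Roots

end EllCount
end

noncomputable section
namespace EllCount
open WeierstrassCurve Polynomial Filter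
open scoped Classical Polynomial.Bivariate

set_option linter.unusedSectionVars false

/-! ### The coordinate ring is integrally closed -/

section IntegrallyClosed

/-- Scaling the integral equation of w = p/d by d gives a monic equation for p whose lower
coefficients are divisible by d. Under φ it becomes φ(p)^r = 0: an integral fraction has a numerator
vanishing wherever its denominator does. -/
lemma map_eq_zero_of_isIntegral {A L k : Type*} [CommRing A] [Field L] [Field k] [Algebra A L]
    (hinj : Function.Injective (algebraMap A L)) {w : L} (hw : IsIntegral A w) {d p : A}
    (h : w * algebraMap A L d = algebraMap A L p) (φ : A →+* k) (hd : φ d = 0) : φ p = 0 := by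
  obtain ⟨q, hq, hqw⟩ := hw
  have h1 : aeval (algebraMap A L d * w) (scaleRoots q d) = 0 := scaleRoots_aeval_eq_zero hqw
  rw [mul_comm, h, aeval_algebraMap_apply, map_eq_zero_iff _ hinj] at h1
  have h2 := congrArg φ h1
  rw [map_zero, coe_aeval_eq_eval, ← eval₂_at_apply, ← eval_map, map_scaleRoots _ _ _ (by
    rw [hq.leadingCoeff, map_one]; exact one_ne_zero), hd, scaleRoots_zero,
    (hq.map φ).leadingCoeff] at h2
  rw [one_smul, eval_pow, eval_X] at h2
  exact eq_zero_of_pow_eq_zero h2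

variable {K : Type*} [Field K] {W : Affine K} {L : Type*} [Field L]
  [Algebra W.CoordinateRing L] [IsFractionRing W.CoordinateRing L] [Algebra K L]
  [IsScalarTower K W.CoordinateRing L] [IsAlgClosed K] [W.IsElliptic]

lemma toFF_C_C (c : K) : toFF L W (C (C c)) = algebraMap K L c := by
  rw [IsScalarTower.algebraMap_apply K W.CoordinateRing L]; rfl

lemma toFF_sub_ne_zero (α : K) : fX W L - algebraMap K L α ≠ 0 := by
  rw [fX, ← toFF_C_C (W := W), ← map_sub, ← map_sub, ← C_sub]
  exact toFF_ne_zero (Affine.CoordinateRing.XClass_ne_zero α)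

/-- Where the vertical line is tangent, (y − β)/(x − α) has a pole. Indeed z² + a₁z is a fraction
with denominator x − α whose numerator takes the value −W_X at the point, and this is nonzero by
nonsingularity since W_Y = 0. -/
lemma not_isIntegral_of_ramified {α β : K} (h : W.Equation α β) (hy : 2 * β + W.a₁ * α + W.a₃ = 0)
    {z : L} (hz : _root_.IsIntegral W.CoordinateRing z)
    (h1 : z * (fX W L - algebraMap K L α) = fY W L - algebraMap K L β) : False := by
  have hns := Affine.equation_iff_nonsingular.mp h
  have h2 : z ^ 2 + algebraMap K L W.a₁ * z = toFF L W (C (X ^ 2 + C α * X + C (α ^ 2) +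
      C W.a₂ * (X + C α) + C W.a₄ - C (W.a₁ * β))) / (fX W L - algebraMap K L α) := by
    have hE := (equation_baseChange _ _).mp (generic_equation W L)
    have hα := congrArg (algebraMap K L) ((Affine.equation_iff _ _).mp h)
    have hyL := congrArg (algebraMap K L) hy
    have e2 : algebraMap K L 2 = 2 := map_ofNat _ _
    simp only [map_add, map_mul, map_pow, e2, map_zero] at hα hyL
    have hd := toFF_sub_ne_zero (W := W) (L := L) α
    rw [eq_div_iff hd]
    apply mul_right_cancel₀ hd
    simp only [toFF, map_add, map_sub, map_mul, map_pow]
    have hXX : (algebraMap W.CoordinateRing L) ((Affine.CoordinateRing.mk W) (C X)) = fX W L := rfl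
    have hcc : ∀ c : K, (algebraMap W.CoordinateRing L) ((Affine.CoordinateRing.mk W) (C (C c))) =
      algebraMap K L c := toFF_C_C
    simp only [hXX, hcc]
    set x := fX W L
    set y := fY W L
    calc _ = (z * (x - algebraMap K L α)) ^ 2 + algebraMap K L W.a₁ *
        (z * (x - algebraMap K L α)) * (x - algebraMap K L α) := by ring
      _ = _ := by
        rw [h1]
        linear_combination hE - hα - y * hyL + algebraMap K L β * hyL
  have h3 : _root_.IsIntegral W.CoordinateRing (z ^ 2 + algebraMap K L W.a₁ * z) := by
    refine (hz.pow 2).add (_root_.IsIntegral.mul ?_ hz)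
    rw [← toFF_C_C (W := W)]
    exact isIntegral_algebraMap
  have h4 := map_eq_zero_of_isIntegral (IsFractionRing.injective W.CoordinateRing L) h3
    (d := Affine.CoordinateRing.mk W (C (X - C α)))
    (p := Affine.CoordinateRing.mk W (C (X ^ 2 + C α * X + C (α ^ 2) + C W.a₂ * (X + C α) +
      C W.a₄ - C (W.a₁ * β)))) (by
      have : algebraMap W.CoordinateRing L (Affine.CoordinateRing.mk W (C (X - C α))) =
          fX W L - algebraMap K L α := by
        rw [C_sub, map_sub, map_sub, ← toFF_C_C (W := W)]; rfl
      rw [h2, this, div_mul_cancel₀ _ (toFF_sub_ne_zero α)])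
    (evalAt h) (by rw [evalAt_mk]; simp [evalEval])
  rw [evalAt_mk] at h4
  simp only [evalEval, eval_C, eval_add, eval_sub, eval_mul, eval_pow, eval_X] at h4
  rcases ((Affine.nonsingular_iff' _ _).mp hns).2 with h5 | h5
  · apply h5; linear_combination -h4
  · exact h5 hy

/-- Subtracting a regular function leaves a numerator p₀ + q₀y with constant coefficients, which
vanishes at both points above α. If q₀ ≠ 0, these points coincide, and the ramified case applies. -/
lemma exists_of_isIntegral_of_mul {z : L} (hz : _root_.IsIntegral W.CoordinateRing z) {α : K}
    {a : W.CoordinateRing} (h : z * (fX W L - algebraMap K L α) = algebraMap _ L a) :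
    ∃ b : W.CoordinateRing, algebraMap _ L b = z := by
  obtain ⟨p, q, rfl⟩ := Affine.CoordinateRing.exists_smul_basis_eq a
  obtain ⟨p', hp'⟩ := X_sub_C_dvd_sub_C_eval (a := α) (p := p)
  obtain ⟨q', hq'⟩ := X_sub_C_dvd_sub_C_eval (a := α) (p := q)
  set p₀ := p.eval α
  set q₀ := q.eval α
  obtain ⟨P, hP0, hPα⟩ := exists_point_of_xCoord W α
  have hE := equation_coord hP0
  rw [hPα] at hE
  set β := yCoord P with hβ
  have hd := toFF_sub_ne_zero (W := W) (L := L) α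
  have hdd : algebraMap W.CoordinateRing L (Affine.CoordinateRing.mk W (C (X - C α))) =
      fX W L - algebraMap K L α := by
    rw [C_sub, map_sub, map_sub, ← toFF_C_C (W := W)]; rfl
  set b := Affine.CoordinateRing.mk W (C p' + C q' * X) with hb
  set z' := z - algebraMap _ L b with hz'
  have hz'i : _root_.IsIntegral W.CoordinateRing z' := hz.sub isIntegral_algebraMap
  have h1 : z' * (fX W L - algebraMap K L α) =
      algebraMap _ L (Affine.CoordinateRing.mk W (C (C p₀) + C (C q₀) * X)) := by
    rw [hz', sub_mul, h, ← hdd, ← map_mul, ← map_sub, hb, ← map_mul]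
    congr 1
    rw [Affine.CoordinateRing.smul, Affine.CoordinateRing.smul, mul_one, ← map_mul, ← map_add,
      ← map_sub]
    congr 1
    have e1 : p = C p₀ + (X - C α) * p' := by rw [← hp']; ring
    have e2 : q = C q₀ + (X - C α) * q' := by rw [← hq']; ring
    rw [e1, e2]
    simp only [map_add, map_mul]
    ring
  have key : ∀ y, W.Equation α y → p₀ + q₀ * y = 0 := by
    intro y hy
    have h1' := h1
    rw [← hdd] at h1'
    have := map_eq_zero_of_isIntegral (IsFractionRing.injective W.CoordinateRing L) hz'i
      (d := Affine.CoordinateRing.mk W (C (X - C α))) h1'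
      (evalAt hy) (by rw [evalAt_mk]; simp [evalEval])
    rw [evalAt_mk] at this
    simpa [evalEval] using this
  have k1 := key β hE
  have k2 := key _ ((Affine.equation_neg α β).mpr hE)
  by_cases hq0 : q₀ = 0
  · have hp0 : p₀ = 0 := by rw [hq0] at k1; simpa using k1
    refine ⟨b, ?_⟩
    rw [hp0, hq0] at h1
    simp only [map_zero, zero_mul, add_zero] at h1
    exact (sub_eq_zero.mp ((mul_eq_zero.mp h1).resolve_right hd)).symm
  · exfalso
    have hββ : 2 * β + W.a₁ * α + W.a₃ = 0 := by
      apply mul_left_cancel₀ hq0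
      rw [Affine.negY] at k2
      linear_combination k1 - k2
    refine not_isIntegral_of_ramified (L := L) hE hββ (z := algebraMap K L q₀⁻¹ * z') ?_ ?_
    · refine _root_.IsIntegral.mul ?_ hz'i
      rw [← toFF_C_C (W := W)]
      exact isIntegral_algebraMap
    · have hpq : p₀ = -(q₀ * β) := by linear_combination k1
      have e : algebraMap _ L (Affine.CoordinateRing.mk W (C (C p₀) + C (C q₀) * X)) =
          algebraMap K L q₀ * (fY W L - algebraMap K L β) := by
        rw [hpq]
        have hcc : ∀ c : K, (algebraMap W.CoordinateRing L)
          ((Affine.CoordinateRing.mk W) (C (C c))) = algebraMap K L c := toFF_C_C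
        have hYY : (algebraMap W.CoordinateRing L) ((Affine.CoordinateRing.mk W) X) = fY W L := rfl
        simp only [map_add, map_mul, map_neg, hcc, hYY]
        ring
      rw [mul_assoc, h1, e, ← mul_assoc, ← map_mul, inv_mul_cancel₀ hq0, map_one, one_mul]

/-- The coordinate ring is integrally closed. -/
theorem exists_of_isIntegral {z : L} (hz : _root_.IsIntegral W.CoordinateRing z) :
    ∃ b : W.CoordinateRing, algebraMap _ L b = z := by
  -- The norm turns every denominator into a polynomial in x. Its linear factors are then removed
  -- one at a time.
  have key : ∀ (n : ℕ) (N : K[X]) (z : L), N.natDegree = n → N ≠ 0 →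
      _root_.IsIntegral W.CoordinateRing z → (∃ a, z * toFF L W (C N) = algebraMap W.CoordinateRing L a) →
      ∃ b : W.CoordinateRing, algebraMap _ L b = z := by
    intro n
    induction n with
    | zero =>
      intro N z hN hN0 hz ⟨a, ha⟩
      rw [eq_C_of_natDegree_eq_zero hN] at ha hN0
      have hc : N.coeff 0 ≠ 0 := fun h => hN0 (by rw [h, map_zero])
      refine ⟨Affine.CoordinateRing.mk W (C (C (N.coeff 0)⁻¹)) * a, ?_⟩
      rw [map_mul, ← ha]
      change toFF L W _ * (z * toFF L W _) = z
      rw [toFF_C_C, toFF_C_C, map_inv₀]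
      have : algebraMap K L (N.coeff 0) ≠ 0 := (_root_.map_ne_zero _).mpr hc
      field_simp
    | succ n ih =>
      intro N z hN hN0 hz ⟨a, ha⟩
      obtain ⟨α, hα⟩ := IsAlgClosed.exists_root N (by
        intro h0
        have := natDegree_eq_zero_iff_degree_le_zero.mpr h0.le
        omega)
      obtain ⟨N', rfl⟩ := dvd_iff_isRoot.mpr hα
      have hN'0 : N' ≠ 0 := right_ne_zero_of_mul hN0
      have hN' : N'.natDegree = n := by
        rw [natDegree_mul (X_sub_C_ne_zero α) hN'0, natDegree_X_sub_C] at hN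
        omega
      have hi : _root_.IsIntegral W.CoordinateRing (z * toFF L W (C N')) := hz.mul isIntegral_algebraMap
      obtain ⟨b, hb⟩ := exists_of_isIntegral_of_mul hi (α := α) (a := a) (by
        rw [← ha, toFF, toFF, map_mul, map_mul, map_mul, C_sub, map_sub, map_sub,
          ← toFF_C_C (W := W) α, fX]
        ring)
      exact ih N' z hN' hN'0 hz ⟨b, hb.symm⟩
  obtain ⟨a, b, hb, rfl⟩ := IsFractionRing.div_surjective (A := W.CoordinateRing) z
  obtain ⟨N, hN, c, hc⟩ := exists_dvd_C b (nonZeroDivisors.ne_zero hb)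
  refine key _ N _ rfl hN hz ⟨a * c, ?_⟩
  have hb0 : algebraMap W.CoordinateRing L b ≠ 0 :=
    (map_ne_zero_iff _ (IsFractionRing.injective W.CoordinateRing L)).mpr
      (nonZeroDivisors.ne_zero hb)
  change _ * algebraMap W.CoordinateRing L (algebraMap K[X] W.CoordinateRing N) = _
  rw [hc, map_mul, map_mul]
  field_simp

end IntegrallyClosed

/-! ### The Weil pairing as a character, its nondegeneracy and surjectivity -/

section Pairing

variable {K : Type*} [Field K] [IsAlgClosed K] {W : Affine K} [W.IsElliptic]

section FunctionField

variable {L : Type*} [Field L]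
  [Algebra W.CoordinateRing L] [IsFractionRing W.CoordinateRing L] [Algebra K L]
  [IsScalarTower K W.CoordinateRing L]

lemma exists_algebraMap_eq_of_pow {z : L} {m : ℕ} (hm : m ≠ 0) {c : K}
    (h : z ^ m = algebraMap K L c) : ∃ b : K, algebraMap K L b = z := by
  apply exists_algebraMap_eq_of_isAlgebraic
  refine ⟨X ^ m - C c, X_pow_sub_C_ne_zero (Nat.pos_of_ne_zero hm) c, ?_⟩
  simp [h]

lemma exists_root_mulPull {f : K[X][Y]} {T : W.Point} {m : ℕ} (hm : m ≠ 0)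
    (hf : Ideal.span {Affine.CoordinateRing.mk W f} = pointIdeal T ^ m) :
    ∃ g : L, g ^ m = mulPull W L hm (toFF L W f) := by
  by_cases hT : T = 0
  · rw [hT, pointIdeal_zero, Ideal.top_pow, Ideal.span_singleton_eq_top] at hf
    obtain ⟨c, -, hc⟩ := exists_C_of_isUnit hf
    obtain ⟨b, hb⟩ := IsAlgClosed.exists_pow_nat_eq c (Nat.pos_of_ne_zero hm)
    refine ⟨algebraMap K L b, ?_⟩
    rw [toFF, hc, ← map_pow, hb]
    exact ((mulPull W L hm).commutes c).symm.trans (by rw [← toFF_C_C (W := W)])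
  · exact exists_pow_eq_mulPull hm hT hf

lemma root_ne_zero {f : K[X][Y]} {T : W.Point} {m : ℕ} (hm : m ≠ 0)
    (hf : Ideal.span {Affine.CoordinateRing.mk W f} = pointIdeal T ^ m) {g : L}
    (hg : g ^ m = mulPull W L hm (toFF L W f)) : g ≠ 0 := by
  rintro rfl
  rw [zero_pow hm] at hg
  exact (_root_.map_ne_zero _).mpr (toFF_ne_zero (mk_ne_zero_of_span hf)) hg.symm

/-- Changing f or its root changes g by a constant, and constants do not affect τ_S g / g. -/
lemma root_unique {f f' : K[X][Y]} {T : W.Point} {m : ℕ} (hm : m ≠ 0)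
    (hf : Ideal.span {Affine.CoordinateRing.mk W f} = pointIdeal T ^ m)
    (hf' : Ideal.span {Affine.CoordinateRing.mk W f'} = pointIdeal T ^ m) {g g' : L}
    (hg : g ^ m = mulPull W L hm (toFF L W f)) (hg' : g' ^ m = mulPull W L hm (toFF L W f')) :
    ∃ c : K, g' = algebraMap K L c * g := by
  obtain ⟨u, hu, hfu⟩ := isUnit_of_span_eq (hf.trans hf'.symm)
  obtain ⟨u, -, rfl⟩ := exists_C_of_isUnit hu
  have hg0 := root_ne_zero hm hf hg
  have h1 : (g' / g) ^ m = algebraMap K L u := by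
    rw [div_pow, hg', hg, toFF, hfu, map_mul, map_mul, ← toFF, mul_div_cancel_left₀ _ (by
      exact (_root_.map_ne_zero _).mpr (toFF_ne_zero (mk_ne_zero_of_span hf)))]
    change mulPull W L hm (toFF L W (C (C u))) = _
    rw [toFF_C_C, AlgHom.commutes]
  obtain ⟨c, hc⟩ := exists_algebraMap_eq_of_pow hm h1
  exact ⟨c, by rw [hc, div_mul_cancel₀ _ hg0]⟩

lemma exists_tau_root {F g : L} {m : ℕ} (hm : m ≠ 0) (hg : g ^ m = mulPull W L hm F) (hg0 : g ≠ 0)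
    {S : W.Point} (hS : m • S = 0) : ∃ c : K, c ^ m = 1 ∧ tau L S g = algebraMap K L c * g := by
  have h1 : (tau L S g / g) ^ m = 1 := by
    rw [div_pow, ← map_pow, hg, tau_mulPull hm hS, ← hg, div_self (pow_ne_zero m hg0)]
  obtain ⟨c, hc⟩ := exists_algebraMap_eq_of_pow (K := K) hm (h1.trans (map_one _).symm)
  refine ⟨c, ?_, by rw [hc, div_mul_cancel₀ _ hg0]⟩
  rw [← hc, ← map_pow] at h1
  exact (algebraMap K L).injective (h1.trans (map_one _).symm)

end FunctionField

/-- The pointwise conditions at almost all points become identities in the function field, where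
translation and pullback are field homomorphisms. -/
lemma isWeilPairing_iff {m : ℕ} (hm : m ≠ 0) {S T : W.Point} {ζ : K} :
    IsWeilPairing W m S T ζ ↔ ∃ (f : K[X][Y]) (g : FF W),
      Ideal.span {Affine.CoordinateRing.mk W f} = pointIdeal T ^ m ∧
      g ^ m = mulPull W (FF W) hm (toFF (FF W) W f) ∧
      tau (FF W) S g = algebraMap K (FF W) ζ * g := by
  have hinf := infinite_point W
  constructor
  · rintro ⟨f, a, b, hf, hab, hS⟩
    have hb : Affine.CoordinateRing.mk W b ≠ 0 := by
      intro h0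
      have h1 : Rep W (0 : FF W) (evalPt b) := by
        have := rep_mk (W := W) (L := FF W) b
        rwa [h0, map_zero] at this
      have h2 : Rep W (0 : FF W) (fun _ => 0) := by
        have := rep_const (W := W) (L := FF W) 0
        rwa [map_zero] at this
      obtain ⟨X, h3, h4⟩ := (hab.and (h1.eq h2)).exists
      exact h3.1 h4
    have hg : Rep W (toFF (FF W) W a / toFF (FF W) W b)
      (fun X => evalPt a X / evalPt b X) := (rep_mk a).div (rep_mk b)
    refine ⟨f, toFF (FF W) W a / toFF (FF W) W b, hf, ?_, ?_⟩
    · refine (hg.pow m).injective (((rep_mk f).mulPull hm).congr ?_)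
      filter_upwards [hab] with X hX
      exact hX.2.symm
    · refine (hg.tau S).injective (((rep_const ζ).mul hg).congr ?_)
      filter_upwards [hS] with X hX
      exact hX.symm
  · rintro ⟨f, g, hf, hg, hS⟩
    obtain ⟨a, b, hb, rfl, hr⟩ := exists_rep_div (W := W) g
    refine ⟨f, a, b, hf, ?_, ?_⟩
    · have h1 := (hr.pow m).eq (hg ▸ (rep_mk f).mulPull hm)
      filter_upwards [eventually_evalPt_ne_zero hb, h1] with X h2 h3
      exact ⟨h2, h3⟩
    · have h1 := (hr.tau S).eq (hS ▸ (rep_const ζ).mul hr)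
      exact h1

/-- The Weil pairing with a fixed second argument as a homomorphism. -/
theorem exists_weilHom {m : ℕ} (hm : m ≠ 0) {T : W.Point} (hT : m • T = 0) :
    ∃ e : Multiplicative (tors W.Point m) →* K, (∀ S, e S ^ m = 1) ∧
      ∀ (S : tors W.Point m) (ζ : K), IsWeilPairing W m S T ζ ↔ e (.ofAdd S) = ζ := by
  obtain ⟨f, hf⟩ := exists_span_eq_pointIdeal_pow hT
  obtain ⟨g, hg⟩ := exists_root_mulPull (L := FF W) hm hf
  have hg0 := root_ne_zero hm hf hg
  -- One g serves all S. The factor of τ_S g is a constant, fixed by every translation, so it is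
  -- multiplicative in S.
  choose e he1 he2 using fun S : tors W.Point m => exists_tau_root hm hg hg0 (mem_tors.mp S.2)
  have huniq : ∀ (S : tors W.Point m) (ζ : K),
      tau (FF W) (S : W.Point) g = algebraMap K (FF W) ζ * g → e S = ζ := by
    intro S ζ h
    rw [he2] at h
    exact (algebraMap K (FF W)).injective (mul_right_cancel₀ hg0 h)
  refine ⟨{ toFun := fun S => e S.toAdd, map_one' := ?_, map_mul' := ?_ }, fun S => he1 _,
    fun S ζ => ?_⟩
  · refine huniq 0 1 ?_
    rw [(algebraMap K (FF W)).map_one, one_mul]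
    exact AlgHom.congr_fun tau_zero g
  · intro S S'
    apply huniq
    change tau (FF W) ((S.toAdd : W.Point) + (S'.toAdd : W.Point)) g = _
    rw [tau_add, AlgHom.comp_apply, he2, map_mul, AlgHom.commutes, he2, map_mul]
    ring
  · change _ ↔ e S = ζ
    rw [isWeilPairing_iff hm]
    constructor
    · rintro ⟨f', g', hf', hg', h⟩
      obtain ⟨c, rfl⟩ := root_unique hm hf hf' hg hg'
      have hc : algebraMap K (FF W) c ≠ 0 := left_ne_zero_of_mul (root_ne_zero hm hf' hg')
      apply huniq
      rw [map_mul, AlgHom.commutes] at h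
      apply mul_left_cancel₀ hc
      rw [h]; ring
    · rintro rfl
      exact ⟨f, g, hf, hg, he2 S⟩

/-- Nondegeneracy of the Weil pairing. -/
lemma not_forall_pow_eq_one {m k : ℕ} (hm : m ≠ 0) {T : W.Point} (hT : addOrderOf T = m)
    (hc : Nat.card (tors W.Point m) = m ^ 2) (hk : k ∣ m) (hkm : k < m) :
    ¬ ∀ (S : W.Point) (ζ : K), m • S = 0 → IsWeilPairing W m S T ζ → ζ ^ k = 1 := by
  intro hall
  have hmT : m • T = 0 := hT ▸ addOrderOf_nsmul_eq_zero T
  obtain ⟨j, rfl⟩ := hk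
  have hk0 : k ≠ 0 := left_ne_zero_of_mul hm
  have hj0 : j ≠ 0 := right_ne_zero_of_mul hm
  obtain ⟨f, hf⟩ := exists_span_eq_pointIdeal_pow hmT
  obtain ⟨g, hg⟩ := exists_root_mulPull (L := FF W) hm hf
  have hg0 := root_ne_zero hm hf hg
  -- If all values were k-th roots of unity, g^k would be invariant under E[m] and so descend along
  -- [m] to some h. With m = kj this gives h^j = f.
  obtain ⟨h, hh⟩ := exists_mulPull_eq (L := FF W) hm hc (h := g ^ k) (by
    intro S hS
    obtain ⟨c, hc1, hc2⟩ := exists_tau_root hm hg hg0 hS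
    have := hall S c hS ((isWeilPairing_iff hm).mpr ⟨f, g, hf, hg, hc2⟩)
    rw [map_pow, hc2, mul_pow, ← map_pow, this, map_one, one_mul])
  have hfh : h ^ j = toFF (FF W) W f := by
    apply (mulPull W (FF W) hm).toRingHom.injective
    change mulPull W (FF W) hm (h ^ j) = mulPull W (FF W) hm (toFF (FF W) W f)
    rw [map_pow, hh, ← hg, pow_mul]
  set T' := k • T with hT'def
  have hT' : T' ≠ 0 := by
    intro h0
    have := addOrderOf_dvd_of_nsmul_eq_zero h0
    rw [hT] at this
    exact absurd (Nat.le_of_dvd (Nat.pos_of_ne_zero hk0) this) (by omega)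
  have hjT' : j • T' = 0 := by rw [hT'def, ← mul_smul, mul_comm, hmT]
  -- Formally h has divisor k(T) − k(O). The factor v/u moves it to (kT) − (O), where kT ≠ 0 as k <
  -- m, and the constant d makes its j-th power exactly f'.
  obtain ⟨u, v, hu, hv, huv⟩ := exists_span_mul_pointIdeal_pow T k
  obtain ⟨f', hf'⟩ := exists_span_eq_pointIdeal_pow hjT'
  have hspan : Ideal.span {v ^ j * Affine.CoordinateRing.mk W f} =
      Ideal.span {u ^ j * Affine.CoordinateRing.mk W f'} := by
    rw [← Ideal.span_singleton_mul_span_singleton, ← Ideal.span_singleton_mul_span_singleton, hf,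
      hf', ← Ideal.span_singleton_pow, ← Ideal.span_singleton_pow, pow_mul, ← mul_pow, ← mul_pow,
      huv]
  obtain ⟨c, hcu, hc⟩ := isUnit_of_span_eq hspan
  obtain ⟨c, hc0, rfl⟩ := exists_C_of_isUnit hcu
  obtain ⟨d, hd⟩ := IsAlgClosed.exists_pow_nat_eq c (Nat.pos_of_ne_zero hj0)
  set uL := algebraMap W.CoordinateRing (FF W) u with huL
  set vL := algebraMap W.CoordinateRing (FF W) v with hvL
  have hinj := IsFractionRing.injective W.CoordinateRing (FF W)
  have huL0 : uL ≠ 0 := (map_ne_zero_iff _ hinj).mpr hu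
  have hroot : (algebraMap K (FF W) d * h * vL / uL) ^ j = toFF (FF W) W f' := by
    have h1 := congrArg (algebraMap W.CoordinateRing (FF W)) hc
    rw [map_mul, map_mul, map_mul, map_pow, map_pow] at h1
    change uL ^ j * toFF (FF W) W f' = vL ^ j * toFF (FF W) W f * toFF (FF W) W (C (C c)) at h1
    rw [toFF_C_C, ← hfh, ← hd, map_pow] at h1
    rw [div_pow, div_eq_iff (pow_ne_zero j huL0), mul_comm (toFF _ _ _), h1]
    ring
  obtain ⟨a, ha⟩ := exists_of_isIntegral (W := W) (L := FF W)
    (z := algebraMap K (FF W) d * h * vL / uL) (_root_.IsIntegral.of_pow (Nat.pos_of_ne_zero hj0) (by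
      rw [hroot]; exact isIntegral_algebraMap))
  rw [← ha, ← map_pow] at hroot
  have haf : a ^ j = Affine.CoordinateRing.mk W f' := hinj hroot
  obtain ⟨c', hc'0, hc'⟩ := exists_mul_conjA hT' hf'
  rw [← mk_norm, ← map_pow, ← map_mul, ← C_pow, ← C_mul, ← haf, map_pow] at hc'
  have hCinj : Function.Injective (fun p : K[X] => Affine.CoordinateRing.mk W (C p)) := by
    intro p q hpq
    have h1 : toFF (FF W) W (C p) = toFF (FF W) W (C q) :=
      congrArg (algebraMap W.CoordinateRing (FF W)) hpq
    have h2 : ∀ p : K[X], toFF (FF W) W (C p) = aeval (fX W (FF W)) p := by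
      intro p
      rw [toFF_eq_fAt, fAt, evL]
      rw [Polynomial.map_C, evalEval_C, coe_mapRingHom, eval_map]; rfl
    rw [h2, h2] at h1
    exact aeval_fX_injective (FF W) h1
  have hpoly := hCinj hc'
  have hdeg := congrArg natDegree hpoly
  rw [natDegree_pow, natDegree_C_mul hc'0, natDegree_pow, natDegree_X_sub_C, mul_one] at hdeg
  -- A regular function with one simple zero has a norm of degree 1, which does not occur on a
  -- Weierstrass curve.
  have : (Algebra.norm K[X] a).natDegree = 1 :=
    Nat.eq_of_mul_eq_mul_left (Nat.pos_of_ne_zero hj0) (hdeg.trans (mul_one j).symm)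
  exact Affine.CoordinateRing.natDegree_norm_ne_one a this

/-- Surjectivity of the Weil pairing onto the roots of unity. -/
theorem exists_isWeilPairing {m : ℕ} (hm : m ≠ 0) {T : W.Point} (hT : addOrderOf T = m)
    (hc : Nat.card (tors W.Point m) = m ^ 2) {ζ : K} (hζ : ζ ^ m = 1) :
    ∃ S : W.Point, m • S = 0 ∧ IsWeilPairing W m S T ζ := by
  have hmT : m • T = 0 := hT ▸ addOrderOf_nsmul_eq_zero T
  obtain ⟨e, he1, he2⟩ := exists_weilHom hm hmT
  have := finite_tors W hm
  let e' : Multiplicative (tors W.Point m) →* Kˣ := e.toHomUnits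
  let Γ : Subgroup Kˣ := e'.range
  have : Finite (Multiplicative (tors W.Point m)) := inferInstanceAs (Finite (tors W.Point m))
  have hΓfin : Finite Γ := (Set.finite_range e').to_subtype
  set k := Nat.card Γ with hk
  have hpow : ∀ S, e S ^ k = 1 := by
    intro S
    have h1 : (⟨e' S, S, rfl⟩ : Γ) ^ k = 1 := pow_card_eq_one'
    have h2 := congrArg (fun x : Γ => ((x : Kˣ) : K)) h1
    exact h2
  -- All values are killed by the order k of the image and by m, so a proper gcd would contradict
  -- nondegeneracy. Hence m ∣ k, while the image lies among the at most m roots of unity of order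
  -- dividing m.
  by_cases hlt : Nat.gcd k m < m
  · exfalso
    refine not_forall_pow_eq_one hm hT hc (Nat.gcd_dvd_right k m) hlt ?_
    intro S ζ hS hζ
    have h1 := (he2 ⟨S, mem_tors.mpr hS⟩ ζ).mp hζ
    rw [← h1, pow_gcd_eq_one]
    exact ⟨hpow _, he1 _⟩
  · have hmk : m ∣ k := by
      have h1 : Nat.gcd k m = m :=
        le_antisymm (Nat.le_of_dvd (Nat.pos_of_ne_zero hm) (Nat.gcd_dvd_right k m)) (by omega)
      exact h1 ▸ Nat.gcd_dvd_left k m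
    have hmle : m ≤ k := Nat.le_of_dvd Nat.card_pos hmk
    have : NeZero m := ⟨hm⟩
    have hΓle : Γ ≤ rootsOfUnity m K := by
      rintro _ ⟨S, rfl⟩
      rw [mem_rootsOfUnity']
      exact he1 S
    have hΓ : Γ = rootsOfUnity m K := Subgroup.eq_of_le_of_card_ge hΓle
      ((card_rootsOfUnity K m).trans hmle)
    have hζ' : Units.ofPowEqOne ζ m hζ hm ∈ Γ := by
      rw [hΓ, mem_rootsOfUnity']
      exact hζ
    obtain ⟨S, hS⟩ := hζ'
    refine ⟨(S.toAdd : tors W.Point m), mem_tors.mp (S.toAdd).2, (he2 S.toAdd ζ).mpr ?_⟩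
    exact congrArg Units.val hS

end Pairing

end EllCount
end

noncomputable section
namespace EllCount
open WeierstrassCurve Polynomial Filter
open scoped Classical Polynomial.Bivariate

set_option linter.unusedSectionVars false

/-! ### The Weil pairing of a point with itself -/

section Alternating

/-- With l the slope through X, S and l' the slope through −S, T, it compares x(X+S) − x(T) with
x(X) − x(T−S). Each difference is a line times its conjugate, up to known factors (`e1`, `e2`), and
the two conjugates are proportional (`e3`). -/
lemma chord_identity {F : Type*} [Field F] {a₁ a₂ a₃ a₄ a₆ xX yX xS yS xT yT l l' : F}
    (hX : yX ^ 2 + a₁ * xX * yX + a₃ * yX = xX ^ 3 + a₂ * xX ^ 2 + a₄ * xX + a₆)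
    (hS : yS ^ 2 + a₁ * xS * yS + a₃ * yS = xS ^ 3 + a₂ * xS ^ 2 + a₄ * xS + a₆)
    (hT : yT ^ 2 + a₁ * xT * yT + a₃ * yT = xT ^ 3 + a₂ * xT ^ 2 + a₄ * xT + a₆)
    (hl : yX - yS = l * (xX - xS)) (hl' : -yS - a₁ * xS - a₃ - yT = l' * (xS - xT))
    (hXS : xX ≠ xS) (hTS : xT ≠ xS) (hXT : xX ≠ xT) :
    (l ^ 2 + a₁ * l - a₂ - xX - xS - xT) *
        (yX - (l' * (xX - xS) + (-yS - a₁ * xS - a₃))) =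
      (xX - (l' ^ 2 + a₁ * l' - a₂ - xS - xT)) * (yT - l * (xT - xX) - yX) := by
  have h1 := sub_ne_zero.mpr hXS
  have h2 := sub_ne_zero.mpr hTS
  have h3 := sub_ne_zero.mpr hXT
  have e1 : (xX - xT) * (xT - xS) * (l ^ 2 + a₁ * l - a₂ - xX - xS - xT) =
      (yT - l * (xT - xX) - yX) * (yT + l * (xT - xX) + yX + a₁ * xT + a₃) := by
    have e := mul_left_cancel₀ h1 (a := xX - xS)
      (b := (xX - xT) * (xT - xS) * (l ^ 2 + a₁ * l - a₂ - xX - xS - xT) -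
        (yT - l * (xT - xX) - yX) * (yT + l * (xT - xX) + yX + a₁ * xT + a₃)) (c := 0) (by
        have hS' : yS = yX - l * (xX - xS) := by linear_combination -hl
        rw [hS'] at hS
        linear_combination (xX - xT) * hS + (xT - xS) * hX - (xX - xS) * hT)
    linear_combination e
  have e2 : (xT - xX) * (xX - xS) * (l' ^ 2 + a₁ * l' - a₂ - xS - xT - xX) =
      (yX - (l' * (xX - xS) + (-yS - a₁ * xS - a₃))) *
        (yX + (l' * (xX - xS) + (-yS - a₁ * xS - a₃)) + a₁ * xX + a₃) := by
    have e := mul_left_cancel₀ h2 (a := xT - xS)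
      (b := (xT - xX) * (xX - xS) * (l' ^ 2 + a₁ * l' - a₂ - xS - xT - xX) -
        (yX - (l' * (xX - xS) + (-yS - a₁ * xS - a₃))) *
        (yX + (l' * (xX - xS) + (-yS - a₁ * xS - a₃)) + a₁ * xX + a₃)) (c := 0) (by
        have hS' : yS = -a₁ * xS - a₃ - yT - l' * (xS - xT) := by linear_combination -hl'
        rw [hS'] at hS ⊢
        linear_combination (xT - xX) * hS + (xX - xS) * hT - (xT - xS) * hX)
    linear_combination e
  have e3 : (yT + l * (xT - xX) + yX + a₁ * xT + a₃) * (xX - xS) =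
      (yX + (l' * (xX - xS) + (-yS - a₁ * xS - a₃)) + a₁ * xX + a₃) * (xT - xS) := by
    linear_combination (xX - xT) * hl + (-(xX - xS)) * hl'
  apply mul_left_cancel₀ (mul_ne_zero (mul_ne_zero h1 h2) h3)
  linear_combination (yX - (l' * (xX - xS) + (-yS - a₁ * xS - a₃))) * (xX - xS) * e1 -
    (yT - l * (xT - xX) - yX) * (xT - xS) * e2 +
    (yT - l * (xT - xX) - yX) * (yX - (l' * (xX - xS) + (-yS - a₁ * xS - a₃))) * e3

variable {K : Type*} [Field K] [IsAlgClosed K] {W : Affine K} [W.IsElliptic]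

section FunctionField

variable {L : Type*} [Field L]
  [Algebra W.CoordinateRing L] [IsFractionRing W.CoordinateRing L] [Algebra K L]
  [IsScalarTower K W.CoordinateRing L]

lemma Nonconst.xCoord_ne {P : (W.baseChange L).toAffine.Point} (hP : Nonconst P) (c : K) :
    xCoord P ≠ algebraMap K L c := by
  intro h
  apply hP.transcendental
  rw [h]
  exact isAlgebraic_algebraMap c

lemma xCoord_pointHom {S : W.Point} : xCoord (pointHom L W S) = algebraMap K L (xCoord S) := by
  rcases S with _ | ⟨x, y, h⟩
  · exact (map_zero _).symm
  · rfl

lemma yCoord_pointHom {S : W.Point} : yCoord (pointHom L W S) = algebraMap K L (yCoord S) := by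
  rcases S with _ | ⟨x, y, h⟩
  · exact (map_zero _).symm
  · rfl

lemma xCoord_generic : xCoord (generic W L) = fX W L := rfl
lemma yCoord_generic : yCoord (generic W L) = fY W L := rfl

/-- Translating a function with divisor `m(T) - m(O)`. -/
lemma exists_tau_mul_eq {f : K[X][Y]} {T : W.Point} {m : ℕ} (hT : T ≠ 0)
    (hf : Ideal.span {Affine.CoordinateRing.mk W f} = pointIdeal T ^ m) {S : W.Point}
    (hS : S ≠ 0) (hST : S ≠ T) (hST' : S ≠ -T) :
    ∃ (a l : W.CoordinateRing) (c : K), a ≠ 0 ∧ l ≠ 0 ∧ c ≠ 0 ∧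
      Ideal.span {a} * (pointIdeal (-S) * pointIdeal T) = Ideal.span {l} * pointIdeal (T - S) ∧
      tau L S (toFF L W f) * algebraMap _ L l ^ m =
        algebraMap K L c * toFF L W f * algebraMap _ L a ^ m := by
  have hx : xCoord S ≠ xCoord T := fun h =>
    (eq_or_eq_neg_of_xCoord_eq hS hT h).elim hST hST'
  obtain ⟨c, hc, hadd⟩ := exists_fAt_add hT hf L
  have hG := nonconst_generic W L
  have hGS := hG.add_const S
  have hS' : pointHom L W S ≠ 0 := fun h => hS (pointHom_injective L W (h.trans (map_zero _).symm))
  have hadd := hadd _ _ hG.ne_zero hS' hGS.ne_zero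
  have hfS : evalPt f S ≠ 0 := by
    rcases S with _ | ⟨x, y, h⟩
    · exact absurd rfl hS
    intro h0
    obtain ⟨-, h1, -⟩ := eq_of_evalEval_eq_zero hf h.1 h0
    exact hx h1.symm
  have hfS' : fAt f (pointHom L W S) = algebraMap K L (evalPt f S) := by
    rcases S with _ | ⟨x, y, h⟩
    · exact absurd rfl hS
    change evL L f (algebraMap K L x) (algebraMap K L y) = algebraMap K L (f.evalEval x y)
    rw [evL, map_mapRingHom_evalEval]
  have htau : tau L S (toFF L W f) = fAt f (generic W L + pointHom L W S) :=
    pull_toFF hGS f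
  set l' := W.slope (xCoord S) (xCoord T) (W.negY (xCoord S) (yCoord S)) (yCoord T) with hl'
  have hnS : -S ≠ 0 := neg_ne_zero.mpr hS
  have hI : Affine.CoordinateRing.XIdeal W (W.addX (xCoord S) (xCoord T) l') *
      (pointIdeal (-S) * pointIdeal T) = Affine.CoordinateRing.YIdeal W
        (Affine.linePolynomial (xCoord S) (W.negY (xCoord S) (yCoord S)) l') *
        pointIdeal (T - S) := by
    rw [sub_eq_neg_add]
    rcases S with _ | ⟨xS, yS, h1⟩
    · exact absurd rfl hS
    rcases T with _ | ⟨xT, yT, h2⟩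
    · exact absurd rfl hT
    have hxy : ¬(xS = xT ∧ W.negY xS yS = W.negY xT yT) := fun h => hx h.1
    rw [Affine.Point.neg_some, Affine.Point.add_some hxy]
    exact Affine.CoordinateRing.XYIdeal_mul_XYIdeal ((Affine.equation_neg xS yS).mpr h1.1) h2.1 hxy
  refine ⟨_, _, evalPt f S / c, Affine.CoordinateRing.XClass_ne_zero _,
    Affine.CoordinateRing.YClass_ne_zero _, div_ne_zero hfS hc, hI, ?_⟩
  set a : L := algebraMap W.CoordinateRing L
    (Affine.CoordinateRing.XClass W (W.addX (xCoord S) (xCoord T) l')) with ha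
  set l : L := algebraMap W.CoordinateRing L (Affine.CoordinateRing.YClass W
    (Affine.linePolynomial (xCoord S) (W.negY (xCoord S) (yCoord S)) l')) with hl
  have hXX : (algebraMap W.CoordinateRing L) ((Affine.CoordinateRing.mk W) (C X)) = fX W L := rfl
  have hYY : (algebraMap W.CoordinateRing L) ((Affine.CoordinateRing.mk W) X) = fY W L := rfl
  have hcc : ∀ c : K, (algebraMap W.CoordinateRing L) ((Affine.CoordinateRing.mk W) (C (C c))) =
      algebraMap K L c := toFF_C_C
  have ha' : a = fX W L - algebraMap K L (W.addX (xCoord S) (xCoord T) l') := by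
    rw [ha, Affine.CoordinateRing.XClass, C_sub, map_sub, map_sub, hXX, hcc]
  have hl2 : l = fY W L - (algebraMap K L l' * (fX W L - algebraMap K L (xCoord S)) +
      algebraMap K L (W.negY (xCoord S) (yCoord S))) := by
    rw [hl, Affine.CoordinateRing.YClass, Affine.linePolynomial]
    simp only [map_sub, map_add, map_mul, hXX, hYY, hcc]
  have ha0 : a ≠ 0 := by
    rw [ha']; exact toFF_sub_ne_zero _
  have hl0 : l ≠ 0 := (map_ne_zero_iff _ (IsFractionRing.injective W.CoordinateRing L)).mpr
    (Affine.CoordinateRing.YClass_ne_zero _)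
  have hXS : xCoord (generic W L) ≠ xCoord (pointHom L W S) := by
    rw [xCoord_pointHom]; exact hG.xCoord_ne _
  -- The chord through the moving point and S, evaluated at T, is traded for the fixed line through
  -- −S and T, evaluated at the moving point. This is what makes `a` and `l` regular functions.
  have key : (xCoord (generic W L + pointHom L W S) - algebraMap K L (xCoord T)) * l =
      a * chordAt (generic W L) (pointHom L W S) T := by
    rw [xCoord_add_of_xCoord_ne hG.ne_zero hS' hXS, ha', hl2, chordAt, chordSlope]
    set ll := (W.baseChange L).toAffine.slope (xCoord (generic W L)) (xCoord (pointHom L W S))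
      (yCoord (generic W L)) (yCoord (pointHom L W S)) with hll
    rw [Affine.slope_of_X_ne hXS] at hll
    rw [Affine.slope_of_X_ne hx] at hl'
    rw [xCoord_pointHom, yCoord_pointHom, xCoord_generic, yCoord_generic] at hll
    rw [xCoord_pointHom, xCoord_generic, yCoord_generic]
    rw [xCoord_pointHom, xCoord_generic] at hXS
    rw [eq_div_iff (sub_ne_zero.mpr hXS)] at hll
    rw [eq_div_iff (sub_ne_zero.mpr hx)] at hl'
    have e1 := (Affine.equation_iff _ _).mp (equation_coord hG.ne_zero)
    have e2 := congrArg (algebraMap K L) ((Affine.equation_iff _ _).mp (equation_coord hS))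
    have e3 := congrArg (algebraMap K L) ((Affine.equation_iff _ _).mp (equation_coord hT))
    have e4 := congrArg (algebraMap K L) hl'
    simp only [map_add, map_mul, map_pow, map_sub, map_neg, Affine.negY] at e2 e3 e4
    rw [xCoord_generic, yCoord_generic] at e1
    have := chord_identity (l := ll) (l' := algebraMap K L l') e1 e2 e3 hll.symm e4.symm hXS
      ((algebraMap K L).injective.ne hx.symm) (hG.xCoord_ne _)
    simp only [Affine.addX, Affine.negY, map_add, map_mul, map_pow, map_sub, map_neg]
    exact this
  set ch := chordAt (generic W L) (pointHom L W S) T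
  have hch : ch ≠ 0 := by
    intro h
    rw [h, mul_zero] at key
    exact mul_ne_zero (sub_ne_zero.mpr (hGS.xCoord_ne _)) hl0 key
  have hc' : algebraMap K L c ≠ 0 := (_root_.map_ne_zero _).mpr hc
  rw [← toFF_eq_fAt, hfS', ← htau] at hadd
  apply mul_left_cancel₀ (mul_ne_zero hc' (pow_ne_zero m hch))
  rw [map_div₀]
  have key' := congrArg (· ^ m) key
  simp only [mul_pow] at key'
  have hd : algebraMap K L c * (algebraMap K L (evalPt f S) / algebraMap K L c) =
    algebraMap K L (evalPt f S) := mul_div_cancel₀ _ hc'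
  linear_combination -l ^ m * hadd + toFF L W f * algebraMap K L (evalPt f S) * key' -
    ch ^ m * toFF L W f * a ^ m * hd

variable (W) in
lemma exists_notMem_zmultiples {T : W.Point} {m : ℕ} (hm : m ≠ 0) (hT : m • T = 0) :
    ∃ R : W.Point, R ∉ AddSubgroup.zmultiples T := by
  by_contra! h
  have := infinite_point W
  refine Set.infinite_univ (α := W.Point) ((finite_multiples.mpr
    (isOfFinAddOrder_iff_nsmul_eq_zero.mpr ⟨m, Nat.pos_of_ne_zero hm, hT⟩)).subset fun R _ => ?_)
  rw [(isOfFinAddOrder_iff_nsmul_eq_zero.mpr ⟨m, Nat.pos_of_ne_zero hm, hT⟩).multiples_eq_zmultiples]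
  exact h R

/-- Since T − (R + iT) = −(R + (i−1)T) and mT = 0, the two products differ by a cyclic shift of the
index. -/
lemma prod_range_pointIdeal_shift {T R : W.Point} {m : ℕ} (hT : m • T = 0) :
    ∏ i ∈ Finset.range m, pointIdeal (T - (R + i • T)) =
      ∏ i ∈ Finset.range m, pointIdeal (-(R + i • T)) := by
  cases m with
  | zero => simp
  | succ m =>
    rw [Finset.prod_range_succ', Finset.prod_range_succ (fun i => pointIdeal (-(R + i • T)))]
    congr 1
    · refine Finset.prod_congr rfl fun i _ => ?_
      congr 1
      rw [succ_nsmul]; abel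
    · congr 1
      rw [succ_nsmul] at hT
      rw [zero_nsmul, eq_neg_of_add_eq_zero_left hT]
      abel

/-- Translating by T shifts the index range from 0, …, m−1 to 1, …, m. As the product is constant,
its new last factor equals its old first one. -/
lemma tau_eq_self_of_prod {T : W.Point} {g : L} (hg : g ≠ 0) {m : ℕ} {c : K}
    (h : ∏ i ∈ Finset.range m, tau L (i • T) g = algebraMap K L c) : tau L (m • T) g = g := by
  have h1 := congrArg (tau L T) h
  rw [AlgHom.commutes, ← h, map_prod] at h1
  have h2 : ∀ i, tau L T (tau L (i • T) g) = tau L ((i + 1) • T) g := fun i => by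
    rw [succ_nsmul', tau_add]; rfl
  simp only [h2] at h1
  have h3 := Finset.prod_range_succ (fun i => tau L (i • T) g) m
  rw [Finset.prod_range_succ', h1, zero_nsmul, tau_zero] at h3
  refine (mul_left_cancel₀ ?_ h3).symm
  exact Finset.prod_ne_zero_iff.mpr fun i _ => (_root_.map_ne_zero _).mpr hg

/-- The function with divisor `m ∑ ((1 - i) T) - (-i T)` is constant. -/
lemma exists_prod_tau_eq {f : K[X][Y]} {T : W.Point} {m : ℕ} (hm : m ≠ 0) (hT : T ≠ 0)
    (hmT : m • T = 0) (hf : Ideal.span {Affine.CoordinateRing.mk W f} = pointIdeal T ^ m) :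
    ∃ c : K, ∏ i ∈ Finset.range m, tau L (i • T) (toFF L W f) = algebraMap K L c := by
  -- The translation formula excludes S = 0, T and −T. Shifting by an auxiliary R outside the
  -- multiples of T avoids these, and translating by −R at the end undoes the shift.
  obtain ⟨R, hR⟩ := exists_notMem_zmultiples W hm hmT
  have hRi : ∀ i : ℕ, ∀ k : ℤ, R + i • T ≠ k • T := by
    intro i k h
    apply hR
    rw [eq_sub_of_add_eq h, ← natCast_zsmul, ← sub_smul]
    exact ⟨_, rfl⟩
  choose a l c ha hl hc hI htau using fun i : ℕ => exists_tau_mul_eq (L := L) hT hf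
    (S := R + i • T) (by simpa using hRi i 0) (by simpa using hRi i 1) (by simpa using hRi i (-1))
  have h1 : Ideal.span {(∏ i ∈ Finset.range m, a i) * Affine.CoordinateRing.mk W f} =
      Ideal.span {∏ i ∈ Finset.range m, l i} := by
    have h2 := Finset.prod_congr rfl fun i (_ : i ∈ Finset.range m) => hI i
    rw [Finset.prod_mul_distrib, Finset.prod_mul_distrib, Finset.prod_mul_distrib,
      prod_range_pointIdeal_shift hmT, Finset.prod_const, Finset.card_range, ← hf,
      Ideal.prod_span_singleton, Ideal.prod_span_singleton] at h2
    have h3 : (∏ i ∈ Finset.range m, pointIdeal (-(R + i • T))) *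
        ∏ i ∈ Finset.range m, pointIdeal (R + i • T) = Ideal.span {∏ i ∈ Finset.range m,
          Affine.CoordinateRing.mk W (C (X - C (xCoord (R + i • T))))} := by
      rw [← Finset.prod_mul_distrib, ← Ideal.prod_span_singleton]
      refine Finset.prod_congr rfl fun i _ => ?_
      rw [mul_comm, pointIdeal_mul_neg (by simpa using hRi i 0)]
    have h4 := congrArg (· * ∏ i ∈ Finset.range m, pointIdeal (R + i • T)) h2
    simp only at h4
    rw [mul_assoc, mul_right_comm, h3, mul_assoc, h3, Ideal.span_singleton_mul_span_singleton,
      mul_comm, Ideal.span_singleton_mul_span_singleton, Ideal.span_singleton_mul_span_singleton,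
      mul_assoc, mul_comm (∏ i ∈ Finset.range m, l i), Ideal.span_singleton_eq_span_singleton] at h4
    rw [Ideal.span_singleton_eq_span_singleton, mul_comm (∏ i ∈ Finset.range m, a i)]
    exact h4.of_mul_left (Associated.refl _) (Finset.prod_ne_zero_iff.mpr fun i _ =>
      Affine.CoordinateRing.XClass_ne_zero (xCoord (R + i • T)))
  obtain ⟨u, hu, h5⟩ := isUnit_of_span_eq h1
  obtain ⟨u, hu0, rfl⟩ := exists_C_of_isUnit hu
  have h6 : (∏ i ∈ Finset.range m, algebraMap W.CoordinateRing L (l i)) =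
      (∏ i ∈ Finset.range m, algebraMap W.CoordinateRing L (a i)) * toFF L W f *
        algebraMap K L u := by
    rw [← map_prod, h5, map_mul, map_mul, map_prod, ← toFF_C_C (W := W)]
  have h7 := Finset.prod_congr rfl fun i (_ : i ∈ Finset.range m) => htau i
  simp only [Finset.prod_mul_distrib, Finset.prod_pow] at h7
  rw [h6, Finset.prod_const, Finset.card_range] at h7
  have hA : ∏ i ∈ Finset.range m, algebraMap W.CoordinateRing L (a i) ≠ 0 :=
    Finset.prod_ne_zero_iff.mpr fun i _ =>
      (map_ne_zero_iff _ (IsFractionRing.injective W.CoordinateRing L)).mpr (ha i)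
  have hF : toFF L W f ≠ 0 := toFF_ne_zero (mk_ne_zero_of_span hf)
  have hu' : algebraMap K L u ≠ 0 := (_root_.map_ne_zero _).mpr hu0
  have h8 : ∏ i ∈ Finset.range m, tau L (R + i • T) (toFF L W f) =
      algebraMap K L ((∏ i ∈ Finset.range m, c i) / u ^ m) := by
    rw [map_div₀, map_pow, map_prod, eq_div_iff (pow_ne_zero m hu')]
    apply mul_right_cancel₀ (mul_ne_zero (pow_ne_zero m hA) (pow_ne_zero m hF))
    simp only [mul_pow] at h7
    linear_combination h7
  refine ⟨(∏ i ∈ Finset.range m, c i) / u ^ m, ?_⟩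
  have h9 := congrArg (tau L (-R)) h8
  rw [AlgHom.commutes, map_prod] at h9
  rw [← h9]
  refine Finset.prod_congr rfl fun i _ => ?_
  rw [← AlgHom.comp_apply, ← tau_add, neg_add_cancel_left]

lemma tau_mulPull_eq {n : ℕ} (hn : n ≠ 0) (S : W.Point) (h : L) :
    tau L S (mulPull W L hn h) = mulPull W L hn (tau L (n • S) h) := by
  have := infinite_point W
  obtain ⟨φ, hφ⟩ := exists_rep (W := W) h
  refine ((hφ.mulPull hn).tau S).injective (((hφ.tau (n • S)).mulPull hn).congr
    (Eventually.of_forall fun X => ?_))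
  simp only [smul_add]

end FunctionField

/-- The Weil pairing is alternating. -/
theorem isWeilPairing_self {m : ℕ} (hm : m ≠ 0) {T : W.Point} (hT : m • T = 0) :
    IsWeilPairing W m T T 1 := by
  rw [isWeilPairing_iff hm]
  obtain ⟨f, hf⟩ := exists_span_eq_pointIdeal_pow hT
  obtain ⟨g, hg⟩ := exists_root_mulPull (L := FF W) hm hf
  refine ⟨f, g, hf, hg, ?_⟩
  rw [map_one, one_mul]
  by_cases hT0 : T = 0
  · rw [hT0, tau_zero]; rfl
  -- The m-th power of the product of the translates of g by multiples of T' is the pullback of the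
  -- constant product of the translates of f by multiples of T = mT'. Hence the former product is
  -- constant, and telescoping gives τ_T g = g.
  obtain ⟨T', rfl⟩ := nsmul_surjective W hm T
  obtain ⟨c, hc⟩ := exists_prod_tau_eq (L := FF W) hm hT0 hT hf
  have h1 : (∏ i ∈ Finset.range m, tau (FF W) (i • T') g) ^ m = algebraMap K (FF W) c := by
    rw [← Finset.prod_pow]
    simp only [← map_pow, hg, tau_mulPull_eq]
    rw [← map_prod, ← AlgHom.commutes (mulPull W (FF W) hm), ← hc]
    congr 1
    refine Finset.prod_congr rfl fun i _ => ?_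
    rw [nsmul_left_comm]
  obtain ⟨b, hb⟩ := exists_algebraMap_eq_of_pow hm h1
  exact tau_eq_self_of_prod (root_ne_zero hm hf hg) hb.symm

end Alternating

end EllCount

end

noncomputable section
namespace EllCount
open WeierstrassCurve Polynomial Filter
open scoped Classical Polynomial.Bivariate

set_option linter.unusedSectionVars false

/-! ### Transport of the pairing along field endomorphisms combined with changes of variables -/

section Transport

/-- The transformation formulas are solved for the coefficients of the old curve, so that no inverse
of u occurs and later identities are polynomial. -/
lemma variableChange_eqs {K : Type*} [Field K] {C : VariableChange K} {W W' : WeierstrassCurve K}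
    (h : C • W = W') :
    W.a₁ = C.u * W'.a₁ - 2 * C.s ∧
    W.a₂ = C.u ^ 2 * W'.a₂ + C.s * W.a₁ - 3 * C.r + C.s ^ 2 ∧
    W.a₃ = C.u ^ 3 * W'.a₃ - C.r * W.a₁ - 2 * C.t ∧
    W.a₄ = C.u ^ 4 * W'.a₄ + C.s * W.a₃ - 2 * C.r * W.a₂ + (C.t + C.r * C.s) * W.a₁ - 3 * C.r ^ 2 +
      2 * C.s * C.t ∧
    W.a₆ = C.u ^ 6 * W'.a₆ - C.r * W.a₄ - C.r ^ 2 * W.a₂ - C.r ^ 3 + C.t * W.a₃ + C.t ^ 2 +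
      C.r * C.t * W.a₁ := by
  subst h
  have hu : (C.u : K) ≠ 0 := C.u.ne_zero
  simp only [variableChange_a₁, variableChange_a₂, variableChange_a₃, variableChange_a₄,
    variableChange_a₆, Units.val_inv_eq_inv_val, ← mul_assoc, ← mul_pow, mul_inv_cancel₀ hu,
    one_pow, one_mul]
  refine ⟨?_, ?_, ?_, ?_, ?_⟩ <;> ring

variable {K : Type*} [Field K]

/-- The substitution attached to a change of variables and an endomorphism of the base field. -/
def substPoly (σ : K →+* K) (C : VariableChange K) : K[X][Y] →+* K[X][Y] :=
  eval₂RingHom (eval₂RingHom ((Polynomial.C.comp Polynomial.C).comp σ)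
    (.C (.C ((C.u : K) ^ 2) * X + .C C.r)))
    (.C (.C ((C.u : K) ^ 3)) * X + .C (.C ((C.u : K) ^ 2 * C.s) * X + .C C.t))

variable (σ : K →+* K) (C : VariableChange K)

lemma substPoly_X : substPoly σ C X =
    .C (.C ((C.u : K) ^ 3)) * X + .C (.C ((C.u : K) ^ 2 * C.s) * X + .C C.t) := by
  simp [substPoly]

lemma substPoly_C_X : substPoly σ C (.C X) = .C (.C ((C.u : K) ^ 2) * X + .C C.r) := by
  simp [substPoly]

lemma substPoly_C_C (c : K) : substPoly σ C (.C (.C c)) = .C (.C (σ c)) := by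
  simp [substPoly]

variable {σ C} {W W' : Affine K}

lemma substPoly_polynomial (h : C • W.map σ = W') :
    substPoly σ C W.polynomial = .C (.C ((C.u : K) ^ 6)) * W'.polynomial := by
  obtain ⟨h1, h2, h3, h4, h6⟩ := variableChange_eqs h
  simp only [map_a₁, map_a₂, map_a₃, map_a₄, map_a₆] at h1 h2 h3 h4 h6
  simp only [Affine.polynomial, map_add, map_sub, map_mul, map_pow, substPoly_X, substPoly_C_X,
    substPoly_C_C, h6, h4, h3, h2, h1, map_ofNat]
  ring

/-- The map of coordinate rings induced by a substitution. -/
def substCoord (h : C • W.map σ = W') : W.CoordinateRing →+* W'.CoordinateRing :=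
  AdjoinRoot.lift ((Affine.CoordinateRing.mk W').comp ((substPoly σ C).comp Polynomial.C))
    (Affine.CoordinateRing.mk W' (substPoly σ C X)) (by
      rw [← hom_eval₂, ← hom_eval₂, eval₂_C_X, substPoly_polynomial h, map_mul]
      exact mul_eq_zero_of_right _ AdjoinRoot.mk_self)

lemma substCoord_mk (h : C • W.map σ = W') (f : K[X][Y]) :
    substCoord h (Affine.CoordinateRing.mk W f) = Affine.CoordinateRing.mk W' (substPoly σ C f) := by
  refine (AdjoinRoot.lift_mk _ f).trans ?_
  rw [← hom_eval₂, ← hom_eval₂, eval₂_C_X]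

lemma evalEval_substPoly {x y x' y' : K} (hx : σ x = (C.u : K) ^ 2 * x' + C.r)
    (hy : σ y = (C.u : K) ^ 3 * y' + (C.u : K) ^ 2 * C.s * x' + C.t) (f : K[X][Y]) :
    (substPoly σ C f).evalEval x' y' = σ (f.evalEval x y) := by
  have h : (evalEvalRingHom x' y').comp (substPoly σ C) = σ.comp (evalEvalRingHom x y) := by
    refine ringHom_ext' (ringHom_ext' (RingHom.ext fun c => ?_) ?_) ?_
    · simp [substPoly_C_C]
    · simp [substPoly_C_X, hx]
    · simp [substPoly_X, hy]; ring
  exact RingHom.congr_fun h f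

lemma map_substCoord_pointIdeal (h : C • W.map σ = W') {x y x' y' : K} (hP : W.Nonsingular x y)
    (hP' : W'.Nonsingular x' y') (hx : σ x = (C.u : K) ^ 2 * x' + C.r)
    (hy : σ y = (C.u : K) ^ 3 * y' + (C.u : K) ^ 2 * C.s * x' + C.t) :
    (pointIdeal (.some x y hP)).map (substCoord h) = pointIdeal (.some x' y' hP') := by
  have hX : substCoord h (Affine.CoordinateRing.XClass W x) =
      Affine.CoordinateRing.mk W' (.C (.C ((C.u : K) ^ 2))) *
        Affine.CoordinateRing.XClass W' x' := by
    rw [Affine.CoordinateRing.XClass, substCoord_mk, Affine.CoordinateRing.XClass, ← map_mul]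
    congr 1
    simp only [map_sub, substPoly_C_X, substPoly_C_C, hx, C_add, C_mul]
    ring
  have hY : substCoord h (Affine.CoordinateRing.YClass W (.C y)) =
      Affine.CoordinateRing.mk W' (.C (.C ((C.u : K) ^ 3))) *
        Affine.CoordinateRing.YClass W' (.C y') +
      Affine.CoordinateRing.mk W' (.C (.C ((C.u : K) ^ 2 * C.s))) *
        Affine.CoordinateRing.XClass W' x' := by
    rw [Affine.CoordinateRing.YClass, substCoord_mk, Affine.CoordinateRing.YClass,
      Affine.CoordinateRing.XClass, ← map_mul, ← map_mul, ← map_add]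
    congr 1
    simp only [map_sub, substPoly_X, substPoly_C_C, hy, C_add, C_mul]
    ring
  have hunit : ∀ k : ℕ, ∀ z : W'.CoordinateRing,
      Affine.CoordinateRing.mk W' (.C (.C (((C.u⁻¹ : Kˣ) : K) ^ k))) *
        (Affine.CoordinateRing.mk W' (.C (.C ((C.u : K) ^ k))) * z) = z := by
    intro k z
    rw [← mul_assoc, ← map_mul, ← C_mul, ← C_mul, ← mul_pow, Units.inv_mul, one_pow, C_1, C_1,
      map_one, one_mul]
  rw [pointIdeal_some, pointIdeal_some, Affine.CoordinateRing.XYIdeal, Ideal.map_span,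
    Set.image_pair, hX, hY, Affine.CoordinateRing.XYIdeal]
  apply le_antisymm
  · rw [Ideal.span_le, Set.insert_subset_iff, Set.singleton_subset_iff]
    have h1 := Ideal.subset_span (s := {Affine.CoordinateRing.XClass W' x',
      Affine.CoordinateRing.YClass W' (.C y')}) (Set.mem_insert _ _)
    have h2 := Ideal.subset_span (s := {Affine.CoordinateRing.XClass W' x',
      Affine.CoordinateRing.YClass W' (.C y')}) (Set.mem_insert_of_mem _ rfl)
    exact ⟨Ideal.mul_mem_left _ _ h1,
      Ideal.add_mem _ (Ideal.mul_mem_left _ _ h2) (Ideal.mul_mem_left _ _ h1)⟩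
  · set I := Ideal.span {Affine.CoordinateRing.mk W' (.C (.C ((C.u : K) ^ 2))) *
      Affine.CoordinateRing.XClass W' x', Affine.CoordinateRing.mk W' (.C (.C ((C.u : K) ^ 3))) *
        Affine.CoordinateRing.YClass W' (.C y') +
      Affine.CoordinateRing.mk W' (.C (.C ((C.u : K) ^ 2 * C.s))) *
        Affine.CoordinateRing.XClass W' x'}
    rw [Ideal.span_le, Set.insert_subset_iff, Set.singleton_subset_iff]
    have h1 : Affine.CoordinateRing.XClass W' x' ∈ I := by
      rw [← hunit 2 (Affine.CoordinateRing.XClass W' x')]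
      exact Ideal.mul_mem_left _ _ (Ideal.subset_span (Set.mem_insert _ _))
    refine ⟨h1, ?_⟩
    rw [SetLike.mem_coe, ← hunit 3 (Affine.CoordinateRing.YClass W' (.C y'))]
    refine Ideal.mul_mem_left _ _ ?_
    rw [← Ideal.add_mem_iff_left I (Ideal.mul_mem_left _ _ h1)]
    exact Ideal.subset_span (Set.mem_insert_of_mem _ rfl)

/-- Transport of structure for the Weil pairing. -/
theorem IsWeilPairing.transport (h : C • W.map σ = W') (π : W.Point ≃+ W'.Point)
    (hπ : ∀ P, P ≠ 0 → σ (xCoord P) = (C.u : K) ^ 2 * xCoord (π P) + C.r ∧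
      σ (yCoord P) = (C.u : K) ^ 3 * yCoord (π P) + (C.u : K) ^ 2 * C.s * xCoord (π P) + C.t)
    {m : ℕ} {S T : W.Point} {ζ : K} (H : IsWeilPairing W m S T ζ) :
    IsWeilPairing W' m (π S) (π T) (σ ζ) := by
  obtain ⟨f, a, b, hf, hab, hS⟩ := H
  have hev : ∀ (f : K[X][Y]) P, evalPt (substPoly σ C f) (π P) = σ (evalPt f P) := by
    intro f P
    by_cases hP : P = 0
    · subst hP
      rw [_root_.map_zero]
      exact (_root_.map_zero σ).symm
    have hP' : π P ≠ 0 := by simpa using hP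
    have h1 := hπ P hP
    generalize π P = P' at *
    rcases P with _ | ⟨x, y, hP⟩
    · exact absurd rfl hP
    rcases P' with _ | ⟨x', y', hP'⟩
    · exact absurd rfl hP'
    exact evalEval_substPoly h1.1 h1.2 f
  have hI : (pointIdeal T).map (substCoord h) = pointIdeal (π T) := by
    by_cases hT : T = 0
    · subst hT
      rw [_root_.map_zero, pointIdeal_zero, pointIdeal_zero, Ideal.map_top]
    have hT' : π T ≠ 0 := by simpa using hT
    have h1 := hπ T hT
    generalize π T = T' at *
    rcases T with _ | ⟨x, y, hxy⟩
    · exact absurd rfl hT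
    rcases T' with _ | ⟨x', y', hxy'⟩
    · exact absurd rfl hT'
    exact map_substCoord_pointIdeal h hxy hxy' h1.1 h1.2
  have htend : Tendsto π.symm cofinite cofinite := π.symm.injective.tendsto_cofinite
  refine ⟨substPoly σ C f, substPoly σ C a, substPoly σ C b, ?_, ?_, ?_⟩
  · rw [← hI, ← Ideal.map_pow, ← hf, Ideal.map_span, Set.image_singleton, substCoord_mk]
  · filter_upwards [htend.eventually hab] with X hX
    obtain ⟨P, rfl⟩ := π.surjective X
    rw [AddEquiv.symm_apply_apply] at hX
    rw [← map_nsmul, hev, hev, hev, ← map_div₀, ← map_pow, hX.2]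
    exact ⟨(_root_.map_ne_zero σ).mpr hX.1, rfl⟩
  · filter_upwards [htend.eventually hS] with X hX
    obtain ⟨P, rfl⟩ := π.surjective X
    rw [AddEquiv.symm_apply_apply] at hX
    rw [← map_add, hev, hev, hev, hev, ← map_div₀, ← map_div₀, ← map_mul, hX]

end Transport

/-! ### The isomorphism of point groups attached to a change of variables -/

section ChangeOfVariables

variable {K : Type*} [Field K] {W W' : Affine K} {C : VariableChange K}

lemma exists_maps [W.IsElliptic] (h : C • W = W') (P : W.Point) : ∃ P' : W'.Point, Maps C P P' := by
  rcases P with _ | ⟨x, y, hP⟩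
  · exact ⟨.zero, trivial⟩
  obtain ⟨h1, h2, h3, h4, h6⟩ := variableChange_eqs h
  have hu : (C.u : K) ≠ 0 := C.u.ne_zero
  have hx : x = (C.u : K) ^ 2 * ((x - C.r) / (C.u : K) ^ 2) + C.r := by field_simp; ring
  have hy : y = (C.u : K) ^ 3 * ((y - C.s * (x - C.r) - C.t) / (C.u : K) ^ 3) +
      (C.u : K) ^ 2 * C.s * ((x - C.r) / (C.u : K) ^ 2) + C.t := by field_simp; ring
  set x' := (x - C.r) / (C.u : K) ^ 2
  set y' := (y - C.s * (x - C.r) - C.t) / (C.u : K) ^ 3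
  have he : W'.Equation x' y' := by
    have he := (Affine.equation_iff x y).mp hP.1
    rw [Affine.equation_iff]
    rw [hx, hy, h6, h4, h3, h2, h1] at he
    apply mul_left_cancel₀ (pow_ne_zero 6 hu)
    linear_combination he
  have : W'.IsElliptic := h ▸ inferInstanceAs (C • W).IsElliptic
  exact ⟨.some x' y' (Affine.equation_iff_nonsingular.mp he), hx, hy⟩

lemma maps_unique {P : W.Point} {P' P'' : W'.Point} (h : Maps C P P') (h' : Maps C P P'') :
    P' = P'' := by
  rcases P with _ | ⟨x, y, hP⟩ <;> rcases P' with _ | ⟨x', y', hP'⟩ <;>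
    rcases P'' with _ | ⟨x'', y'', hP''⟩ <;> simp only [Maps] at h h'
  · rfl
  · have hu : (C.u : K) ≠ 0 := C.u.ne_zero
    have hx : x' = x'' := by
      apply mul_left_cancel₀ (pow_ne_zero 2 hu)
      linear_combination h'.1 - h.1
    subst hx
    refine point_some_congr rfl ?_
    apply mul_left_cancel₀ (pow_ne_zero 3 hu)
    linear_combination h'.2 - h.2

lemma maps_unique_left {P P' : W.Point} {P'' : W'.Point} (h : Maps C P P'') (h' : Maps C P' P'') :
    P = P' := maps_unique (maps_inv h) (maps_inv h')

lemma Maps.add (h : C • W = W') {P Q : W.Point} {P' Q' : W'.Point} (hP : Maps C P P')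
    (hQ : Maps C Q Q') : Maps C (P + Q) (P' + Q') := by
  rcases P with _ | ⟨x₁, y₁, h₁⟩ <;> rcases P' with _ | ⟨x₁', y₁', h₁'⟩
  · exact (zero_add Q).symm ▸ (zero_add Q').symm ▸ hQ
  · exact hP.elim
  · exact hP.elim
  rcases Q with _ | ⟨x₂, y₂, h₂⟩ <;> rcases Q' with _ | ⟨x₂', y₂', h₂'⟩
  · exact hP
  · exact hQ.elim
  · exact hQ.elim
  obtain ⟨rfl, rfl⟩ := hP
  obtain ⟨rfl, rfl⟩ := hQ
  obtain ⟨e1, e2, e3, e4, e6⟩ := variableChange_eqs h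
  have hu : (C.u : K) ≠ 0 := C.u.ne_zero
  have hX : (C.u : K) ^ 2 * x₁' + C.r = (C.u : K) ^ 2 * x₂' + C.r ↔ x₁' = x₂' := by
    rw [add_left_inj, mul_right_inj' (pow_ne_zero 2 hu)]
  have hYn : ∀ x y : K, W.negY ((C.u : K) ^ 2 * x + C.r)
      ((C.u : K) ^ 3 * y + (C.u : K) ^ 2 * C.s * x + C.t) =
      (C.u : K) ^ 3 * W'.negY x y + (C.u : K) ^ 2 * C.s * x + C.t := by
    intro x y
    rw [Affine.negY, Affine.negY, e3, e1]; ring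
  by_cases hxy' : x₁' = x₂' ∧ y₁' = W'.negY x₂' y₂'
  · rw [Affine.Point.add_of_Y_eq hxy'.1 hxy'.2, Affine.Point.add_of_Y_eq (hX.mpr hxy'.1) (by
      rw [hYn, ← hxy'.2, hxy'.1])]
    trivial
  have hxy : ¬((C.u : K) ^ 2 * x₁' + C.r = (C.u : K) ^ 2 * x₂' + C.r ∧
      (C.u : K) ^ 3 * y₁' + (C.u : K) ^ 2 * C.s * x₁' + C.t =
      W.negY ((C.u : K) ^ 2 * x₂' + C.r)
        ((C.u : K) ^ 3 * y₂' + (C.u : K) ^ 2 * C.s * x₂' + C.t)) := by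
    rintro ⟨hx, hy⟩
    have hx := hX.mp hx
    subst hx
    rw [hYn, add_left_inj, add_left_inj, mul_right_inj' (pow_ne_zero 3 hu)] at hy
    exact hxy' ⟨rfl, hy⟩
  rw [Affine.Point.add_some hxy, Affine.Point.add_some hxy']
  -- Slopes transform as l = u l' + s for chords and tangents alike. The addition formulas then
  -- match by expansion.
  have hsl : W.slope ((C.u : K) ^ 2 * x₁' + C.r) ((C.u : K) ^ 2 * x₂' + C.r)
      ((C.u : K) ^ 3 * y₁' + (C.u : K) ^ 2 * C.s * x₁' + C.t)
      ((C.u : K) ^ 3 * y₂' + (C.u : K) ^ 2 * C.s * x₂' + C.t) =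
      C.u * W'.slope x₁' x₂' y₁' y₂' + C.s := by
    by_cases hx : x₁' = x₂'
    · have hY' : y₁' ≠ W'.negY x₂' y₂' := fun hy => hxy' ⟨hx, hy⟩
      have hyy := Affine.Y_eq_of_Y_ne h₁'.1 h₂'.1 hx hY'
      subst hx hyy
      have hY : (C.u : K) ^ 3 * y₁' + (C.u : K) ^ 2 * C.s * x₁' + C.t ≠
        W.negY ((C.u : K) ^ 2 * x₁' + C.r)
        ((C.u : K) ^ 3 * y₁' + (C.u : K) ^ 2 * C.s * x₁' + C.t) := fun hy => hxy ⟨rfl, hy⟩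
      rw [Affine.slope_of_Y_ne rfl hY', Affine.slope_of_Y_ne rfl hY, hYn, e4, e3, e2, e1]
      have h0 := sub_ne_zero.mpr hY'
      have h0' : (C.u : K) ^ 3 * y₁' + (C.u : K) ^ 2 * C.s * x₁' + C.t -
        ((C.u : K) ^ 3 * W'.negY x₁' y₁' + (C.u : K) ^ 2 * C.s * x₁' + C.t) ≠ 0 := by
        have := mul_ne_zero (pow_ne_zero 3 hu) h0
        intro h; apply this; linear_combination h
      rw [div_eq_iff h0']
      have h5 := mul_div_cancel₀ (3 * x₁' ^ 2 + 2 * W'.a₂ * x₁' + W'.a₄ - W'.a₁ * y₁') h0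
      set sl := (3 * x₁' ^ 2 + 2 * W'.a₂ * x₁' + W'.a₄ - W'.a₁ * y₁') / (y₁' - W'.negY x₁' y₁')
      rw [Affine.negY] at h5 ⊢
      linear_combination -(C.u : K) ^ 4 * h5
    · rw [Affine.slope_of_X_ne hx, Affine.slope_of_X_ne (hX.not.mpr hx)]
      have h0 := sub_ne_zero.mpr hx
      have h0' := sub_ne_zero.mpr (hX.not.mpr hx)
      rw [div_eq_iff h0']
      have h5 := mul_div_cancel₀ (y₁' - y₂') h0
      set sl := (y₁' - y₂') / (x₁' - x₂')
      linear_combination -(C.u : K) ^ 3 * h5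
  simp only [Maps, hsl, Affine.addX, Affine.addY, Affine.negAddY, Affine.negY, e3, e2, e1]
  constructor <;> ring

/-- The isomorphism of groups of points attached to a change of variables. -/
def mapsEquiv [W.IsElliptic] (h : C • W = W') : W.Point ≃+ W'.Point :=
  AddEquiv.ofBijective (AddMonoidHom.mk' (fun P => (exists_maps h P).choose) (fun P Q =>
    maps_unique (exists_maps h (P + Q)).choose_spec
      ((exists_maps h P).choose_spec.add h (exists_maps h Q).choose_spec)))
    ⟨fun P Q hPQ => by
      have h1 := (exists_maps h P).choose_spec
      have h2 := (exists_maps h Q).choose_spec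
      have h3 : (exists_maps h P).choose = (exists_maps h Q).choose := hPQ
      rw [h3] at h1
      exact maps_unique_left h1 h2, fun P' => by
      have : W'.IsElliptic := h ▸ inferInstanceAs (C • W).IsElliptic
      have h' : C⁻¹ • W' = W := by rw [← h, inv_smul_smul]
      obtain ⟨P, hP⟩ := exists_maps h' P'
      have hP' := maps_inv hP
      rw [inv_inv] at hP'
      exact ⟨P, maps_unique (exists_maps h P).choose_spec hP'⟩⟩

lemma maps_mapsEquiv [W.IsElliptic] (h : C • W = W') (P : W.Point) : Maps C P (mapsEquiv h P) :=
  (exists_maps h P).choose_spec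

lemma IsWeilPairing.variableChange [W.IsElliptic] (h : C • W = W') {m : ℕ} {S T : W.Point} {ζ : K}
    (H : IsWeilPairing W m S T ζ) : IsWeilPairing W' m (mapsEquiv h S) (mapsEquiv h T) ζ := by
  refine IsWeilPairing.transport (σ := RingHom.id K) (C := C) ((congrArg (C • ·) (WeierstrassCurve.map_id W)).trans h)
    (mapsEquiv h) (fun P hP => ?_) H
  have h1 := maps_mapsEquiv h P
  have hP' : mapsEquiv h P ≠ 0 := by simpa using hP
  generalize mapsEquiv h P = P' at *
  rcases P with _ | ⟨x, y, hP⟩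
  · exact absurd rfl hP
  rcases P' with _ | ⟨x', y', hP'⟩
  · exact absurd rfl hP'
  exact h1

end ChangeOfVariables

/-! ### Galois equivariance of the pairing -/

section Galois

variable {F K : Type*} [Field F] [Field K] [Algebra F K] {E : WeierstrassCurve F}

/-- The action of an automorphism on points. -/
def galEquiv (E : WeierstrassCurve F) (σ : K ≃ₐ[F] K) :
    (E.baseChange K).toAffine.Point ≃+ (E.baseChange K).toAffine.Point :=
  AddEquiv.ofBijective (Affine.Point.map (W' := E) (σ : K →ₐ[F] K))
    ⟨Affine.Point.map_injective _, fun P => ⟨Affine.Point.map (W' := E) (σ.symm : K →ₐ[F] K) P, by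
      rw [Affine.Point.map_map]
      rcases P with _ | ⟨x, y, h⟩
      · rfl
      · exact point_some_congr (σ.apply_symm_apply x) (σ.apply_symm_apply y)⟩⟩

lemma xCoord_galEquiv (σ : K ≃ₐ[F] K) (P : (E.baseChange K).toAffine.Point) :
    xCoord (galEquiv E σ P) = σ (xCoord P) := by
  rcases P with _ | ⟨x, y, h⟩
  · exact (map_zero σ).symm
  · rfl

lemma yCoord_galEquiv (σ : K ≃ₐ[F] K) (P : (E.baseChange K).toAffine.Point) :
    yCoord (galEquiv E σ P) = σ (yCoord P) := by
  rcases P with _ | ⟨x, y, h⟩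
  · exact (map_zero σ).symm
  · rfl

lemma galEquiv_pointHom (σ : K ≃ₐ[F] K) (P : E.toAffine.Point) :
    galEquiv E σ (pointHom K E P) = pointHom K E P := by
  rcases P with _ | ⟨x, y, h⟩
  · rfl
  · exact point_some_congr (σ.commutes x) (σ.commutes y)

lemma IsWeilPairing.galois (σ : K ≃ₐ[F] K) {m : ℕ} {S T : (E.baseChange K).toAffine.Point} {ζ : K}
    (H : IsWeilPairing (E.baseChange K).toAffine m S T ζ) :
    IsWeilPairing (E.baseChange K).toAffine m (galEquiv E σ S) (galEquiv E σ T) (σ ζ) := by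
  refine IsWeilPairing.transport (σ := (σ : K →+* K)) (C := 1) ?_ (galEquiv E σ) (fun P _ => ?_) H
  · rw [one_smul]
    refine (WeierstrassCurve.map_map E _ _).trans ?_
    congr 1
    exact RingHom.ext fun x => σ.commutes x
  · rw [xCoord_galEquiv, yCoord_galEquiv]
    simp [VariableChange.one_def]

end Galois

end EllCount

end

noncomputable section
namespace EllCount
open WeierstrassCurve Polynomial Filter
open scoped Classical Polynomial.Bivariate

set_option linter.unusedSectionVars false

/-! ### Fixed points of Frobenius in an orbit -/

section Counting

lemma card_eq_mul_of_fiber {α β κ : Type*} (f : α → β)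
    (h : ∀ b, Nonempty ({a // f a = b} ≃ κ)) : Nat.card α = Nat.card β * Nat.card κ := by
  rw [← Nat.card_prod]
  exact Nat.card_congr ((Equiv.sigmaFiberEquiv f).symm.trans
    ((Equiv.sigmaCongrRight fun b => (h b).some).trans (Equiv.sigmaEquivProd β κ)))

/-- The number of rational points of an orbit, when the group satisfies Lang's theorem. -/
theorem card_fixed_orbit {G Ω : Type*} [Group G] [MulAction G Ω] (σ : G →* G) (τ : Ω → Ω)
    (hτ : ∀ g x, τ (g • x) = σ g • τ x) (lang : ∀ h, ∃ g, σ g = g * h) {x : Ω} (hx : τ x = x)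
    [Finite (MulAction.stabilizer G x)] :
    Nat.card {y // y ∈ MulAction.orbit G x ∧ τ y = y} = Nat.card {g // σ g = g} := by
  set H := MulAction.stabilizer G x with hH
  have hfix : ∀ g, τ (g • x) = g • x ↔ g⁻¹ * σ g ∈ H := by
    intro g
    rw [hτ, hx, MulAction.mem_stabilizer_iff, mul_smul, inv_smul_eq_iff]
  -- The elements g with g⁻¹σ(g) ∈ H are counted twice. The map g ↦ g·x sends them onto the fixed
  -- points of the orbit, with cosets of H as fibres. By Lang's theorem g ↦ g⁻¹σ(g) sends them onto
  -- H, and its fibres are translates of the fixed subgroup.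
  have h1 : Nat.card {g // g⁻¹ * σ g ∈ H} =
      Nat.card {y // y ∈ MulAction.orbit G x ∧ τ y = y} * Nat.card H := by
    refine card_eq_mul_of_fiber (fun g => ⟨g.1 • x, ⟨g.1, rfl⟩, (hfix g.1).mpr g.2⟩) ?_
    rintro ⟨_, ⟨g₀, rfl⟩, h0⟩
    refine ⟨⟨fun g => ⟨g₀⁻¹ * g.1.1, ?_⟩, fun h => ⟨⟨g₀ * h, ?_⟩, ?_⟩, fun g => ?_, fun h => ?_⟩⟩
    · have := congrArg Subtype.val g.2
      rw [MulAction.mem_stabilizer_iff, mul_smul, inv_smul_eq_iff]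
      exact this
    · rw [← hfix, mul_smul, MulAction.mem_stabilizer_iff.mp h.2]
      exact h0
    · apply Subtype.ext
      change (g₀ * (h : G)) • x = g₀ • x
      rw [mul_smul, MulAction.mem_stabilizer_iff.mp h.2]
    · exact Subtype.ext (Subtype.ext (mul_inv_cancel_left _ _))
    · exact Subtype.ext (inv_mul_cancel_left _ _)
  have h2 : Nat.card {g // g⁻¹ * σ g ∈ H} = Nat.card H * Nat.card {g // σ g = g} := by
    refine card_eq_mul_of_fiber (fun g => ⟨g.1⁻¹ * σ g.1, g.2⟩) ?_
    rintro ⟨h, hh⟩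
    obtain ⟨g₀, hg₀⟩ := lang h
    have hg₀' : g₀⁻¹ * σ g₀ = h := by rw [hg₀, inv_mul_cancel_left]
    refine ⟨⟨fun g => ⟨g.1.1 * g₀⁻¹, ?_⟩, fun g => ⟨⟨g.1 * g₀, ?_⟩, ?_⟩, fun g => ?_, fun g => ?_⟩⟩
    · have := congrArg Subtype.val g.2
      have h3 : g.1.1⁻¹ * σ g.1.1 = h := this
      rw [inv_mul_eq_iff_eq_mul] at h3
      rw [map_mul, map_inv, h3, hg₀]
      group
    · rw [map_mul, g.2, mul_inv_rev, mul_assoc, inv_mul_cancel_left, hg₀']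
      exact hh
    · apply Subtype.ext
      change (g.1 * g₀)⁻¹ * σ (g.1 * g₀) = h
      rw [map_mul, g.2, mul_inv_rev, mul_assoc, inv_mul_cancel_left, hg₀']
    · exact Subtype.ext (Subtype.ext (inv_mul_cancel_right _ _))
    · exact Subtype.ext (mul_inv_cancel_right _ _)
  rw [h1, mul_comm] at h2
  exact mul_left_cancel₀ Nat.card_pos.ne' h2

end Counting

/-! ### Lang's theorem for changes of variables -/

section Lang

variable {K : Type*} [Field K] [IsAlgClosed K]

lemma exists_pow_eq_mul_add {q : ℕ} (hq : 1 < q) (a b : K) : ∃ x : K, x ^ q = a * x + b := by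
  obtain ⟨x, hx⟩ := IsAlgClosed.exists_root (X ^ q - (C a * X + C b)) (by
    have h1 : (C a * X + C b : K[X]).degree < (X ^ q : K[X]).degree := by
      rw [degree_X_pow]
      exact degree_linear_le.trans_lt (by exact_mod_cast hq)
    rw [degree_sub_eq_left_of_degree_lt h1, degree_X_pow]
    exact_mod_cast (by omega : q ≠ 0))
  refine ⟨x, ?_⟩
  have : x ^ q - (a * x + b) = 0 := by simpa [IsRoot] using hx
  linear_combination this

/-- Lang's theorem for the group of changes of variables. -/
theorem exists_mapHom_eq_mul {q : ℕ} (hq : 1 < q) (φ : K →+* K) (hφ : ∀ x, φ x = x ^ q)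
    (h : VariableChange K) : ∃ g, VariableChange.mapHom φ g = g * h := by
  -- In the parameters u, r, s, t the equation is triangular: a Kummer equation for u, then
  -- equations x^q = ax + b for r, s and t, the last depending on r.
  obtain ⟨u, hu⟩ := IsAlgClosed.exists_pow_nat_eq (h.u : K) (n := q - 1) (by omega)
  have hu0 : u ≠ 0 := by
    rintro rfl
    rw [zero_pow (by omega)] at hu
    exact h.u.ne_zero hu.symm
  obtain ⟨r, hr⟩ := exists_pow_eq_mul_add hq ((h.u : K) ^ 2) h.r
  obtain ⟨s, hs⟩ := exists_pow_eq_mul_add hq (h.u : K) h.s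
  obtain ⟨t, ht⟩ := exists_pow_eq_mul_add hq ((h.u : K) ^ 3) (r * h.s * (h.u : K) ^ 2 + h.t)
  refine ⟨⟨Units.mk0 u hu0, r, s, t⟩, ?_⟩
  rw [VariableChange.mul_def]
  change VariableChange.map _ φ = _
  ext
  · change φ u = u * h.u
    rw [hφ, ← hu, ← pow_succ', Nat.sub_add_cancel hq.le]
  · change φ r = _
    rw [hφ, hr]; ring
  · change φ s = _
    rw [hφ, hs]
  · change φ t = _
    rw [hφ, ht]; ring

end Lang

/-! ### Automorphism groups of elliptic curves are finite -/

section Stabilizer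

variable {K : Type*} [Field K]

lemma finite_roots {p : K[X]} (hp : p ≠ 0) : {x | p.eval x = 0}.Finite :=
  (p.roots.toFinset.finite_toSet).subset fun x hx => by
    simpa [hp] using hx

lemma finite_quadratic (b c : K) : {x : K | x ^ 2 + b * x + c = 0}.Finite := by
  have hp : (X ^ 2 + C b * X + C c : K[X]).Monic := by monicity!
  simpa using finite_roots hp.ne_zero

lemma finite_cubic (b c d : K) : {x : K | x ^ 3 + b * x ^ 2 + c * x + d = 0}.Finite := by
  have hp : (X ^ 3 + C b * X ^ 2 + C c * X + C d : K[X]).Monic := by monicity!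
  simpa using finite_roots hp.ne_zero

lemma finite_quartic (b c d : K) : {x : K | x ^ 4 + b * x ^ 2 + c * x + d = 0}.Finite := by
  have hp : (X ^ 4 + C b * X ^ 2 + C c * X + C d : K[X]).Monic := by monicity!
  simpa using finite_roots hp.ne_zero

lemma finite_of_finite_values {α β : Type*} {s : Set α} (f : α → β) {v : Set β} (hv : v.Finite)
    (hf : ∀ a ∈ s, f a ∈ v) (h : ∀ b, (s ∩ {a | f a = b}).Finite) : s.Finite :=
  Set.Finite.of_finite_fibers f (hv.subset (by rintro _ ⟨a, ha, rfl⟩; exact hf a ha))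
    fun b _ => h b

/-- Invariance of the discriminant gives u¹² = 1. Then s, r and t, in this order, satisfy nontrivial
equations whose shape depends on whether the characteristic is 2 or 3. Finiteness is needed to
cancel the order of the stabiliser in the orbit count. -/
theorem finite_stabilizer (W : WeierstrassCurve K) [W.IsElliptic] :
    Finite (MulAction.stabilizer (VariableChange K) W) := by
  have h12 : ∀ C ∈ (MulAction.stabilizer (VariableChange K) W : Set (VariableChange K)),
      (C.u : K) ^ 12 = 1 := by
    intro C hC
    have h1 := variableChange_Δ W C
    rw [MulAction.mem_stabilizer_iff.mp hC] at h1
    have h2 := W.isUnit_Δ.ne_zero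
    have h3 : ((C.u⁻¹ : Kˣ) : K) ^ 12 = 1 := mul_right_cancel₀ h2 (by rw [← h1, one_mul])
    rw [Units.val_inv_eq_inv_val, inv_pow, inv_eq_one] at h3
    exact h3
  have hu : {x : K | x ^ 12 = 1}.Finite := by
    have := finite_roots (X_pow_sub_C_ne_zero (by norm_num : 0 < 12) (1 : K))
    simpa [sub_eq_zero] using this
  refine finite_of_finite_values (fun C : VariableChange K => (C.u : K)) hu h12 fun u => ?_
  have hE := fun C (hC : C ∈ (MulAction.stabilizer (VariableChange K) W : Set (VariableChange K))) =>
    variableChange_eqs (MulAction.mem_stabilizer_iff.mp hC)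
  have hs : ∃ v : Set K, v.Finite ∧ ∀ C ∈ (MulAction.stabilizer (VariableChange K) W : Set (VariableChange K)) ∩
      {C | (C.u : K) = u}, C.s ∈ v := by
    -- In characteristic 2, if a₁ = 0 the a₂-equation gives r in terms of s and the a₄-equation
    -- becomes a monic quartic in s. If a₁ ≠ 0 the a₃-equation fixes r and the a₂-equation is
    -- quadratic in s.
    by_cases h2 : (2 : K) = 0
    · by_cases ha : W.a₁ = 0
      · refine ⟨_, finite_quartic (2 * (u ^ 2 - 1) * W.a₂) W.a₃
          (((u ^ 2 - 1) * W.a₂) ^ 2 + (u ^ 4 - 1) * W.a₄), ?_⟩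
        rintro C ⟨hC, rfl⟩
        obtain ⟨e1, e2, e3, e4, e6⟩ := hE C hC
        simp only [ha] at e1 e2 e3 e4 e6
        rw [Set.mem_ofPred_eq]
        have hr : C.r = C.s ^ 2 + ((C.u : K) ^ 2 - 1) * W.a₂ := by
          linear_combination e2 - C.r * h2
        linear_combination e4 - (C.r + C.s ^ 2 + ((C.u : K) ^ 2 - 1) * W.a₂) * hr +
          (-C.r ^ 2 + C.s * W.a₃ + ((C.u : K) ^ 4 - 1) * W.a₄ - C.r * W.a₂ + C.s * C.t) * h2
      · refine ⟨_, finite_quadratic W.a₁ ((u ^ 2 - 1) * W.a₂ - (u ^ 3 - 1) * W.a₃ / W.a₁), ?_⟩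
        rintro C ⟨hC, rfl⟩
        obtain ⟨e1, e2, e3, e4, e6⟩ := hE C hC
        rw [Set.mem_ofPred_eq]
        have hr : C.r = ((C.u : K) ^ 3 - 1) * W.a₃ / W.a₁ := by
          rw [eq_div_iff ha]
          linear_combination e3 - C.t * h2
        rw [← hr]
        linear_combination -e2 + C.r * h2
    · refine ⟨{(u - 1) * W.a₁ / 2}, Set.finite_singleton _, ?_⟩
      rintro C ⟨hC, rfl⟩
      obtain ⟨e1, -⟩ := hE C hC
      rw [Set.mem_singleton_iff, eq_div_iff h2]
      linear_combination e1
  obtain ⟨v, hv, hs⟩ := hs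
  refine finite_of_finite_values (fun C : VariableChange K => C.s) hv hs fun s => ?_
  have hr : ∃ v : Set K, v.Finite ∧ ∀ C ∈ ((MulAction.stabilizer (VariableChange K) W : Set (VariableChange K)) ∩
      {C | (C.u : K) = u}) ∩ {C | C.s = s}, C.r ∈ v := by
    by_cases h3 : (3 : K) = 0
    · have h2 : (2 : K) ≠ 0 := fun h => one_ne_zero (α := K) (by linear_combination h3 - h)
      refine ⟨_, finite_cubic (W.a₂ + W.a₁ ^ 2 / 4) (W.a₄ + W.a₁ * W.a₃ / 2)
        (W.a₆ - u ^ 6 * W.a₆ + W.a₃ ^ 2 * (1 - u ^ 6) / 4), ?_⟩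
      rintro C ⟨⟨hC, rfl⟩, -⟩
      obtain ⟨e1, e2, e3, e4, e6⟩ := hE C hC
      rw [Set.mem_ofPred_eq]
      have ht : C.t = (((C.u : K) ^ 3 - 1) * W.a₃ - C.r * W.a₁) / 2 := by
        rw [eq_div_iff h2]
        linear_combination e3
      rw [ht] at e6
      have h4 : (4 : K) ≠ 0 := by
        intro h; apply mul_ne_zero h2 h2; linear_combination h
      field_simp at e6 ⊢
      linear_combination 2 * e6
    · refine ⟨{(u ^ 2 * W.a₂ - W.a₂ + s * W.a₁ + s ^ 2) / 3}, Set.finite_singleton _, ?_⟩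
      rintro C ⟨⟨hC, rfl⟩, rfl⟩
      obtain ⟨e1, e2, -⟩ := hE C hC
      rw [Set.mem_singleton_iff, eq_div_iff h3]
      linear_combination e2
  obtain ⟨v, hv, hr⟩ := hr
  refine finite_of_finite_values (fun C : VariableChange K => C.r) hv hr fun r => ?_
  refine finite_of_finite_values (fun C : VariableChange K => C.t)
    (finite_quadratic (W.a₃ + r * W.a₁)
      (u ^ 6 * W.a₆ - W.a₆ - r * W.a₄ - r ^ 2 * W.a₂ - r ^ 3)) ?_ fun t => ?_
  · rintro C ⟨⟨⟨hC, rfl⟩, rfl⟩, rfl⟩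
    obtain ⟨e1, e2, e3, e4, e6⟩ := hE C hC
    rw [Set.mem_ofPred_eq]
    linear_combination -e6
  · refine Set.Subsingleton.finite ?_
    rintro C ⟨⟨⟨⟨-, h1⟩, h2⟩, h3⟩, h4⟩ C' ⟨⟨⟨⟨-, h1'⟩, h2'⟩, h3'⟩, h4'⟩
    simp only [Set.mem_ofPred_eq] at h1 h2 h3 h4 h1' h2' h3' h4'
    exact VariableChange.ext (Units.ext (h1.trans h1'.symm)) (h3.trans h3'.symm)
      (h2.trans h2'.symm) (h4.trans h4'.symm)

end Stabilizer

end EllCount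

end

noncomputable section
namespace EllCount
open WeierstrassCurve Polynomial Filter
open scoped Classical Polynomial.Bivariate

set_option linter.unusedSectionVars false

/-! ### Coordinates detached from curves, with the action of changes of variables -/

section RawPoints

/-- A pair of coordinates. -/
@[ext]
structure AffPt (K : Type*) where
  x : K
  y : K

variable {K : Type*} [Field K]

/-- Detaching the coordinates from the curve puts all triples into one fixed set on which the group
acts, as the orbit count requires. -/
instance : SMul (VariableChange K) (AffPt K) where
  smul C p := ⟨(p.x - C.r) / (C.u : K) ^ 2, (p.y - C.s * (p.x - C.r) - C.t) / (C.u : K) ^ 3⟩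

lemma affPt_smul_def (C : VariableChange K) (p : AffPt K) : C • p =
    ⟨(p.x - C.r) / (C.u : K) ^ 2, (p.y - C.s * (p.x - C.r) - C.t) / (C.u : K) ^ 3⟩ := rfl

lemma affPt_smul_eq_iff (C : VariableChange K) (p p' : AffPt K) : C • p = p' ↔
    p.x = (C.u : K) ^ 2 * p'.x + C.r ∧
      p.y = (C.u : K) ^ 3 * p'.y + (C.u : K) ^ 2 * C.s * p'.x + C.t := by
  have hu : (C.u : K) ≠ 0 := C.u.ne_zero
  rw [affPt_smul_def, AffPt.ext_iff]
  dsimp only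
  rw [div_eq_iff (pow_ne_zero 2 hu), div_eq_iff (pow_ne_zero 3 hu)]
  constructor
  · rintro ⟨h1, h2⟩
    exact ⟨by linear_combination h1, by linear_combination h2 + C.s * h1⟩
  · rintro ⟨h1, h2⟩
    exact ⟨by linear_combination h1, by linear_combination h2 - C.s * h1⟩

instance : MulAction (VariableChange K) (AffPt K) where
  one_smul p := by
    rw [affPt_smul_eq_iff]
    simp [VariableChange.one_def]
  mul_smul C C' p := by
    obtain ⟨h1, h2⟩ := (affPt_smul_eq_iff C' p (C' • p)).mp rfl
    obtain ⟨h3, h4⟩ := (affPt_smul_eq_iff C (C' • p) (C • C' • p)).mp rfl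
    rw [affPt_smul_eq_iff, h1, h2, h3, h4, VariableChange.mul_def]
    simp only [Units.val_mul]
    constructor <;> ring

/-- The coordinates of a point. -/
def raw {W : Affine K} : W.Point → Option (AffPt K)
  | .zero => none
  | .some x y _ => some ⟨x, y⟩

lemma raw_injective {W : Affine K} : Function.Injective (raw (W := W)) := by
  rintro (_ | ⟨x, y, h⟩) (_ | ⟨x', y', h'⟩) hh
  · rfl
  · cases hh
  · cases hh
  · simp only [raw, Option.some.injEq, AffPt.mk.injEq] at hh
    exact point_some_congr hh.1 hh.2

lemma maps_iff_raw {W W' : Affine K} {C : VariableChange K} {P : W.Point} {P' : W'.Point} :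
    Maps C P P' ↔ C • raw P = raw P' := by
  rcases P with _ | ⟨x, y, h⟩ <;> rcases P' with _ | ⟨x', y', h'⟩
  · exact iff_of_true trivial rfl
  · exact iff_of_false id (fun h => by cases h)
  · exact iff_of_false id (fun h => by cases h)
  · simp only [Maps, raw, Option.smul_some, Option.some.injEq, affPt_smul_eq_iff]

instance {F : Type*} [Field F] [Finite F] (W : Affine F) : Finite W.Point := by
  have : Finite (AffPt F) := Finite.of_injective (fun p : AffPt F => (p.x, p.y)) (fun p p' h => by
    simp only [Prod.mk.injEq] at h
    exact AffPt.ext h.1 h.2)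
  exact Finite.of_injective raw raw_injective

instance {F : Type*} [Field F] [Finite F] : Finite (WeierstrassCurve F) :=
  Finite.of_injective (fun W : WeierstrassCurve F => (W.a₁, W.a₂, W.a₃, W.a₄, W.a₆))
    (fun W W' h => by
      simp only [Prod.mk.injEq] at h
      exact WeierstrassCurve.ext h.1 h.2.1 h.2.2.1 h.2.2.2.1 h.2.2.2.2)

instance {F : Type*} [Field F] [Finite F] : Finite (VariableChange F) :=
  Finite.of_injective (fun C : VariableChange F => (C.u, C.r, C.s, C.t))
    (fun C C' h => by
      simp only [Prod.mk.injEq] at h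
      exact VariableChange.ext h.1 h.2.1 h.2.2.1 h.2.2.2)

end RawPoints

/-! ### Frobenius on configurations and descent to the finite field -/

section Frobenius

variable {F : Type*} [Field F] [Finite F] {K : Type*} [Field K] [Algebra F K]

lemma mem_range_of_pow_card_eq {x : K} (h : x ^ Nat.card F = x) : ∃ a : F, algebraMap F K a = x := by
  have := Fintype.ofFinite F
  rw [Nat.card_eq_fintype_card] at h
  have h1 : (X ^ Fintype.card F - X : F[X]).natDegree = Fintype.card F :=
    FiniteField.X_pow_card_sub_X_natDegree_eq F Fintype.one_lt_card
  have hm : (X ^ Fintype.card F - X : F[X]).Monic :=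
    monic_X_pow_sub (by rw [degree_X]; exact_mod_cast Fintype.one_lt_card)
  have h2 := prod_multiset_X_sub_C_of_monic_of_roots_card_eq hm (by
    rw [h1, FiniteField.roots_X_pow_card_sub_X]; rfl)
  have h3 := congrArg (fun p : F[X] => aeval x p) h2
  simp only [FiniteField.roots_X_pow_card_sub_X, map_sub, map_pow, aeval_X, h, sub_self,
    map_multiset_prod, Multiset.map_map, Function.comp_def, aeval_C] at h3
  rw [Multiset.prod_eq_zero_iff, Multiset.mem_map] at h3
  obtain ⟨a, -, ha⟩ := h3
  exact ⟨a, (sub_eq_zero.mp ha).symm⟩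

variable (F K) in
/-- The `q`-power Frobenius automorphism. -/
def frob [Algebra.IsAlgebraic F K] : K ≃ₐ[F] K :=
  letI := Fintype.ofFinite F
  FiniteField.frobeniusAlgEquivOfAlgebraic F K

lemma frob_apply [Algebra.IsAlgebraic F K] (x : K) : frob F K x = x ^ Nat.card F := by
  let := Fintype.ofFinite F
  rw [Nat.card_eq_fintype_card]
  rfl

lemma exists_of_frob_eq [Algebra.IsAlgebraic F K] {x : K} (h : frob F K x = x) :
    ∃ a : F, algebraMap F K a = x :=
  mem_range_of_pow_card_eq ((frob_apply x).symm.trans h)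

variable [Algebra.IsAlgebraic F K]

lemma card_mapHom_fixed : Nat.card {g : VariableChange K //
    VariableChange.mapHom ((frob F K : K →ₐ[F] K) : K →+* K) g = g} =
      Nat.card (VariableChange F) := by
  have key : ∀ g : VariableChange F, VariableChange.mapHom ((frob F K : K →ₐ[F] K) : K →+* K)
      (VariableChange.mapHom (algebraMap F K) g) = VariableChange.mapHom (algebraMap F K) g := by
    intro g
    change VariableChange.map (VariableChange.map g _) _ = VariableChange.map g _
    rw [VariableChange.map_map]
    congr 1
    exact RingHom.ext fun x => (frob F K).commutes x
  refine (Nat.card_congr (Equiv.ofBijective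
    (fun g => ⟨VariableChange.mapHom (algebraMap F K) g, key g⟩) ⟨?_, ?_⟩)).symm
  · intro C C' h
    exact VariableChange.map_injective (algebraMap F K).injective (congrArg Subtype.val h)
  · rintro ⟨⟨u, r, s, t⟩, h⟩
    obtain ⟨r, rfl⟩ := exists_of_frob_eq (F := F) (congrArg VariableChange.r h)
    obtain ⟨s, rfl⟩ := exists_of_frob_eq (F := F) (congrArg VariableChange.s h)
    obtain ⟨t, rfl⟩ := exists_of_frob_eq (F := F) (congrArg VariableChange.t h)
    obtain ⟨v, hv⟩ := exists_of_frob_eq (F := F)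
      (congrArg (fun C : VariableChange K => (C.u : K)) h)
    have hv0 : v ≠ 0 := by
      rintro rfl
      rw [map_zero] at hv
      exact u.ne_zero hv.symm
    exact ⟨⟨Units.mk0 v hv0, r, s, t⟩, Subtype.ext (VariableChange.ext (Units.ext hv) rfl rfl rfl)⟩

/-- Curves with two pairs of coordinates. -/
abbrev Config (K : Type*) : Type _ := WeierstrassCurve K × Option (AffPt K) × Option (AffPt K)

/-- Base change of pairs of coordinates. -/
def AffPt.map (φ : K →+* K) (p : AffPt K) : AffPt K := ⟨φ p.x, φ p.y⟩

/-- Base change of configurations. -/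
def Config.map (φ : K →+* K) (c : Config K) : Config K :=
  (c.1.map φ, c.2.1.map (AffPt.map φ), c.2.2.map (AffPt.map φ))

lemma option_map_smul (φ : K →+* K) (C : VariableChange K) (p : Option (AffPt K)) :
    (C • p).map (AffPt.map φ) = VariableChange.mapHom φ C • p.map (AffPt.map φ) := by
  rcases p with _ | p
  · rfl
  · simp only [Option.smul_some, Option.map_some, Option.some.injEq]
    change _ = VariableChange.map C φ • _
    simp [AffPt.map, affPt_smul_def, VariableChange.map]

lemma Config.map_smul (φ : K →+* K) (C : VariableChange K) (c : Config K) :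
    (C • c).map φ = VariableChange.mapHom φ C • c.map φ := by
  refine Prod.ext ?_ (Prod.ext (option_map_smul φ C c.2.1) (option_map_smul φ C c.2.2))
  exact (map_variableChange c.1 C φ).symm

lemma exists_baseChange_of_frob {W : WeierstrassCurve K}
    (h : W.map ((frob F K : K →ₐ[F] K) : K →+* K) = W) :
    ∃ E : WeierstrassCurve F, E.baseChange K = W := by
  obtain ⟨a₁, a₂, a₃, a₄, a₆⟩ := W
  obtain ⟨a₁, rfl⟩ := exists_of_frob_eq (F := F) (congrArg WeierstrassCurve.a₁ h)
  obtain ⟨a₂, rfl⟩ := exists_of_frob_eq (F := F) (congrArg WeierstrassCurve.a₂ h)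
  obtain ⟨a₃, rfl⟩ := exists_of_frob_eq (F := F) (congrArg WeierstrassCurve.a₃ h)
  obtain ⟨a₄, rfl⟩ := exists_of_frob_eq (F := F) (congrArg WeierstrassCurve.a₄ h)
  obtain ⟨a₆, rfl⟩ := exists_of_frob_eq (F := F) (congrArg WeierstrassCurve.a₆ h)
  exact ⟨⟨a₁, a₂, a₃, a₄, a₆⟩, rfl⟩

lemma exists_pointHom_of_raw {E : WeierstrassCurve F} {P : (E.baseChange K).toAffine.Point}
    (h : (raw P).map (AffPt.map ((frob F K : K →ₐ[F] K) : K →+* K)) = raw P) :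
    ∃ P' : E.toAffine.Point, pointHom K E P' = P := by
  rcases P with _ | ⟨x, y, hP⟩
  · exact ⟨.zero, rfl⟩
  · simp only [raw, Option.map_some, Option.some.injEq, AffPt.map, AffPt.mk.injEq] at h
    obtain ⟨x, rfl⟩ := exists_of_frob_eq (F := F) h.1
    obtain ⟨y, rfl⟩ := exists_of_frob_eq (F := F) h.2
    exact ⟨.some x y ((Affine.map_nonsingular E (algebraMap F K).injective x y).mp hP), rfl⟩

lemma raw_pointHom_fixed {E : WeierstrassCurve F} (P : E.toAffine.Point) :
    (raw (pointHom K E P)).map (AffPt.map ((frob F K : K →ₐ[F] K) : K →+* K)) =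
      raw (pointHom K E P) := by
  rcases P with _ | ⟨x, y, hP⟩
  · rfl
  · change some _ = some _
    rw [Option.some.injEq]
    exact AffPt.ext ((frob F K).commutes x) ((frob F K).commutes y)

end Frobenius

/-! ### Counting triples by isomorphism classes over the closure -/

section Triples

variable {F : Type*} [Field F] [Finite F] {ζ : F} {m n : ℕ}

/-- The configuration over the algebraic closure given by a triple. -/
def Triple.config (t : Triple F ζ m n) : Config (AlgebraicClosure F) :=
  (t.E.baseChange _, raw (pointBase _ t.E t.P), raw (pointBase _ t.E t.Q))

lemma Triple.config_injective : Function.Injective (Triple.config (ζ := ζ) (m := m) (n := n)) := by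
  rintro ⟨E, h1, P, Q, h2, h3, h4⟩ ⟨E', h1', P', Q', h2', h3', h4'⟩ h
  obtain ⟨hE, hPQ⟩ := Prod.ext_iff.mp h
  have hE := WeierstrassCurve.map_injective (algebraMap F (AlgebraicClosure F)).injective hE
  dsimp only at hE
  subst hE
  obtain ⟨hP, hQ⟩ := Prod.ext_iff.mp hPQ
  have hP : P = P' := pointHom_injective _ _ (raw_injective hP)
  have hQ' : Q = Q' := pointHom_injective _ _ (raw_injective hQ)
  subst hP hQ'
  rfl

lemma tripleSetoid_r_iff (t t' : Triple F ζ m n) :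
    (tripleSetoid (AlgebraicClosure F) F ζ m n).r t t' ↔
      t'.config ∈ MulAction.orbit (VariableChange (AlgebraicClosure F)) t.config := by
  refine exists_congr fun C => ?_
  rw [maps_iff_raw, maps_iff_raw, Prod.ext_iff, Prod.ext_iff]
  rfl

lemma addOrderOf_pointHom {K : Type*} [Field K] (L : Type*) [Field L] [Algebra K L]
    (E : WeierstrassCurve K) (P : E.toAffine.Point) :
    addOrderOf (pointHom L E P) = addOrderOf P :=
  addOrderOf_injective (pointHom L E) (pointHom_injective L E) P

/-- A Frobenius-fixed configuration has coefficients and coordinates in F. The orders and the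
pairing condition carry over from t because the change of variables induces an isomorphism of groups
that preserves the pairing. -/
lemma Triple.exists_config_eq (t : Triple F ζ m n) {c : Config (AlgebraicClosure F)}
    (hc : c ∈ MulAction.orbit (VariableChange (AlgebraicClosure F)) t.config)
    (h : c.map ((frob F (AlgebraicClosure F) :
      AlgebraicClosure F →ₐ[F] AlgebraicClosure F) : AlgebraicClosure F →+* AlgebraicClosure F) = c) :
    ∃ t' : Triple F ζ m n, t'.config = c := by
  have := t.isElliptic
  obtain ⟨C, rfl⟩ := hc
  obtain ⟨hE, hPQ⟩ := Prod.ext_iff.mp h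
  obtain ⟨hP, hQ⟩ := Prod.ext_iff.mp hPQ
  obtain ⟨E', hE'⟩ := exists_baseChange_of_frob hE
  have hE'' : C • t.E.baseChange (AlgebraicClosure F) = E'.baseChange (AlgebraicClosure F) :=
    hE'.symm
  have hell : E'.IsElliptic := by
    have h1 : (E'.baseChange (AlgebraicClosure F)).IsElliptic :=
      hE' ▸ inferInstanceAs (C • t.E.baseChange (AlgebraicClosure F)).IsElliptic
    rw [isElliptic_iff] at h1 ⊢
    have h2 := h1.ne_zero
    rw [show (E'.baseChange (AlgebraicClosure F)).Δ = algebraMap F _ E'.Δ from map_Δ E' _] at h2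
    exact isUnit_iff_ne_zero.mpr fun h3 => h2 (by rw [h3, map_zero])
  have hraw : ∀ P, C • raw (pointBase (AlgebraicClosure F) t.E P) =
      raw (mapsEquiv hE'' (pointHom (AlgebraicClosure F) t.E P)) := fun P =>
    maps_iff_raw.mp (maps_mapsEquiv hE'' _)
  have hP' : (C • raw (pointBase (AlgebraicClosure F) t.E t.P)).map (AffPt.map _) =
    C • raw (pointBase (AlgebraicClosure F) t.E t.P) := hP
  have hQ' : (C • raw (pointBase (AlgebraicClosure F) t.E t.Q)).map (AffPt.map _) =
    C • raw (pointBase (AlgebraicClosure F) t.E t.Q) := hQ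
  rw [hraw] at hP' hQ'
  obtain ⟨P', hPP⟩ := exists_pointHom_of_raw hP'
  obtain ⟨Q', hQQ⟩ := exists_pointHom_of_raw hQ'
  refine ⟨⟨E', hell, P', Q', ?_, ?_, ?_⟩, ?_⟩
  · rw [← addOrderOf_pointHom (AlgebraicClosure F), hPP, AddEquiv.addOrderOf_eq,
      addOrderOf_pointHom, t.orderP]
  · rw [← addOrderOf_pointHom (AlgebraicClosure F), hQQ, AddEquiv.addOrderOf_eq,
      addOrderOf_pointHom, t.orderQ]
  · have h1 := t.pairing.variableChange hE''
    rw [← pointHom_apply, ← pointHom_apply, map_nsmul, map_nsmul, ← hPP, ← hQQ, ← map_nsmul] at h1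
    exact h1
  · refine Prod.ext hE' (Prod.ext ?_ ?_)
    · exact (congrArg raw hPP).trans (hraw t.P).symm
    · exact (congrArg raw hQQ).trans (hraw t.Q).symm

/-- The number of triples in an isomorphism class. -/
theorem card_triple_class (t : Triple F ζ m n) :
    Nat.card {t' // (tripleSetoid (AlgebraicClosure F) F ζ m n).r t t'} =
      Nat.card (VariableChange F) := by
  have := t.isElliptic
  set φ : AlgebraicClosure F →+* AlgebraicClosure F :=
    ((frob F (AlgebraicClosure F) : AlgebraicClosure F →ₐ[F] AlgebraicClosure F) :
      AlgebraicClosure F →+* AlgebraicClosure F) with hφ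
  have hfix : ∀ t : Triple F ζ m n, t.config.map φ = t.config := by
    intro t
    refine Prod.ext ?_ (Prod.ext (raw_pointHom_fixed t.P) (raw_pointHom_fixed t.Q))
    refine (WeierstrassCurve.map_map t.E _ _).trans ?_
    congr 1
    exact RingHom.ext fun x => (frob F (AlgebraicClosure F)).commutes x
  have hstab : Finite (MulAction.stabilizer (VariableChange (AlgebraicClosure F)) t.config) := by
    have := finite_stabilizer (t.E.baseChange (AlgebraicClosure F))
    refine Finite.of_injective (β := MulAction.stabilizer (VariableChange (AlgebraicClosure F))
      (t.E.baseChange (AlgebraicClosure F))) (fun g => ⟨g.1, ?_⟩) (fun g g' h => ?_)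
    · exact congrArg Prod.fst g.2
    · exact Subtype.ext (Subtype.mk.inj h)
  -- By descent the triples equivalent to t are the Frobenius-fixed elements of the orbit of its
  -- configuration.
  rw [← card_mapHom_fixed (F := F) (K := AlgebraicClosure F), ← card_fixed_orbit
    (VariableChange.mapHom φ) (Config.map φ) (fun C c => Config.map_smul φ C c)
    (exists_mapHom_eq_mul (q := Nat.card F) Finite.one_lt_card φ fun x => frob_apply x) (hfix t)]
  refine Nat.card_congr (Equiv.ofBijective
    (fun t' => ⟨t'.1.config, (tripleSetoid_r_iff t t'.1).mp t'.2, hfix _⟩) ⟨?_, ?_⟩)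
  · intro t' t'' h
    exact Subtype.ext (Triple.config_injective (congrArg Subtype.val h))
  · rintro ⟨c, hc, hc'⟩
    obtain ⟨t', rfl⟩ := t.exists_config_eq hc hc'
    exact ⟨⟨t', (tripleSetoid_r_iff t t').mpr hc⟩, rfl⟩

/-- All classes over the closure contain equally many triples, whatever their automorphisms. This is
why the left-hand count is unweighted. -/
theorem card_triple : Nat.card (Triple F ζ m n) = y F ζ m n * Nat.card (VariableChange F) := by
  refine card_eq_mul_of_fiber (Quotient.mk (tripleSetoid (AlgebraicClosure F) F ζ m n)) ?_
  intro c
  obtain ⟨t, rfl⟩ := Quotient.exists_rep c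
  have hfin : Finite {t' // (tripleSetoid (AlgebraicClosure F) F ζ m n).r t t'} :=
    Nat.finite_of_card_ne_zero (by rw [card_triple_class]; exact Nat.card_pos.ne')
  obtain ⟨e⟩ := Finite.card_eq.mp (card_triple_class t)
  exact ⟨(Equiv.subtypeEquivRight fun t' =>
    ⟨fun h => (tripleSetoid _ _ _ _ _).iseqv.symm (Quotient.exact h),
      fun h => Quotient.sound ((tripleSetoid _ _ _ _ _).iseqv.symm h)⟩).trans e⟩

end Triples

/-! ### Weighted counts as numbers of Weierstrass equations -/

section Weighted

variable {F : Type*} [Field F] [Finite F]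

lemma card_isoClass_mul_autCard (c : IsoClass F) :
    Nat.card {E : EllCurve F // Quotient.mk (isoSetoid F) E = c} * autCard c =
      Nat.card (VariableChange F) := by
  obtain ⟨E, rfl⟩ := Quotient.exists_rep c
  change _ * Nat.card (Aut E.1) = _
  have hE := E.2
  rw [Subgroup.card_eq_card_quotient_mul_card_subgroup (Aut E.1)]
  congr 1
  refine Nat.card_congr (Equiv.trans ?_ (MulAction.orbitEquivQuotientStabilizer _ E.1))
  refine Equiv.ofBijective (fun E' => ⟨E'.1.1, ?_⟩) ⟨?_, ?_⟩
  · have h : (isoSetoid F).r E E'.1 := (isoSetoid F).iseqv.symm (Quotient.exact E'.2)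
    exact h
  · intro E' E'' h
    exact Subtype.ext (Subtype.ext (Subtype.mk.inj h))
  · rintro ⟨_, C, rfl⟩
    refine ⟨⟨⟨C • E.1, inferInstance⟩, ?_⟩, rfl⟩
    exact Quotient.sound ((isoSetoid F).iseqv.symm (show (isoSetoid F).r E _ from ⟨C, rfl⟩))

/-- An isomorphism of groups restricts to torsion subgroups. -/
def torsEquiv {A B : Type*} [AddCommGroup A] [AddCommGroup B] (π : A ≃+ B) (n : ℕ) :
    tors A n ≃+ tors B n where
  toFun a := ⟨π a, mem_tors.mpr (by rw [← map_nsmul, mem_tors.mp a.2, map_zero])⟩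
  invFun b := ⟨π.symm b, mem_tors.mpr (by rw [← map_nsmul, mem_tors.mp b.2, map_zero])⟩
  left_inv a := Subtype.ext (π.symm_apply_apply a)
  right_inv b := Subtype.ext (π.apply_symm_apply b)
  map_add' a b := Subtype.ext (map_add π a.1 b.1)

lemma nonempty_torsion_congr {E E' : EllCurve F} (h : (isoSetoid F).r E E') {d n : ℕ}
    (hE : Nonempty (AddSubgroup.torsionBy E.1.toAffine.Point (n : ℤ) ≃+ ZMod d × ZMod n)) :
    Nonempty (AddSubgroup.torsionBy E'.1.toAffine.Point (n : ℤ) ≃+ ZMod d × ZMod n) := by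
  obtain ⟨C, hC⟩ := h
  obtain ⟨e⟩ := hE
  have := E.2
  exact ⟨(torsEquiv (mapsEquiv hC) n).symm.trans e⟩

/-- By orbit-stabiliser each class contains #G(F)/#Aut equations, so the weight 1/#Aut becomes 1 per
equation after multiplication by #G(F). -/
theorem w_mul_card (d n : ℕ) : w F d n * Nat.card (VariableChange F) =
    Nat.card {E : EllCurve F //
      Nonempty (AddSubgroup.torsionBy E.1.toAffine.Point (n : ℤ) ≃+ ZMod d × ZMod n)} := by
  have hfin : Finite (IsoClass F) := Quotient.finite _
  have := Fintype.ofFinite (IsoClass F)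
  have h1 : Nat.card {E : EllCurve F //
      Nonempty (AddSubgroup.torsionBy E.1.toAffine.Point (n : ℤ) ≃+ ZMod d × ZMod n)} =
      ∑ c : IsoClass F, if c ∈ classesW F d n then
        Nat.card {E : EllCurve F // Quotient.mk (isoSetoid F) E = c} else 0 := by
    let cl : {E : EllCurve F // Nonempty (AddSubgroup.torsionBy E.1.toAffine.Point (n : ℤ) ≃+
      ZMod d × ZMod n)} → IsoClass F := fun E => Quotient.mk (isoSetoid F) E.1
    rw [Nat.card_congr (Equiv.sigmaFiberEquiv cl).symm, Nat.card_sigma]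
    refine Finset.sum_congr rfl fun c _ => ?_
    split_ifs with hc
    · obtain ⟨E₀, rfl, hE₀⟩ := hc
      refine Nat.card_congr ⟨fun E => ⟨E.1.1, E.2⟩, fun E => ⟨⟨E.1, ?_⟩, E.2⟩, fun E => rfl,
        fun E => rfl⟩
      exact nonempty_torsion_congr ((isoSetoid F).iseqv.symm (Quotient.exact E.2)) hE₀
    · rw [Nat.card_eq_zero]
      left
      exact ⟨fun E => hc ⟨E.1.1, E.2, E.1.2⟩⟩
  rw [h1, w, weightedCard, finsum_mem_def, finsum_eq_sum_of_fintype, Finset.sum_mul, Nat.cast_sum]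
  refine Finset.sum_congr rfl fun c _ => ?_
  rw [Set.indicator_apply]
  split_ifs with hc
  · have h2 := card_isoClass_mul_autCard c
    have h3 : (autCard c : ℚ) ≠ 0 := by
      rw [Nat.cast_ne_zero]
      rintro h0
      rw [h0, mul_zero] at h2
      exact Nat.card_pos.ne h2
    rw [← h2, Nat.cast_mul]
    field_simp
  · simp

end Weighted

end EllCount

end

noncomputable section
namespace EllCount
open WeierstrassCurve Polynomial Filter
open scoped Classical Polynomial.Bivariate

set_option linter.unusedSectionVars false

/-! ### The group structure of rational n-torsion -/

section Splitting

/-- A cyclic subgroup whose order n kills the whole group is a direct factor. Identify it with the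
n-th roots of unity in ℂ and extend this character to G. The extension still takes values in the
n-th roots of unity. -/
lemma exists_retraction_zpowers {G : Type*} [CommGroup G] [Finite G] {n : ℕ} (hn : n ≠ 0)
    (hG : ∀ g : G, g ^ n = 1) {q : G} (hq : orderOf q = n) :
    ∃ ρ : G →* Subgroup.zpowers q, ∀ h : Subgroup.zpowers q, ρ h = h := by
  have : NeZero n := ⟨hn⟩
  have : NeZero (Monoid.exponent G) := ⟨Monoid.exponent_ne_zero_of_finite⟩
  have hcyc : IsCyclic (rootsOfUnity n ℂ) := inferInstance
  have hcard : Nat.card (Subgroup.zpowers q) = Nat.card (rootsOfUnity n ℂ) := by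
    rw [Nat.card_zpowers, hq, HasEnoughRootsOfUnity.natCard_rootsOfUnity ℂ n]
  let e : Subgroup.zpowers q ≃* rootsOfUnity n ℂ := mulEquivOfCyclicCardEq hcard
  obtain ⟨χ, hχ⟩ := MonoidHom.domRestrict_surjective ℂ (Subgroup.zpowers q)
    ((rootsOfUnity n ℂ).subtype.comp e.toMonoidHom)
  have hχ' : ∀ h : Subgroup.zpowers q, χ h = e h := fun h => DFunLike.congr_fun hχ h
  let χ' : G →* rootsOfUnity n ℂ := χ.codRestrict (rootsOfUnity n ℂ) (fun g => by
    rw [mem_rootsOfUnity, ← map_pow, hG, map_one])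
  refine ⟨e.symm.toMonoidHom.comp χ', fun h => ?_⟩
  change e.symm (χ' h) = h
  rw [MulEquiv.symm_apply_eq]
  exact Subtype.ext (hχ' h)

lemma exists_retraction_zmultiples {B : Type*} [AddCommGroup B] [Finite B] {n : ℕ} (hn : n ≠ 0)
    (hB : ∀ b : B, n • b = 0) {Q : B} (hQ : addOrderOf Q = n) :
    ∃ ρ : B →+ AddSubgroup.zmultiples Q, ∀ h : AddSubgroup.zmultiples Q, ρ h = h := by
  obtain ⟨ρ, hρ⟩ := exists_retraction_zpowers (G := Multiplicative B) hn
    (fun g => hB g.toAdd) (q := Multiplicative.ofAdd Q) (by rw [orderOf_ofAdd_eq_addOrderOf, hQ])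
  refine ⟨AddMonoidHom.mk' (fun b => ⟨(ρ (.ofAdd b) : Multiplicative B).toAdd, ?_⟩) ?_, ?_⟩
  · obtain ⟨k, hk⟩ := (ρ (.ofAdd b)).2
    exact ⟨k, congrArg Multiplicative.toAdd hk⟩
  · intro a b
    apply Subtype.ext
    exact congrArg (fun h : Subgroup.zpowers (Multiplicative.ofAdd Q) =>
      (h : Multiplicative B).toAdd) (map_mul ρ (.ofAdd a) (.ofAdd b))
  · rintro ⟨_, k, rfl⟩
    apply Subtype.ext
    exact congrArg (fun h : Subgroup.zpowers (Multiplicative.ofAdd Q) =>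
      (h : Multiplicative B).toAdd) (hρ ⟨Multiplicative.ofAdd (k • Q), k, rfl⟩)

/-- A group with a retraction onto a subgroup is a direct product. -/
def prodEquivOfRetraction {B : Type*} [AddCommGroup B] {H : AddSubgroup B} (ρ : B →+ H)
    (hρ : ∀ h : H, ρ h = h) : B ≃+ ρ.ker × H where
  toFun b := (⟨b - ρ b, by rw [AddMonoidHom.mem_ker, map_sub, hρ, sub_self]⟩, ρ b)
  invFun p := p.1 + p.2
  left_inv b := sub_add_cancel b _
  right_inv p := by
    have h : ρ (p.1 + p.2) = p.2 := by
      rw [map_add, AddMonoidHom.mem_ker.mp p.1.2, zero_add, hρ]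
    refine Prod.ext (Subtype.ext ?_) h
    change (p.1 : B) + p.2 - ρ (p.1 + p.2) = p.1
    rw [h, add_sub_cancel_right]
  map_add' a b := by
    refine Prod.ext (Subtype.ext ?_) (map_add ρ a b)
    change a + b - (ρ (a + b) : B) = a - ρ a + (b - ρ b)
    rw [map_add, AddSubgroup.coe_add]
    abel

lemma card_tors_eq_sum {B : Type*} [AddCommGroup B] [Finite B] {k : ℕ} (hk : k ≠ 0) :
    Nat.card (tors B k) = ∑ i ∈ k.divisors, Nat.card {b : B // addOrderOf b = i} := by
  have := Fintype.ofFinite B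
  have h := sum_card_addOrderOf_eq_card_nsmul_eq_zero (G := B) hk
  rw [Nat.card_congr (Equiv.subtypeEquivRight fun b : B => mem_tors (n := k)),
    Nat.card_eq_fintype_card, Fintype.card_subtype, ← h]
  exact Finset.sum_congr rfl fun i _ => by rw [Nat.card_eq_fintype_card, Fintype.card_subtype]

/-- The complement of ⟨Q⟩ is cyclic because it has at most k elements killed by k. For g = gcd(k,
n), its g-torsion times the subgroup of order g in ⟨Q⟩ embeds into the g-torsion of B, which has at
most g² elements. The number d is the order of the complement. -/
theorem exists_equiv_zmod_prod {B : Type*} [AddCommGroup B] [Finite B] {n : ℕ} (hn : n ≠ 0)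
    (hB : ∀ b : B, n • b = 0) {Q : B} (hQ : addOrderOf Q = n)
    (hc : ∀ k, k ≠ 0 → Nat.card (tors B k) ≤ k ^ 2) :
    ∃ d, d ∣ n ∧ Nonempty (B ≃+ ZMod d × ZMod n) := by
  obtain ⟨ρ, hρ⟩ := exists_retraction_zmultiples hn hB hQ
  have hcyc : IsAddCyclic ρ.ker := by
    have := Fintype.ofFinite ρ.ker
    apply isAddCyclic_of_card_nsmul_eq_zero_le
    intro k hk
    set g := Nat.gcd k n with hg
    have hg0 : g ≠ 0 := Nat.gcd_ne_zero_right hn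
    have h1 : (Finset.univ.filter fun b : ρ.ker => k • b = 0).card ≤ Nat.card (tors ρ.ker g) := by
      rw [← Fintype.card_subtype, ← Nat.card_eq_fintype_card]
      refine Nat.card_le_card_of_injective (fun b => ⟨b.1, ?_⟩) (fun a b h =>
        Subtype.ext (Subtype.mk.inj h))
      obtain ⟨b, hb⟩ := b
      refine mem_tors.mpr (addOrderOf_dvd_iff_nsmul_eq_zero.mp (Nat.dvd_gcd
        (addOrderOf_dvd_of_nsmul_eq_zero hb) (addOrderOf_dvd_of_nsmul_eq_zero
          (Subtype.ext (hB b)))))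
    have hgn : g ∣ n := Nat.gcd_dvd_right k n
    set R := (n / g) • Q with hR
    have hRo : addOrderOf R = g := by
      rw [hR, addOrderOf_nsmul_of_dvd (Nat.div_pos (Nat.le_of_dvd (Nat.pos_of_ne_zero hn) hgn)
        (Nat.pos_of_ne_zero hg0)).ne' (by rw [hQ]; exact Nat.div_dvd_of_dvd hgn), hQ, Nat.div_div_self hgn hn]
    have h2 : Nat.card (tors ρ.ker g × AddSubgroup.zmultiples R) ≤ Nat.card (tors B g) := by
      refine Nat.card_le_card_of_injective (fun p => ⟨p.1.1.1 + p.2.1, ?_⟩) ?_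
      · rw [mem_tors, smul_add]
        have e1 : g • (p.1.1.1 : B) = 0 := congrArg Subtype.val (mem_tors.mp p.1.2)
        obtain ⟨i, hi⟩ := p.2.2
        have e2 : g • p.2.1 = 0 := by
          rw [← hi]
          change g • i • R = 0
          rw [smul_comm, ← hRo, addOrderOf_nsmul_eq_zero, smul_zero]
        rw [e1, e2, add_zero]
      · rintro ⟨⟨⟨a, ha⟩, _⟩, ⟨_, i, rfl⟩⟩ ⟨⟨⟨b, hb⟩, _⟩, ⟨_, j, rfl⟩⟩ h
        have h : a + i • R = b + j • R := congrArg Subtype.val h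
        have hρR : ∀ i : ℤ, (ρ (i • R) : B) = i • R := fun i =>
          congrArg Subtype.val (hρ ⟨i • R, by
            rw [hR]; exact zsmul_mem (nsmul_mem (AddSubgroup.mem_zmultiples Q) _) _⟩)
        have h3 := congrArg (fun x => (ρ x : B)) h
        simp only [map_add, AddMonoidHom.mem_ker.mp ha, AddMonoidHom.mem_ker.mp hb, zero_add,
          hρR] at h3
        rw [h3, add_left_inj] at h
        subst h
        simp only [Prod.mk.injEq, true_and]
        exact Subtype.ext h3
    rw [Nat.card_prod, Nat.card_zmultiples, hRo] at h2
    have h3 := h2.trans (hc g hg0)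
    rw [pow_two] at h3
    exact (h1.trans (Nat.le_of_mul_le_mul_right h3 (Nat.pos_of_ne_zero hg0))).trans
      (Nat.le_of_dvd hk (Nat.gcd_dvd_left k n))
  refine ⟨Nat.card ρ.ker, ?_, ⟨(prodEquivOfRetraction ρ hρ).trans (AddEquiv.prodCongr
    (zmodAddCyclicAddEquiv hcyc).symm ?_)⟩⟩
  · rw [← IsAddCyclic.exponent_eq_card]
    exact AddMonoid.exponent_dvd_of_forall_nsmul_eq_zero fun b => Subtype.ext (hB b)
  · have h1 : IsAddCyclic (AddSubgroup.zmultiples Q) := inferInstance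
    have h2 := zmodAddCyclicAddEquiv h1
    rw [Nat.card_zmultiples, hQ] at h2
    exact h2.symm

end Splitting

/-! ### Elements of order n in ℤ/d × ℤ/n -/

section Counting

lemma card_tors_zmod (a k : ℕ) (ha : a ≠ 0) : Nat.card (tors (ZMod a) k) = Nat.gcd k a := by
  have : NeZero a := ⟨ha⟩
  have hg : Nat.gcd k a ∣ a := Nat.gcd_dvd_right k a
  have h1 : Nat.card (tors (ZMod a) k) = Nat.card (tors (ZMod a) (Nat.gcd k a)) := by
    refine Nat.card_congr (Equiv.subtypeEquivRight fun b => ?_)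
    rw [mem_tors, mem_tors, ← addOrderOf_dvd_iff_nsmul_eq_zero, ← addOrderOf_dvd_iff_nsmul_eq_zero,
      Nat.dvd_gcd_iff]
    refine ⟨fun h => ⟨h, ?_⟩, fun h => h.1⟩
    rw [addOrderOf_dvd_iff_nsmul_eq_zero, nsmul_eq_mul, CharP.cast_eq_zero, zero_mul]
  rw [h1, card_tors_eq_sum (Nat.gcd_ne_zero_right ha)]
  conv_rhs => rw [← Nat.sum_totient (Nat.gcd k a)]
  refine Finset.sum_congr rfl fun m hm => ?_
  rw [Nat.card_eq_fintype_card, Fintype.card_subtype]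
  exact IsAddCyclic.card_addOrderOf_eq_totient
    (by rw [ZMod.card]; exact (Nat.dvd_of_mem_divisors hm).trans hg)

lemma card_tors_prod {A B : Type*} [AddCommGroup A] [AddCommGroup B] (k : ℕ) :
    Nat.card (tors (A × B) k) = Nat.card (tors A k) * Nat.card (tors B k) := by
  rw [← Nat.card_prod]
  exact Nat.card_congr ⟨fun p => (⟨p.1.1, mem_tors.mpr (congrArg Prod.fst (mem_tors.mp p.2))⟩,
    ⟨p.1.2, mem_tors.mpr (congrArg Prod.snd (mem_tors.mp p.2))⟩),
    fun p => ⟨(p.1.1, p.2.1), mem_tors.mpr (Prod.ext (mem_tors.mp p.1.2) (mem_tors.mp p.2.2))⟩,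
    fun p => rfl, fun p => rfl⟩

lemma card_tors_zmod_prod {d n : ℕ} (hd : d ≠ 0) (hn : n ≠ 0) (k : ℕ) :
    Nat.card (tors (ZMod d × ZMod n) k) = Nat.gcd k d * Nat.gcd k n := by
  rw [card_tors_prod, card_tors_zmod d k hd, card_tors_zmod n k hn]

open ArithmeticFunction in
/-- The number of elements of given order is multiplicative. -/
lemma card_addOrderOf_eq_prod {d n : ℕ} (hd : d ≠ 0) (hn : n ≠ 0) :
    (Nat.card {x : ZMod d × ZMod n // addOrderOf x = n} : ℚ) = ∏ p ∈ n.primeFactors,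
      (((p ^ n.factorization p).gcd d * (p ^ n.factorization p).gcd n : ℕ) -
        ((p ^ (n.factorization p - 1)).gcd d * (p ^ (n.factorization p - 1)).gcd n : ℕ) : ℚ) := by
  have : NeZero d := ⟨hd⟩
  have : NeZero n := ⟨hn⟩
  let N : ArithmeticFunction ℚ := ⟨fun k => if k = 0 then 0 else
    (Nat.card {x : ZMod d × ZMod n // addOrderOf x = k} : ℚ), if_pos rfl⟩
  let g : ArithmeticFunction ℚ := ⟨fun k => if k = 0 then 0 else
    ((k.gcd d * k.gcd n : ℕ) : ℚ), if_pos rfl⟩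
  have hN : ∀ {k : ℕ}, k ≠ 0 → N k = (Nat.card {x : ZMod d × ZMod n // addOrderOf x = k} : ℚ) :=
    fun hk => if_neg hk
  have hgv : ∀ {k : ℕ}, k ≠ 0 → g k = ((k.gcd d * k.gcd n : ℕ) : ℚ) := fun hk => if_neg hk
  have hg : g.IsMultiplicative := by
    rw [IsMultiplicative.iff_ne_zero]
    refine ⟨by rw [hgv one_ne_zero]; simp, fun {a b} ha hb hab => ?_⟩
    rw [hgv (mul_ne_zero ha hb), hgv ha, hgv hb, ← Nat.cast_mul, Nat.gcd_comm, hab.gcd_mul,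
      Nat.gcd_comm (a * b), hab.gcd_mul, Nat.gcd_comm d, Nat.gcd_comm d, Nat.gcd_comm n,
      Nat.gcd_comm n]
    congr 1
    ring
  have hsum : ∀ {k : ℕ}, k ≠ 0 → ∑ i ∈ k.divisors, N i = g k := by
    intro k hk
    rw [hgv hk, ← card_tors_zmod_prod hd hn, card_tors_eq_sum hk, Nat.cast_sum]
    exact Finset.sum_congr rfl fun i hi => hN (Nat.pos_of_mem_divisors hi).ne'
  -- Möbius inversion of k ↦ gcd(k, d)·gcd(k, n), the number of elements killed by k. Both factors
  -- are multiplicative, so the count is determined by its values at prime powers.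
  have hNg : N = g * (moebius : ArithmeticFunction ℤ) := by
    have h1 : N * (zeta : ArithmeticFunction ℕ) = g := by
      ext k
      rcases eq_or_ne k 0 with rfl | hk
      · simp
      · rw [coe_mul_zeta_apply, hsum hk]
    rw [← h1, mul_assoc, coe_zeta_mul_coe_moebius, mul_one]
  have hNm : N.IsMultiplicative := by
    rw [hNg]
    exact hg.mul isMultiplicative_moebius.intCast
  rw [← hN hn, hNm.multiplicative_factorization _ hn, Finsupp.prod, Nat.support_factorization]
  refine Finset.prod_congr rfl fun p hp => ?_
  have hp' := Nat.prime_of_mem_primeFactors hp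
  obtain ⟨e, he⟩ : ∃ e, n.factorization p = e + 1 :=
    Nat.exists_eq_succ_of_ne_zero (Finsupp.mem_support_iff.mp
      (by rwa [Nat.support_factorization]))
  rw [he, Nat.add_sub_cancel, ← hgv (pow_ne_zero _ hp'.ne_zero), ← hgv (pow_ne_zero _ hp'.ne_zero),
    ← hsum (pow_ne_zero _ hp'.ne_zero), ← hsum (pow_ne_zero _ hp'.ne_zero),
    Nat.sum_divisors_prime_pow hp', Nat.sum_divisors_prime_pow hp', Finset.sum_range_succ _ (e + 1),
    add_sub_cancel_left]

lemma psi_ne_zero {n : ℕ} (hn : n ≠ 0) : psi n ≠ 0 := by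
  refine mul_ne_zero (Nat.cast_ne_zero.mpr hn) (Finset.prod_ne_zero_iff.mpr fun p _ => ?_)
  positivity

/-- The number of elements of order `n` in `ℤ/d × ℤ/n`. -/
theorem card_addOrderOf_eq {d n : ℕ} (hn : n ≠ 0) (hdn : d ∣ n) :
    (Nat.card {x : ZMod d × ZMod n // addOrderOf x = n} : ℚ) =
      Nat.totient n * psi n / psi (n / d) := by
  have hd : d ≠ 0 := ne_zero_of_dvd_ne_zero hn hdn
  obtain ⟨k, rfl⟩ := hdn
  have hk : k ≠ 0 := right_ne_zero_of_mul hn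
  rw [Nat.mul_div_cancel_left k (Nat.pos_of_ne_zero hd), eq_div_iff (psi_ne_zero hk),
    card_addOrderOf_eq_prod hd hn, Nat.totient_eq_mul_prod_factors, psi, psi]
  have hsub : k.primeFactors ⊆ (d * k).primeFactors :=
    Nat.primeFactors_mono (Dvd.intro_left d rfl) hn
  have e1 : ∏ p ∈ k.primeFactors, (1 + 1 / (p : ℚ)) = ∏ p ∈ (d * k).primeFactors,
      if p ∣ k then (1 + 1 / (p : ℚ)) else 1 := by
    rw [← Finset.prod_subset hsub (f := fun p => if p ∣ k then (1 + 1 / (p : ℚ)) else 1)]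
    · exact Finset.prod_congr rfl fun p hp => (if_pos (Nat.dvd_of_mem_primeFactors hp)).symm
    · intro p hp hp'
      exact if_neg fun h => hp' (Nat.mem_primeFactors.mpr
        ⟨Nat.prime_of_mem_primeFactors hp, h, hk⟩)
  have e2 : ((d * k : ℕ) : ℚ) = ∏ p ∈ (d * k).primeFactors,
      (p : ℚ) ^ (d * k).factorization p := by
    conv_lhs => rw [← Nat.prod_factorization_pow_eq_self hn]
    rw [Finsupp.prod, Nat.support_factorization, Nat.cast_prod]
    exact Finset.prod_congr rfl fun p _ => Nat.cast_pow _ _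
  have e3 : (d : ℚ) = ∏ p ∈ (d * k).primeFactors, (p : ℚ) ^ d.factorization p := by
    conv_lhs => rw [← Nat.prod_factorization_pow_eq_self hd]
    rw [Finsupp.prod, Nat.support_factorization, Nat.cast_prod,
      ← Finset.prod_subset (Nat.primeFactors_mono (Dvd.intro k rfl) hn)]
    · exact Finset.prod_congr rfl fun p _ => Nat.cast_pow _ _
    · intro p _ hp
      rw [← Nat.support_factorization, Finsupp.notMem_support_iff] at hp
      rw [hp, pow_zero]
  -- Let p^a and p^e exactly divide d and n = dk. For a < e the local count is p^(a+e)(1 − 1/p), and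
  -- for a = e it is p^(2e)(1 − 1/p²). So the factor 1 + 1/p is present exactly when p does not
  -- divide k, which is the effect of dividing by ψ(k).
  have key : ∀ p ∈ (d * k).primeFactors,
      (((p ^ (d * k).factorization p).gcd d * (p ^ (d * k).factorization p).gcd (d * k) : ℕ) -
        ((p ^ ((d * k).factorization p - 1)).gcd d *
          (p ^ ((d * k).factorization p - 1)).gcd (d * k) : ℕ) : ℚ) *
        (if p ∣ k then (1 + 1 / (p : ℚ)) else 1) =
      (p : ℚ) ^ (d * k).factorization p * (p : ℚ) ^ d.factorization p * (1 - (p : ℚ)⁻¹) *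
        (1 + 1 / (p : ℚ)) := by
    intro p hp
    have hp' := Nat.prime_of_mem_primeFactors hp
    have hgcd : ∀ i {a : ℕ}, a ≠ 0 → (p ^ i).gcd a = p ^ min i (a.factorization p) := by
      intro i a ha
      conv_lhs => rw [← Nat.ordProj_mul_ordCompl_eq_self a p]
      rw [Nat.Coprime.gcd_mul_right_cancel_right _
        ((Nat.coprime_ordCompl hp' ha).symm.pow_right i)]
      rcases le_total i (a.factorization p) with h | h
      · rw [min_eq_left h, Nat.gcd_eq_left (pow_dvd_pow p h)]
      · rw [min_eq_right h, Nat.gcd_eq_right (pow_dvd_pow p h)]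
    have hfac : (d * k).factorization p = d.factorization p + k.factorization p := by
      rw [Nat.factorization_mul hd hk]; rfl
    have hpos : 0 < (d * k).factorization p := hp'.factorization_pos_of_dvd hn
      (Nat.dvd_of_mem_primeFactors hp)
    have hp0 : (p : ℚ) ≠ 0 := Nat.cast_ne_zero.mpr hp'.ne_zero
    rw [hgcd _ hd, hgcd _ hn, hgcd _ hd, hgcd _ hn, min_self, min_eq_left (Nat.sub_le _ _),
      min_eq_right (by omega : d.factorization p ≤ (d * k).factorization p)]
    by_cases hpk : p ∣ k
    · have h1 : 0 < k.factorization p := hp'.factorization_pos_of_dvd hk hpk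
      rw [if_pos hpk, min_eq_right (by omega)]
      obtain ⟨e, he⟩ := Nat.exists_eq_succ_of_ne_zero hpos.ne'
      rw [he, Nat.succ_sub_one]
      push_cast
      rw [pow_succ]
      field_simp
    · have h1 : k.factorization p = 0 := Nat.factorization_eq_zero_of_not_dvd hpk
      rw [if_neg hpk]
      rw [h1, add_zero] at hfac
      rw [← hfac, min_eq_left (Nat.sub_le _ _)]
      obtain ⟨e, he⟩ := Nat.exists_eq_succ_of_ne_zero hpos.ne'
      rw [he, Nat.succ_sub_one]
      push_cast
      rw [pow_succ]
      field_simp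
      ring
  have h := Finset.prod_congr rfl key
  simp only [Finset.prod_mul_distrib] at h
  rw [← e1, ← e2, ← e3] at h
  rw [mul_left_comm, h]
  push_cast
  ring

end Counting

end EllCount

end

noncomputable section
namespace EllCount
open WeierstrassCurve Polynomial Filter
open scoped Classical Polynomial.Bivariate

set_option linter.unusedSectionVars false

/-! ### Rational torsion and rational values of the Weil pairing -/

section RationalTorsion

variable {F : Type*} [Field F] [Finite F] (K : Type*) [Field K] [Algebra F K]
  [IsAlgClosed K] {E : WeierstrassCurve F} [E.IsElliptic]

/-- Base change of torsion points. -/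
def torsBase (E : WeierstrassCurve F) (k : ℕ) (P : tors E.toAffine.Point k) :
    tors (E.baseChange K).toAffine.Point k :=
  ⟨pointHom K E P, mem_tors.mpr (by rw [← map_nsmul, mem_tors.mp P.2, map_zero])⟩

lemma torsBase_injective (k : ℕ) : Function.Injective (torsBase K E k) := fun _ _ h =>
  Subtype.ext (pointHom_injective K E (congrArg Subtype.val h))

variable (E) in
lemma card_tors_point_le {k : ℕ} (hk : k ≠ 0) : Nat.card (tors E.toAffine.Point k) ≤ k ^ 2 := by
  have := finite_tors (E.baseChange (AlgebraicClosure F)).toAffine hk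
  exact (Nat.card_le_card_of_injective _ (torsBase_injective (AlgebraicClosure F) k)).trans
    (card_tors_le _ hk)

lemma addOrderOf_tors {B : Type*} [AddCommGroup B] {n : ℕ} (x : tors B n) :
    addOrderOf x = addOrderOf (x : B) :=
  (addOrderOf_injective (tors B n).subtype Subtype.val_injective x).symm

lemma exists_torsion_equiv {n : ℕ} (hn : n ≠ 0) {Q : E.toAffine.Point} (hQ : addOrderOf Q = n) :
    ∃ d, d ∣ n ∧ Nonempty (tors E.toAffine.Point n ≃+ ZMod d × ZMod n) := by
  refine exists_equiv_zmod_prod hn (fun b => Subtype.ext (mem_tors.mp b.2))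
    (Q := ⟨Q, mem_tors.mpr (hQ ▸ addOrderOf_nsmul_eq_zero Q)⟩) ?_ fun k hk => ?_
  · rw [addOrderOf_tors]; exact hQ
  · refine le_trans (Nat.card_le_card_of_injective (β := tors E.toAffine.Point k)
      (fun b => ⟨b.1.1, mem_tors.mpr (congrArg Subtype.val (mem_tors.mp b.2))⟩) fun a b h => ?_)
      (card_tors_point_le E hk)
    exact Subtype.ext (Subtype.ext (Subtype.mk.inj h))

lemma card_tors_of_equiv {B : Type*} [AddCommGroup B] {d n : ℕ} (hd : d ≠ 0) (hn : n ≠ 0)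
    (e : tors B n ≃+ ZMod d × ZMod n) {k : ℕ} (hk : k ∣ n) :
    Nat.card (tors B k) = Nat.gcd k d * k := by
  have h1 : Nat.card (tors B k) = Nat.card (tors (tors B n) k) := by
    refine Nat.card_congr ⟨fun b => ⟨⟨b.1, ?_⟩, mem_tors.mpr (Subtype.ext (mem_tors.mp b.2))⟩,
      fun b => ⟨b.1.1, mem_tors.mpr (congrArg Subtype.val (mem_tors.mp b.2))⟩,
      fun b => rfl, fun b => rfl⟩
    obtain ⟨c, rfl⟩ := hk
    rw [mem_tors, mul_comm, mul_smul, mem_tors.mp b.2, smul_zero]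
  rw [h1, Nat.card_congr (torsEquiv e k).toEquiv, card_tors_zmod_prod hd hn, Nat.gcd_eq_left hk]

lemma card_tors_closure {k : ℕ} (hk : k ≠ 0)
    (hc : Nat.card (tors E.toAffine.Point k) = k ^ 2) :
    Nat.card (tors (E.baseChange K).toAffine.Point k) = k ^ 2 := by
  have := finite_tors (E.baseChange K).toAffine hk
  exact le_antisymm (card_tors_le _ hk)
    (hc ▸ Nat.card_le_card_of_injective _ (torsBase_injective K k))

lemma natCast_ne_zero_of_card_tors {k : ℕ} (hk : k ≠ 0)
    (hc : Nat.card (tors E.toAffine.Point k) = k ^ 2) :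
    (k : K) ≠ 0 := fun h0 =>
  (card_tors_lt (E.baseChange K).toAffine hk h0).ne (card_tors_closure K hk hc)

lemma torsBase_bijective {k : ℕ} (hk : k ≠ 0)
    (hc : Nat.card (tors E.toAffine.Point k) = k ^ 2) :
    Function.Bijective (torsBase K E k) := by
  have := finite_tors (E.baseChange K).toAffine hk
  exact (Nat.bijective_iff_injective_and_card _).mpr ⟨torsBase_injective K k, by
    rw [hc, card_tors_closure K hk hc]⟩

/-- Having k² rational points killed by k makes k invertible and all of E[k] rational. A primitive
k-th root of unity is then a pairing of rational points, hence fixed by Frobenius. -/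
lemma dvd_card_sub_one [Algebra.IsAlgebraic F K] {k : ℕ} (hk : k ≠ 0)
    (hc : Nat.card (tors E.toAffine.Point k) = k ^ 2)
    {T : E.toAffine.Point} (hT : addOrderOf T = k) : k ∣ Nat.card F - 1 := by
  have hk0 := natCast_ne_zero_of_card_tors K hk hc
  have : NeZero (k : K) := ⟨hk0⟩
  obtain ⟨ξ, hξ⟩ := HasEnoughRootsOfUnity.exists_primitiveRoot K k
  have hT' : addOrderOf (pointHom K E T) = k := (addOrderOf_pointHom K E T).trans hT
  obtain ⟨S, hS, hST⟩ := exists_isWeilPairing hk hT' (card_tors_closure K hk hc) hξ.pow_eq_one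
  obtain ⟨S', hS'⟩ := (torsBase_bijective K hk hc).2 ⟨S, mem_tors.mpr hS⟩
  have hS' : pointHom K E S' = S := congrArg Subtype.val hS'
  have hgal := hST.galois (frob F K)
  rw [← hS', galEquiv_pointHom, galEquiv_pointHom, hS', frob_apply] at hgal
  obtain ⟨e, -, he⟩ := exists_weilHom hk (hT' ▸ addOrderOf_nsmul_eq_zero (pointHom K E T))
  have h1 := ((he ⟨S, mem_tors.mpr hS⟩ _).mp hgal).symm.trans ((he ⟨S, mem_tors.mpr hS⟩ _).mp hST)
  apply hξ.dvd_of_pow_eq_one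
  apply mul_right_cancel₀ (hξ.ne_zero hk)
  rw [← pow_succ, Nat.sub_add_cancel (Finite.one_lt_card (α := F)).le, h1, one_mul]

/-- The number of rational points with a given Weil pairing against a rational point. -/
lemma card_isWeilPairing {k : ℕ} (hk : k ≠ 0)
    (hc : Nat.card (tors E.toAffine.Point k) = k ^ 2)
    {T : E.toAffine.Point} (hT : addOrderOf T = k) {ζ : F}
    (hζ : IsPrimitiveRoot ζ k) :
    Nat.card {P : E.toAffine.Point // addOrderOf P = k ∧ IsWeilPairing (E.baseChange K).toAffine k
      (pointHom K E P) (pointHom K E T) (algebraMap F K ζ)} = k := by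
  have : NeZero k := ⟨hk⟩
  have : NeZero (k : K) := ⟨natCast_ne_zero_of_card_tors K hk hc⟩
  have hA := card_tors_closure K hk hc
  have hfin := finite_tors (E.baseChange K).toAffine hk
  have hξ : IsPrimitiveRoot (algebraMap F K ζ) k := hζ.map_of_injective (algebraMap F K).injective
  have hT' : addOrderOf (pointHom K E T) = k := (addOrderOf_pointHom K E T).trans hT
  obtain ⟨e, he1, he⟩ := exists_weilHom hk (hT' ▸ addOrderOf_nsmul_eq_zero (pointHom K E T))
  let e' : Multiplicative (tors (E.baseChange K).toAffine.Point k) →* Kˣ := e.toHomUnits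
  have hval : ∀ S, ((e' S : Kˣ) : K) = e S := fun S => rfl
  have hrange : e'.range = rootsOfUnity k K := by
    ext u
    rw [mem_rootsOfUnity']
    constructor
    · rintro ⟨S, rfl⟩
      exact he1 S
    · intro hu
      obtain ⟨S, hS, hST⟩ := exists_isWeilPairing hk hT' hA hu
      exact ⟨.ofAdd ⟨S, mem_tors.mpr hS⟩, Units.ext ((he ⟨S, mem_tors.mpr hS⟩ _).mp hST)⟩
  -- Pairing with T maps k² points onto the k roots of unity. The points with a given value form a
  -- coset of the kernel.
  have hker : Nat.card e'.ker = k := by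
    have h1 := Subgroup.card_eq_card_quotient_mul_card_subgroup e'.ker
    rw [Nat.card_congr (QuotientGroup.quotientKerEquivRange e').toEquiv, hrange,
      HasEnoughRootsOfUnity.natCard_rootsOfUnity K k] at h1
    have h2 : Nat.card (Multiplicative (tors (E.baseChange K).toAffine.Point k)) = k ^ 2 := hA
    rw [h2, pow_two] at h1
    exact (mul_left_cancel₀ hk h1).symm
  obtain ⟨S₀, hS₀, hST₀⟩ := exists_isWeilPairing hk hT' hA hξ.pow_eq_one
  have hS₀' := (he ⟨S₀, mem_tors.mpr hS₀⟩ _).mp hST₀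
  set s₀ : Multiplicative (tors (E.baseChange K).toAffine.Point k) :=
    .ofAdd ⟨S₀, mem_tors.mpr hS₀⟩
  refine Eq.trans ?_ ((Nat.card_congr (e'.fiberEquivKer s₀)).trans hker)
  have hmem : ∀ P : E.toAffine.Point, addOrderOf P = k ∧ IsWeilPairing (E.baseChange K).toAffine k
      (pointHom K E P) (pointHom K E T) (algebraMap F K ζ) → P ∈ tors E.toAffine.Point k :=
    fun P hP => mem_tors.mpr (hP.1 ▸ addOrderOf_nsmul_eq_zero P)
  refine Nat.card_congr (Equiv.ofBijective (fun P => ⟨.ofAdd (torsBase K E k ⟨P.1, hmem _ P.2⟩),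
    ?_⟩) ⟨fun P P' h => ?_, ?_⟩)
  · rw [Set.mem_preimage, Set.mem_singleton_iff]
    apply Units.ext
    rw [hval, hval, hS₀']
    exact (he _ _).mp P.2.2
  · have h1 := torsBase_injective K k (Multiplicative.ofAdd.injective (Subtype.mk.inj h))
    exact Subtype.ext (Subtype.mk.inj h1)
  · rintro ⟨S, hS⟩
    obtain ⟨P, hP⟩ := (torsBase_bijective K hk hc).2 S.toAdd
    have hS : e S = algebraMap F K ζ := by
      rw [← hS₀', ← hval, ← hval]
      exact congrArg Units.val hS
    have hw : IsWeilPairing (E.baseChange K).toAffine k (pointHom K E P) (pointHom K E T)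
        (algebraMap F K ζ) := by
      rw [show pointHom K E P = ((S.toAdd : tors (E.baseChange K).toAffine.Point k) :
        (E.baseChange K).toAffine.Point) from congrArg Subtype.val hP]
      exact (he S.toAdd _).mpr hS
    refine ⟨⟨P, Nat.dvd_antisymm (addOrderOf_dvd_of_nsmul_eq_zero (mem_tors.mp P.2)) ?_, hw⟩, ?_⟩
    -- The order of P is exactly k because its pairing value is a primitive k-th root of unity.
    · apply hξ.dvd_of_pow_eq_one
      rw [← hS, ← map_pow]
      have : S ^ addOrderOf (P : E.toAffine.Point) = 1 := by
        have h2 : addOrderOf (P : E.toAffine.Point) • S.toAdd = 0 := by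
          rw [← hP]
          apply Subtype.ext
          change addOrderOf (P : E.toAffine.Point) • pointHom K E P = 0
          rw [← map_nsmul, addOrderOf_nsmul_eq_zero, map_zero]
        exact h2
      rw [this, map_one]
    · apply Subtype.ext
      exact congrArg Multiplicative.ofAdd hP

/-- P and T are independent modulo m. Pairing iP + jT = 0 with T gives ζ^i = 1, since T pairs
trivially with itself. So m ∣ i, and then jT = 0 gives m ∣ j. The m² combinations are distinct. -/
lemma card_tors_of_isWeilPairing {m : ℕ} (hm : m ≠ 0) {P T : E.toAffine.Point}
    (hP : addOrderOf P = m) (hT : addOrderOf T = m) {ζ : F} (hζ : IsPrimitiveRoot ζ m)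
    (h : IsWeilPairing (E.baseChange K).toAffine m (pointHom K E P) (pointHom K E T)
      (algebraMap F K ζ)) : Nat.card (tors E.toAffine.Point m) = m ^ 2 := by
  have : NeZero m := ⟨hm⟩
  have hPm : m • P = 0 := hP ▸ addOrderOf_nsmul_eq_zero P
  have hTm : m • T = 0 := hT ▸ addOrderOf_nsmul_eq_zero T
  have hTm' : m • pointHom K E T = 0 := by rw [← map_nsmul, hTm, map_zero]
  have hξ : IsPrimitiveRoot (algebraMap F K ζ) m := hζ.map_of_injective (algebraMap F K).injective
  obtain ⟨e, he1, he⟩ := exists_weilHom hm hTm'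
  let p := torsBase K E m ⟨P, mem_tors.mpr hPm⟩
  let t := torsBase K E m ⟨T, mem_tors.mpr hTm⟩
  have hep : e (.ofAdd p) = algebraMap F K ζ := (he p _).mp h
  have het : e (.ofAdd t) = 1 := (he t _).mp (isWeilPairing_self hm hTm')
  have key : ∀ i j : ℤ, i • P + j • T = 0 → (m : ℤ) ∣ i ∧ (m : ℤ) ∣ j := by
    intro i j hij
    have h1 : i • p + j • t = 0 := by
      apply Subtype.ext
      change i • pointHom K E P + j • pointHom K E T = 0
      rw [← map_zsmul, ← map_zsmul, ← map_add, hij, map_zero]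
    let e' : Multiplicative (tors (E.baseChange K).toAffine.Point m) →* Kˣ := e.toHomUnits
    have h2 : e' (.ofAdd p) ^ i * e' (.ofAdd t) ^ j = 1 := by
      refine Eq.trans ?_ ((congrArg (fun s => e' (Multiplicative.ofAdd s)) h1).trans (map_one e'))
      exact ((map_mul e' (.ofAdd p ^ i) (.ofAdd t ^ j)).trans
        (congrArg₂ _ (map_zpow e' _ i) (map_zpow e' _ j))).symm
    have h3 : e' (.ofAdd t) = 1 := Units.ext het
    rw [h3, one_zpow, mul_one] at h2
    have h4 : algebraMap F K ζ ^ i = 1 := by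
      rw [← hep]
      have := congrArg Units.val h2
      rwa [Units.val_zpow_eq_zpow_val] at this
    have h5 := (hξ.zpow_eq_one_iff_dvd i).mp h4
    refine ⟨h5, ?_⟩
    obtain ⟨c, rfl⟩ := h5
    rw [mul_comm, mul_smul, natCast_zsmul, hPm, smul_zero, zero_add] at hij
    rw [← hT]
    exact addOrderOf_dvd_iff_zsmul_eq_zero.mpr hij
  refine le_antisymm (card_tors_point_le E hm) ?_
  rw [pow_two, ← Nat.card_zmod m, ← Nat.card_prod, Nat.card_zmod]
  refine Nat.card_le_card_of_injective (fun ij : ZMod m × ZMod m =>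
    ⟨ij.1.val • P + ij.2.val • T, mem_tors.mpr ?_⟩) ?_
  · rw [smul_add, smul_comm m, smul_comm m, hPm, hTm, smul_zero, smul_zero, add_zero]
  · rintro ⟨i, j⟩ ⟨i', j'⟩ h
    have h := Subtype.mk.inj h
    dsimp only at h
    obtain ⟨h1, h2⟩ := key (i.val - i'.val) (j.val - j'.val) (by
      rw [sub_smul, sub_smul, natCast_zsmul, natCast_zsmul, natCast_zsmul, natCast_zsmul,
        sub_add_sub_comm, h, sub_self])
    have hz : ∀ i i' : ZMod m, (m : ℤ) ∣ i.val - i'.val → i = i' := by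
      intro i i' h
      have := (ZMod.intCast_zmod_eq_zero_iff_dvd _ m).mpr h
      push_cast at this
      rw [ZMod.natCast_zmod_val, ZMod.natCast_zmod_val] at this
      exact sub_eq_zero.mp this
    exact Prod.ext (hz _ _ h1) (hz _ _ h2)

end RationalTorsion

/-! ### Counting pairs (P, Q) on one curve -/

section Pairs

variable {F : Type*} [Field F] [Finite F]

/-- The pairs of points occurring in the triples on a given curve. -/
abbrev Pairs (E : WeierstrassCurve F) (ζ : F) (m n : ℕ) : Type _ :=
  {p : E.toAffine.Point × E.toAffine.Point // addOrderOf p.1 = m ∧ addOrderOf p.2 = n ∧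
    IsWeilPairing (E.baseChange (AlgebraicClosure F)).toAffine m
      (pointHom (AlgebraicClosure F) E p.1) (pointHom (AlgebraicClosure F) E ((n / m) • p.2))
      (algebraMap F (AlgebraicClosure F) ζ)}

lemma card_triple_eq_sum (ζ : F) (m n : ℕ) [Fintype (EllCurve F)] :
    Nat.card (Triple F ζ m n) = ∑ E : EllCurve F, Nat.card (Pairs E.1 ζ m n) := by
  rw [← Nat.card_sigma]
  exact Nat.card_congr ⟨fun t => ⟨⟨t.E, t.isElliptic⟩, ⟨(t.P, t.Q), t.orderP, t.orderQ, t.pairing⟩⟩,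
    fun p => ⟨p.1.1, p.1.2, p.2.1.1, p.2.1.2, p.2.2.1, p.2.2.2.1, p.2.2.2.2⟩,
    fun t => rfl, fun p => rfl⟩

variable {E : WeierstrassCurve F} [E.IsElliptic] {ζ : F} {m n : ℕ}

lemma addOrderOf_div_nsmul {B : Type*} [AddCommGroup B] (hn : n ≠ 0) (hmn : m ∣ n)
    {Q : B} (hQ : addOrderOf Q = n) : addOrderOf ((n / m) • Q) = m := by
  have hm : m ≠ 0 := ne_zero_of_dvd_ne_zero hn hmn
  rw [addOrderOf_nsmul_of_dvd (Nat.div_pos (Nat.le_of_dvd (Nat.pos_of_ne_zero hn) hmn)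
    (Nat.pos_of_ne_zero hm)).ne' (by rw [hQ]; exact Nat.div_dvd_of_dvd hmn), hQ,
    Nat.div_div_self hmn hn]

/-- The pair makes the full m-torsion rational, so m ∣ d. The full d-torsion is rational by the
shape of the group, so the d-th roots of unity lie in F and d ∣ q − 1. -/
lemma exists_torsion_equiv_of_pairs (hn : n ≠ 0) (hmn : m ∣ n) (hζ : IsPrimitiveRoot ζ m)
    (p : Pairs E ζ m n) : ∃ d, m ∣ d ∧ d ∣ Nat.gcd n (Nat.card F - 1) ∧
      Nonempty (tors E.toAffine.Point n ≃+ ZMod d × ZMod n) := by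
  obtain ⟨⟨P, Q⟩, hP, hQ, hPQ⟩ := p
  dsimp only at hP hQ hPQ
  have hm : m ≠ 0 := ne_zero_of_dvd_ne_zero hn hmn
  obtain ⟨d, hdn, ⟨e⟩⟩ := exists_torsion_equiv hn hQ
  have hd : d ≠ 0 := ne_zero_of_dvd_ne_zero hn hdn
  refine ⟨d, ?_, Nat.dvd_gcd hdn ?_, ⟨e⟩⟩
  · have h1 := card_tors_of_isWeilPairing (AlgebraicClosure F) hm hP
      (addOrderOf_div_nsmul hn hmn hQ) hζ hPQ
    rw [card_tors_of_equiv hd hn e hmn, pow_two] at h1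
    have h2 := mul_right_cancel₀ hm h1
    exact h2 ▸ Nat.gcd_dvd_right m d
  · have h1 := card_tors_of_equiv hd hn e hdn
    rw [Nat.gcd_self, ← pow_two] at h1
    exact dvd_card_sub_one (AlgebraicClosure F) hd h1 (addOrderOf_div_nsmul hn hdn hQ)

/-- Projecting to Q, every fibre has m elements, because m ∣ d makes E[m] rational and (n/m)Q has
order m. The points Q are the elements of order n in ℤ/d × ℤ/n. -/
lemma card_pairs_of_equiv (hn : n ≠ 0) (hζ : IsPrimitiveRoot ζ m) {d : ℕ} (hmd : m ∣ d)
    (hdn : d ∣ n) (e : tors E.toAffine.Point n ≃+ ZMod d × ZMod n) :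
    (Nat.card (Pairs E ζ m n) : ℚ) = m * Nat.totient n * psi n / psi (n / d) := by
  have hd : d ≠ 0 := ne_zero_of_dvd_ne_zero hn hdn
  have hm : m ≠ 0 := ne_zero_of_dvd_ne_zero hd hmd
  have hmn : m ∣ n := hmd.trans hdn
  have hc := card_tors_of_equiv hd hn e hmn
  rw [Nat.gcd_eq_left hmd, ← pow_two] at hc
  have h1 : Nat.card (Pairs E ζ m n) =
      Nat.card {Q : E.toAffine.Point // addOrderOf Q = n} * Nat.card (Fin m) := by
    refine card_eq_mul_of_fiber (fun p => ⟨p.1.2, p.2.2.1⟩) ?_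
    rintro ⟨Q, hQ⟩
    have h2 := card_isWeilPairing (AlgebraicClosure F) hm hc (addOrderOf_div_nsmul hn hmn hQ) hζ
    refine Finite.card_eq.mp (Eq.trans (Nat.card_congr ?_) (h2.trans (Nat.card_fin m).symm))
    refine ⟨fun p => ⟨p.1.1.1, p.1.2.1, ?_⟩, fun P => ⟨⟨(P.1, Q), P.2.1, hQ, P.2.2⟩, rfl⟩,
      fun p => ?_, fun P => rfl⟩
    · have h3 : p.1.1.2 = Q := congrArg Subtype.val p.2
      have h4 := p.1.2.2.2
      rwa [h3] at h4
    · obtain ⟨⟨⟨P, Q'⟩, hP⟩, hQ'⟩ := p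
      obtain rfl : Q' = Q := congrArg Subtype.val hQ'
      rfl
  have h2 : Nat.card {Q : E.toAffine.Point // addOrderOf Q = n} =
      Nat.card {x : ZMod d × ZMod n // addOrderOf x = n} := by
    refine Nat.card_congr ((Equiv.symm ?_).trans (e.toEquiv.subtypeEquiv (p := fun x =>
      addOrderOf x = n) fun x => ?_))
    · exact ⟨fun x => ⟨x.1.1, (addOrderOf_tors x.1).symm.trans x.2⟩,
        fun Q => ⟨⟨Q.1, mem_tors.mpr (by
          have := addOrderOf_nsmul_eq_zero Q.1
          rwa [Q.2] at this)⟩,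
          (addOrderOf_tors _).trans Q.2⟩, fun x => rfl, fun Q => rfl⟩
    · change _ ↔ addOrderOf (e x) = n
      rw [AddEquiv.addOrderOf_eq]
  rw [h1, Nat.card_fin, h2, Nat.cast_mul, card_addOrderOf_eq hn hdn]
  ring

/-- The group E[n](F) has order dn, so d is determined by the curve and at most one term of the sum
is nonzero. -/
lemma card_pairs (hn : n ≠ 0) (hmn : m ∣ n) (hζ : IsPrimitiveRoot ζ m) :
    (Nat.card (Pairs E ζ m n) : ℚ) =
      ∑ d ∈ (Nat.gcd n (Nat.card F - 1)).divisors with m ∣ d,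
        if Nonempty (tors E.toAffine.Point n ≃+ ZMod d × ZMod n) then
          m * Nat.totient n * psi n / psi (n / d) else 0 := by
  by_cases h : ∃ d, m ∣ d ∧ d ∣ Nat.gcd n (Nat.card F - 1) ∧
      Nonempty (tors E.toAffine.Point n ≃+ ZMod d × ZMod n)
  · obtain ⟨d, hmd, hd, ⟨e⟩⟩ := h
    rw [Finset.sum_eq_single d, if_pos ⟨e⟩,
      card_pairs_of_equiv hn hζ hmd (hd.trans (Nat.gcd_dvd_left _ _)) e]
    · intro d' _ hne
      refine if_neg ?_
      rintro ⟨e'⟩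
      apply hne
      have h1 := Nat.card_congr (e'.symm.trans e).toEquiv
      rw [Nat.card_prod, Nat.card_prod, Nat.card_zmod, Nat.card_zmod, Nat.card_zmod] at h1
      exact mul_right_cancel₀ hn h1
    · intro h1
      refine absurd (Finset.mem_filter.mpr ⟨Nat.mem_divisors.mpr ⟨hd, ?_⟩, hmd⟩) h1
      exact Nat.gcd_ne_zero_left hn
  · rw [Finset.sum_eq_zero]
    · rw [Nat.cast_eq_zero, Nat.card_eq_zero]
      exact Or.inl ⟨fun p => h (exists_torsion_equiv_of_pairs hn hmn hζ p)⟩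
    · intro d hd
      obtain ⟨hd1, hd2⟩ := Finset.mem_filter.mp hd
      exact if_neg fun hne => h ⟨d, hd2, Nat.dvd_of_mem_divisors hd1, hne⟩

end Pairs

end EllCount

end

/-! ### The formula, after multiplication by the number of changes of variables over F -/

theorem mainTheorem9 {F : Type*} [Field F] [Finite F] (q : ℕ) (hq : Nat.card F = q)
    (m n : ℕ) (hm : 0 < m) (hn : 0 < n) (hmn : m ∣ Nat.gcd n (q - 1))
    (ζ : F) (hζ : IsPrimitiveRoot ζ m) :
    (EllCount.y F ζ m n : ℚ) =
      m * Nat.totient n * EllCount.psi n *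
        ∑ d ∈ (Nat.gcd n (q - 1)).divisors with m ∣ d,
          EllCount.w F d n / EllCount.psi (n / d) := by
  classical
  subst hq
  have := Fintype.ofFinite (EllCount.EllCurve F)
  have hV : (Nat.card (WeierstrassCurve.VariableChange F) : ℚ) ≠ 0 :=
    Nat.cast_ne_zero.mpr Nat.card_pos.ne'
  apply mul_right_cancel₀ hV
  have hpairs : ∀ E : EllCount.EllCurve F, (Nat.card (EllCount.Pairs E.1 ζ m n) : ℚ) = _ :=
    fun E => have := E.2
      EllCount.card_pairs hn.ne' (hmn.trans (Nat.gcd_dvd_left _ _)) hζ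
  rw [← Nat.cast_mul, ← EllCount.card_triple, EllCount.card_triple_eq_sum, Nat.cast_sum,
    Finset.sum_congr rfl fun E _ => hpairs E, Finset.sum_comm, Finset.mul_sum, Finset.sum_mul]
  refine Finset.sum_congr rfl fun d _ => ?_
  -- After exchanging the sums, each d contributes a constant times the number of equations with
  -- torsion ℤ/d × ℤ/n, which is w(d, n)·#G(F).
  rw [← Finset.sum_filter, Finset.sum_const, nsmul_eq_mul]
  have h1 := EllCount.w_mul_card (F := F) d n
  rw [Nat.card_eq_fintype_card (α := {E : EllCount.EllCurve F // _}), Fintype.card_subtype] at h1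
  refine (congrArg (· * _) h1.symm).trans ?_
  ring
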